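/- Let $\omega:\mathbb R^2\to\mathbb R$ be Lipschitz continuous, let $D=\{(x',x_3)\in\mathbb R^2\times\mathbb R:\ x_3>\omega(x')\}$, and assume that the $x_1$-axis $L=\{x\in\mathbb R^3: x_2=x_3=0\}$ is contained in $\partial D$. Put $r(x)=\mathrm{dist}(x,L)$. For $G=D$ or $G=\mathbb R^3$, $l\in\mathbb N_0$, $\delta\in\mathbb R$ and $1\le p<\infty$, let $V^{l,p}_\delta(G)$ be the closure of $\{\varphi|_G:\varphi\in C_0^\infty(\mathbb R^3\setminus L)\}$ with respect to the norm $$\|u\|_{V^{l,p}_\delta(G)}=\Big(\int_G\sum_{|\alpha|\le l}r(x)^{p(\delta-l+|\alpha|)}|\partial^\alpha u(x)|^p\,dx\Big)^{1/p},$$ realized as a space of real functions (modulo equality a.e. on $G$) with weak derivatives $\partial^\alpha u$ on $G\setminus L$. Call $\psi:[1,\infty)\to\mathbb R$ admissible if it is smooth, $\sup_{\lambda\ge1}\lambda^N|\psi(\lambda)|<\infty$ for every $N\in\mathbb N_0$, $\int_1^\infty\psi(\lambda)\,d\lambda=1$ and $\int_1^\infty\lambda^k\psi(\lambda)\,d\lambda=0$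 for every integer $k\ge1$. Call $\delta^*$ admissible if $\delta^*=2c\Delta$ on $\mathbb R^3\setminus\overline D$, where $\Delta$ is smooth on $\mathbb R^3\setminus\overline D$ and, for some constants $C_1,C_2>0$, $B_\alpha$ and $c$, all $x=(x',x_3)\in\mathbb R^3\setminus\overline D$ and all multi-indices $\alpha$, $$C_1\,\mathrm{dist}(x,\partial D)\le\Delta(x)\le C_2\,\mathrm{dist}(x,\partial D),\qquad |\partial^\alpha\Delta(x)|\le B_\alpha\,\mathrm{dist}(x,\partial D)^{1-|\alpha|},\qquad \omega(x')-x_3\le c\,\Delta(x).$$ Then admissible $\psi$ and $\delta^*$ exist, and for every such pair, Stein's operator $$\mathfrak E u(x',x_3)=\int_1^\infty u\big(x',x_3+\lambda\,\delta^*(x',x_3)\big)\psi(\lambda)\,d\lambda\quad(x_3<\omega(x')),\qquad \mathfrak E u=u\ \text{ on }D,$$ is a universal bounded linear extension operator: this one operator, which does not depend on $l,\delta,p$, is, for all $l\in\mathbb N_0$, $\delta\in\mathbb R$ and $1\le p<\infty$, well defined (modulo equality a.e.) and linear from $V^{l,p}_\delta(D)$ to $V^{l,p}_\delta(\mathbb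 R^3)$, satisfies $\mathfrak Eu=u$ a.e. on $D$, and $$\|\mathfrak Eu\|_{V^{l,p}_\delta(\mathbb R^3)}\le C\,\|u\|_{V^{l,p}_\delta(D)}\qquad\text{for all }u\in V^{l,p}_\delta(D),$$ where the constant $C$ does not depend on $u$. -/

import Mathlib

open MeasureTheory Set
open scoped ENNReal NNReal ContDiff

noncomputable section

/-- Euclidean three-space; the coordinates `x₁, x₂, x₃` are `x 0, x 1, x 2`. -/
abbrev R3 : Type := EuclideanSpace ℝ (Fin 3)

/-- The `x₁`-axis. -/
def axis : Set R3 := {x | x 1 = 0 ∧ x 2 = 0}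

/-- The distance `r(x)` of `x` to the `x₁`-axis. -/
def axisDist (x : R3) : ℝ := Metric.infDist x axis

/-- The horizontal part `x' = (x₁, x₂)` of `x`. -/
def horiz (x : R3) : EuclideanSpace ℝ (Fin 2) := !₂[x 0, x 1]

/-- The region above the graph of `w`. -/
def aboveGraph (w : EuclideanSpace ℝ (Fin 2) → ℝ) : Set R3 := {x | w (horiz x) < x 2}

/-- The classical partial derivative with respect to the `i`-th coordinate. -/
def partialD (i : Fin 3) (f : R3 → ℝ) : R3 → ℝ :=
  fun x => fderiv ℝ f x (EuclideanSpace.single i 1)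

/-- The order `|α|` of a multi-index. -/
def order (α : Fin 3 → ℕ) : ℕ := ∑ i, α i

/-- The classical partial derivative `∂^α`. -/
def multiD (α : Fin 3 → ℕ) (f : R3 → ℝ) : R3 → ℝ :=
  (partialD 0)^[α 0] ((partialD 1)^[α 1] ((partialD 2)^[α 2] f))

/-- The finite set of multi-indices of order at most `l`. -/
def multiIdx (l : ℕ) : Finset (Fin 3 → ℕ) :=
  (Fintype.piFinset fun _ : Fin 3 => Finset.range (l + 1)).filter fun α => order α ≤ l

theorem mem_multiIdx (l : ℕ) (α : Fin 3 → ℕ) : α ∈ multiIdx l ↔ order α ≤ l := by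
  simp only [multiIdx, Finset.mem_filter, Fintype.mem_piFinset, Finset.mem_range,
    and_iff_right_iff_imp]
  intro h i
  have : α i ≤ order α := Finset.single_le_sum (fun _ _ => Nat.zero_le _) (Finset.mem_univ i)
  omega

/-- `φ ∈ C₀^∞(U)`. -/
structure IsTestFunction (U : Set R3) (φ : R3 → ℝ) : Prop where
  smooth : ContDiff ℝ ∞ φ
  compact : HasCompactSupport φ
  support : tsupport φ ⊆ U

/-- `v` is the weak derivative `∂^α u` on the open set `U`. -/
structure HasWeakDeriv (U : Set R3) (α : Fin 3 → ℕ) (u v : R3 → ℝ) : Prop where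
  left : LocallyIntegrableOn u U
  right : LocallyIntegrableOn v U
  parts : ∀ φ, IsTestFunction U φ →
    ∫ x in U, u x * multiD α φ x = (-1) ^ order α * ∫ x in U, v x * φ x

open Classical in
/-- A representative of the weak derivative `∂^α u` on `U` (it is unique up to null sets); the
value `0` is used where there is none. -/
def weakD (U : Set R3) (α : Fin 3 → ℕ) (u : R3 → ℝ) : R3 → ℝ :=
  if h : ∃ v, HasWeakDeriv U α u v then h.choose else 0

/-- The norm of `V_δ^{l,p}(G)`,
`(∫_G ∑_{|α| ≤ l} r^{p(δ-l+|α|)} |∂^α u|^p dx)^{1/p}`, with values in `[0, ∞]`.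
Derivatives are taken off the axis, where alone the elements of the space are locally integrable
in general; the axis is a null set. -/
def vNorm (G : Set R3) (l : ℕ) (δ p : ℝ) (u : R3 → ℝ) : ℝ≥0∞ :=
  (∫⁻ x in G, ∑ α ∈ multiIdx l,
    ENNReal.ofReal (axisDist x ^ (p * (δ - l + order α)) * |weakD (G \ axis) α u x| ^ p)) ^ (1 / p)

/-- `u ∈ V_δ^{l,p}(G)`: the closure, with respect to `vNorm`, of the restrictions to `G` of the
functions in `C₀^∞(ℝ³ ∖ axis)`. Functions are identified when they agree almost everywhere
on `G`; the values of `u` outside `G` play no role. -/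
structure MemV (G : Set R3) (l : ℕ) (δ p : ℝ) (u : R3 → ℝ) : Prop where
  weak : ∀ α ∈ multiIdx l, ∃ v, HasWeakDeriv (G \ axis) α u v
  finite : vNorm G l δ p u < ⊤
  approx : ∀ ε : ℝ≥0∞, 0 < ε → ∃ φ, IsTestFunction axisᶜ φ ∧ vNorm G l δ p (u - φ) < ε

/-- `Δ` is a regularized version, on the complement of the closure of `D`, of the distance
to the boundary of `D`. -/
structure IsRegularizedDist (D : Set R3) (Δ : R3 → ℝ) : Prop where
  smooth : ContDiffOn ℝ ∞ Δ (closure D)ᶜ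
  comparable : ∃ C₁ C₂ : ℝ, 0 < C₁ ∧ 0 < C₂ ∧ ∀ x ∉ closure D,
    C₁ * Metric.infDist x (frontier D) ≤ Δ x ∧ Δ x ≤ C₂ * Metric.infDist x (frontier D)
  deriv_bound : ∀ α : Fin 3 → ℕ, ∃ B : ℝ, ∀ x ∉ closure D,
    |multiD α Δ x| ≤ B * Metric.infDist x (frontier D) ^ (1 - (order α : ℤ))

/-- `δs` is an admissible function `δ^*` for Stein's operator: `δ^* = 2 c Δ` with a regularized
distance `Δ` and a constant `c` such that `w(x') - x₃ ≤ c Δ(x)` below the graph of `w`. -/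
def IsSteinDist (w : EuclideanSpace ℝ (Fin 2) → ℝ) (δs : R3 → ℝ) : Prop :=
  ∃ (Δ : R3 → ℝ) (c : ℝ), IsRegularizedDist (aboveGraph w) Δ ∧
    ∀ x ∉ closure (aboveGraph w), w (horiz x) - x 2 ≤ c * Δ x ∧ δs x = 2 * c * Δ x

/-- The averaging kernels `ψ : [1, ∞) → ℝ` of Stein's operator: smooth, decaying faster than every
power, with integral one and all higher moments zero. -/
structure IsSteinKernel (ψ : ℝ → ℝ) : Prop where
  smooth : ContDiffOn ℝ ∞ ψ (Ici 1)
  decay : ∀ N : ℕ, ∃ A : ℝ, ∀ t : ℝ, 1 ≤ t → t ^ N * |ψ t| ≤ A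
  mass : ∫ t in Ioi (1 : ℝ), ψ t = 1
  moments : ∀ k : ℕ, 1 ≤ k → ∫ t in Ioi (1 : ℝ), t ^ k * ψ t = 0

/-- Stein's operator: below the graph of `w`,
`(E u)(x', x₃) = ∫_1^∞ u(x', x₃ + t δ^*(x', x₃)) ψ(t) dt`, and `E u = u` elsewhere
(the graph itself is a null set). -/
def steinExt (w : EuclideanSpace ℝ (Fin 2) → ℝ) (δs : R3 → ℝ) (ψ : ℝ → ℝ) (u : R3 → ℝ) : R3 → ℝ :=
  fun x => if x 2 < w (horiz x) then
    ∫ t in Ioi (1 : ℝ), u (x + EuclideanSpace.single 2 (t * δs x)) * ψ t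
  else u x

/-- `E` is a bounded linear extension operator from `V_δ^{l,p}(D)` to `V_δ^{l,p}(ℝ³)`, well defined
on functions modulo equality almost everywhere. -/
structure IsBoundedExtension (D : Set R3) (l : ℕ) (δ p : ℝ) (E : (R3 → ℝ) → R3 → ℝ) : Prop where
  congr_ae : ∀ u v, MemV D l δ p u → MemV D l δ p v →
    u =ᵐ[volume.restrict D] v → E u =ᵐ[volume] E v
  linear : ∀ u v, MemV D l δ p u → MemV D l δ p v → ∀ a b : ℝ,
    E (a • u + b • v) =ᵐ[volume] a • E u + b • E v
  extends_fun : ∀ u, MemV D l δ p u → E u =ᵐ[volume.restrict D] u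
  maps : ∀ u, MemV D l δ p u → MemV univ l δ p (E u)
  bounded : ∃ C : ℝ≥0, ∀ u, MemV D l δ p u → vNorm univ l δ p (E u) ≤ C * vNorm D l δ p u

end

/-! Write d(x) = ω(x') − x₃ for the depth of x below the graph and η for the step δ*. Both the graph
and the axis lie in the zero set of the Lipschitz function d, so |d| is bounded by a multiple of r.
This is the only way in which the axis interacts with the domain.

The central point is that derivatives of an average are controlled by averages of derivatives of the
same order, so that each derivative keeps its own weight exponent δ − l + |α|. Differentiating ∫ φ(x
+ tη e₃) ψ(t) dt gives the average of the derivative plus terms a(x) ∫ ∂^L φ(x + tη e₃) θ(t) dt,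
where a is of size d^{-m}, |L| + m is the order of differentiation, and θ has only vanishing
moments, because the inner derivative of the shift brings out a factor t
(`exists_listD_kernelAvg_eq`). The primitive of such a θ is again of this kind
(`IsNull.isNull_primitive`), so m integrations by parts in t turn the missing m derivatives into
vertical ones and gain η^m, which cancels the blow-up of a (`IsRemainder.exists_enorm_le`).

The averages are bounded on weighted L^p: along the half-line above x the weight changes by at most
a power of t, which the decay of the kernel absorbs (`IsStep.exists_axisDist_rpow_le`); Jensen's
inequality for the probability measure t⁻² dt reduces p to 1; and Tonelli's theorem after a vertical
shear settles p = 1, where η ≥ 2d is used (`IsStep.exists_lintegral_avg_le`).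

For a test function φ, Taylor's formula and the moment conditions show that 𝔈φ − φ vanishes to
infinite order at the graph, so 𝔈φ is smooth on the whole space. It need not vanish near the axis,
but it is O(r^N) there with all derivatives and for every N, so cutting it off near the axis gives
approximating test functions (`isAxisFlat_steinExt`, `IsAxisFlat.tendsto_wInt`). For general u one
approximates by test functions: the derivatives of their extensions are Cauchy, and the order-zero
bound, valid for measurable functions, identifies the limit as 𝔈u (`IsStep.exists_approx_steinExt`).

A kernel ψ comes from the log-normal density times sin(2π log x), all of whose moments vanish;
dividing by a suitable power of t restores the mass (`exists_isSteinKernel`). A regularized distance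
comes from averaging over balls whose radius is governed by the depth at the centre
(`exists_isRegularizedDist`). -/

/-! ### Iterated partial derivatives and the Leibniz rule. -/

/-- The iterated partial derivative along a list of coordinates, the head being outermost. -/
noncomputable def listD : List (Fin 3) → (R3 → ℝ) → R3 → ℝ
  | [], f => f
  | i :: L, f => partialD i (listD L f)

@[simp] theorem listD_nil (f : R3 → ℝ) : listD [] f = f := rfl

@[simp] theorem listD_cons (i : Fin 3) (L : List (Fin 3)) (f : R3 → ℝ) :
    listD (i :: L) f = partialD i (listD L f) := rfl

theorem listD_append (L L' : List (Fin 3)) (f : R3 → ℝ) :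
    listD (L ++ L') f = listD L (listD L' f) := by
  induction L with
  | nil => rfl
  | cons i L ih => simp [ih]

theorem listD_replicate (n : ℕ) (i : Fin 3) (f : R3 → ℝ) :
    listD (List.replicate n i) f = (partialD i)^[n] f := by
  induction n with
  | zero => rfl
  | succ n ih => rw [List.replicate_succ, listD_cons, ih, Function.iterate_succ_apply']

/-- The list of coordinates, in increasing order, with multiplicities given by `α`. -/
def multiList (α : Fin 3 → ℕ) : List (Fin 3) :=
  List.replicate (α 0) 0 ++ (List.replicate (α 1) 1 ++ List.replicate (α 2) 2)

theorem multiD_eq_listD (α : Fin 3 → ℕ) (f : R3 → ℝ) : multiD α f = listD (multiList α) f := by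
  simp [multiD, multiList, listD_append, listD_replicate]

theorem length_multiList (α : Fin 3 → ℕ) : (multiList α).length = order α := by
  simp [multiList, order, Fin.sum_univ_three, add_assoc]

theorem partialD_congr {U : Set R3} (hU : IsOpen U) {f g : R3 → ℝ} (h : EqOn f g U) (i : Fin 3) :
    EqOn (partialD i f) (partialD i g) U := by
  intro x hx
  have : f =ᶠ[nhds x] g := Filter.eventuallyEq_of_mem (hU.mem_nhds hx) h
  simp [partialD, this.fderiv_eq]

theorem listD_congr {U : Set R3} (hU : IsOpen U) {f g : R3 → ℝ} (h : EqOn f g U)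
    (L : List (Fin 3)) : EqOn (listD L f) (listD L g) U := by
  induction L with
  | nil => exact h
  | cons i L ih => exact partialD_congr hU ih i

theorem ContDiffOn.partialD {U : Set R3} (hU : IsOpen U) {f : R3 → ℝ} (h : ContDiffOn ℝ ∞ f U)
    (i : Fin 3) : ContDiffOn ℝ ∞ (partialD i f) U :=
  (h.fderiv_of_isOpen hU (m := ∞) (by simp)).clm_apply contDiffOn_const

theorem ContDiffOn.listD {U : Set R3} (hU : IsOpen U) {f : R3 → ℝ} (h : ContDiffOn ℝ ∞ f U)
    (L : List (Fin 3)) : ContDiffOn ℝ ∞ (listD L f) U := by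
  induction L with
  | nil => exact h
  | cons i L ih => exact ih.partialD hU i

theorem ContDiff.partialD {f : R3 → ℝ} (h : ContDiff ℝ ∞ f) (i : Fin 3) :
    ContDiff ℝ ∞ (partialD i f) :=
  contDiffOn_univ.1 ((contDiffOn_univ.2 h).partialD isOpen_univ i)

theorem ContDiff.listD {f : R3 → ℝ} (h : ContDiff ℝ ∞ f) (L : List (Fin 3)) :
    ContDiff ℝ ∞ (listD L f) :=
  contDiffOn_univ.1 ((contDiffOn_univ.2 h).listD isOpen_univ L)

theorem ContDiffOn.differentiableAt_of_isOpen {U : Set R3} (hU : IsOpen U) {f : R3 → ℝ}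
    (h : ContDiffOn ℝ ∞ f U) {x : R3} (hx : x ∈ U) : DifferentiableAt ℝ f x :=
  ((h x hx).contDiffAt (hU.mem_nhds hx)).differentiableAt (by simp)

theorem partialD_add {f g : R3 → ℝ} {x : R3} (hf : DifferentiableAt ℝ f x)
    (hg : DifferentiableAt ℝ g x) (i : Fin 3) :
    partialD i (fun y => f y + g y) x = partialD i f x + partialD i g x := by
  simp [partialD, fderiv_fun_add hf hg]

theorem partialD_mul {f g : R3 → ℝ} {x : R3} (hf : DifferentiableAt ℝ f x)
    (hg : DifferentiableAt ℝ g x) (i : Fin 3) :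
    partialD i (fun y => f y * g y) x = partialD i f x * g x + f x * partialD i g x := by
  simp [partialD, fderiv_fun_mul hf hg]; ring

theorem partialD_const_mul {f : R3 → ℝ} {x : R3} (hf : DifferentiableAt ℝ f x) (c : ℝ)
    (i : Fin 3) : partialD i (fun y => c * f y) x = c * partialD i f x := by
  simp [partialD, fderiv_const_mul hf c]

theorem partialD_const (c : ℝ) (i : Fin 3) : partialD i (fun _ => c) = fun _ => 0 := by
  ext x; simp [partialD]

theorem fderiv_eq_sum_partialD (f : R3 → ℝ) (x v : R3) :
    fderiv ℝ f x v = ∑ i, v i * partialD i f x := by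
  have hv : v = ∑ i, v i • EuclideanSpace.single i (1 : ℝ) := by
    ext j; fin_cases j <;> simp [Fin.sum_univ_three]
  conv_lhs => rw [hv]
  simp [partialD]

theorem listD_add {U : Set R3} (hU : IsOpen U) {f g : R3 → ℝ} (hf : ContDiffOn ℝ ∞ f U)
    (hg : ContDiffOn ℝ ∞ g U) (L : List (Fin 3)) :
    EqOn (listD L (fun y => f y + g y)) (fun y => listD L f y + listD L g y) U := by
  induction L with
  | nil => exact fun _ _ => rfl
  | cons i L ih =>
    intro x hx
    rw [listD_cons, partialD_congr hU ih i hx]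
    exact partialD_add ((hf.listD hU L).differentiableAt_of_isOpen hU hx)
      ((hg.listD hU L).differentiableAt_of_isOpen hU hx) i

theorem listD_const_mul {U : Set R3} (hU : IsOpen U) {f : R3 → ℝ} (hf : ContDiffOn ℝ ∞ f U)
    (c : ℝ) (L : List (Fin 3)) :
    EqOn (listD L (fun y => c * f y)) (fun y => c * listD L f y) U := by
  induction L with
  | nil => exact fun _ _ => rfl
  | cons i L ih =>
    intro x hx
    rw [listD_cons, partialD_congr hU ih i hx]
    exact partialD_const_mul ((hf.listD hU L).differentiableAt_of_isOpen hU hx) c i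

theorem listD_sub {U : Set R3} (hU : IsOpen U) {f g : R3 → ℝ} (hf : ContDiffOn ℝ ∞ f U)
    (hg : ContDiffOn ℝ ∞ g U) (L : List (Fin 3)) :
    EqOn (listD L (fun y => f y - g y)) (fun y => listD L f y - listD L g y) U := by
  intro x hx
  have h1 := listD_add hU hf (contDiffOn_const.mul hg : ContDiffOn ℝ ∞ (fun y => (-1 : ℝ) * g y) U)
    L hx
  simp only [listD_const_mul hU hg (-1) L hx] at h1
  simpa [sub_eq_add_neg] using h1

/-- Products of functions that behave like powers of a weight `ρ` behave in the same way. -/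
theorem abs_listD_mul_le {U : Set R3} (hU : IsOpen U) {ρ : R3 → ℝ} (hρ : ∀ x ∈ U, 0 < ρ x)
    (n : ℕ) : ∀ (f g : R3 → ℝ), ContDiffOn ℝ ∞ f U → ContDiffOn ℝ ∞ g U → ∀ (a b : ℤ) (A B : ℝ),
    (∀ L, L.length ≤ n → ∀ x ∈ U, |listD L f x| ≤ A * ρ x ^ (a - L.length)) →
    (∀ L, L.length ≤ n → ∀ x ∈ U, |listD L g x| ≤ B * ρ x ^ (b - L.length)) →
    ∀ L, L.length ≤ n → ∀ x ∈ U,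
      |listD L (fun y => f y * g y) x| ≤ 2 ^ L.length * (A * B) * ρ x ^ (a + b - L.length) := by
  have zero : ∀ (f g : R3 → ℝ) (a b : ℤ) (A B : ℝ),
      (∀ x ∈ U, |f x| ≤ A * ρ x ^ a) → (∀ x ∈ U, |g x| ≤ B * ρ x ^ b) →
      ∀ x ∈ U, |f x * g x| ≤ A * B * ρ x ^ (a + b) := by
    intro f g a b A B hf hg x hx
    rw [abs_mul, zpow_add₀ (hρ x hx).ne']
    calc _ ≤ (A * ρ x ^ a) * (B * ρ x ^ b) :=
          mul_le_mul (hf x hx) (hg x hx) (abs_nonneg _) ((abs_nonneg _).trans (hf x hx))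
      _ = _ := by ring
  induction n with
  | zero =>
    intro f g _ _ a b A B hA hB L hL x hx
    obtain rfl : L = [] := List.length_eq_zero_iff.1 (by omega)
    simpa using zero f g a b A B (by simpa using hA [] le_rfl) (by simpa using hB [] le_rfl) x hx
  | succ n ih =>
    intro f g hf hg a b A B hA hB L hL x hx
    -- The innermost derivative is split off, so that the product rule applies to f g itself and the
    -- induction hypothesis to the two products ∂f · g and f · ∂g.
    rcases List.eq_nil_or_concat L with rfl | ⟨L, i, rfl⟩
    · simpa using zero f g a b A B (by simpa using hA [] (by simp))
        (by simpa using hB [] (by simp)) x hx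
    · simp only [List.concat_eq_append] at hL ⊢
      have hL' : L.length ≤ n := by simpa using hL
      have e : EqOn (partialD i (fun y => f y * g y))
          (fun y => partialD i f y * g y + f y * partialD i g y) U := fun y hy =>
        partialD_mul (hf.differentiableAt_of_isOpen hU hy) (hg.differentiableAt_of_isOpen hU hy) i
      rw [listD_append, listD_cons, listD_nil, listD_congr hU e L hx,
        listD_add hU ((hf.partialD hU i).mul hg) (hf.mul (hg.partialD hU i)) L hx]
      have s : ∀ (f : R3 → ℝ) (a : ℤ) (A : ℝ),
          (∀ L, L.length ≤ n + 1 → ∀ x ∈ U, |listD L f x| ≤ A * ρ x ^ (a - L.length)) →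
          ∀ L, L.length ≤ n → ∀ x ∈ U,
            |listD L (partialD i f) x| ≤ A * ρ x ^ (a - 1 - L.length) := by
        intro f a A h L hL x hx
        have := h (L ++ [i]) (by simpa using hL) x hx
        have e : a - 1 - (L.length : ℤ) = a - ((L ++ [i]).length : ℤ) := by
          push_cast [List.length_append, List.length_singleton]; ring
        rw [listD_append] at this
        rw [e]
        exact this
      have h1 := ih _ _ (hf.partialD hU i) hg (a - 1) b A B (s f a A hA)
        (fun L hL => hB L (by omega)) L hL' x hx
      have h2 := ih _ _ hf (hg.partialD hU i) a (b - 1) A B (fun L hL => hA L (by omega))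
        (s g b B hB) L hL' x hx
      have e1 : a - 1 + b - (L.length : ℤ) = a + b - ((L ++ [i]).length : ℤ) := by
        push_cast [List.length_append, List.length_singleton]; ring
      have e2 : a + (b - 1) - (L.length : ℤ) = a + b - ((L ++ [i]).length : ℤ) := by
        simp only [List.length_append, List.length_singleton]; push_cast; ring
      rw [e1] at h1; rw [e2] at h2
      refine (abs_add_le _ _).trans ((add_le_add h1 h2).trans_eq ?_)
      generalize ρ x ^ (a + b - ((L ++ [i]).length : ℤ)) = R
      rw [List.length_append, List.length_singleton, pow_succ]; ring

theorem partialD_comm {U : Set R3} (hU : IsOpen U) {f : R3 → ℝ} (hf : ContDiffOn ℝ ∞ f U)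
    (i j : Fin 3) : EqOn (partialD i (partialD j f)) (partialD j (partialD i f)) U := by
  intro x hx
  have hc : ContDiffAt ℝ ∞ f x := (hf x hx).contDiffAt (hU.mem_nhds hx)
  have hsym : IsSymmSndFDerivAt ℝ f x := hc.isSymmSndFDerivAt (by simpa using WithTop.coe_le_coe.2 (le_top : (2 : ℕ∞) ≤ ⊤))
  have hd : DifferentiableAt ℝ (fderiv ℝ f) x :=
    (hc.fderiv_right (m := ∞) (by simp)).differentiableAt (by simp)
  have key : ∀ v w : R3, fderiv ℝ (fun y => fderiv ℝ f y v) x w = fderiv ℝ (fderiv ℝ f) x w v := by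
    intro v w
    rw [fderiv_clm_apply hd (by fun_prop)]
    simp
  change fderiv ℝ (fun y => fderiv ℝ f y _) x _ = fderiv ℝ (fun y => fderiv ℝ f y _) x _
  rw [key, key]
  exact hsym.eq _ _

theorem listD_perm {U : Set R3} (hU : IsOpen U) {f : R3 → ℝ} (hf : ContDiffOn ℝ ∞ f U)
    {L L' : List (Fin 3)} (h : L.Perm L') : EqOn (listD L f) (listD L' f) U := by
  induction h with
  | nil => exact fun _ _ => rfl
  | cons i _ ih => exact partialD_congr hU ih i
  | swap i j L => exact partialD_comm hU (hf.listD hU L) j i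
  | trans _ _ h1 h2 => exact h1.trans h2

/-- The multi-index counting the occurrences of each coordinate. -/
def listIdx (L : List (Fin 3)) : Fin 3 → ℕ := fun i => L.count i

theorem multiList_listIdx_perm (L : List (Fin 3)) : (multiList (listIdx L)).Perm L := by
  rw [List.perm_iff_count]
  intro i
  fin_cases i <;> simp [multiList, listIdx, List.count_replicate]

theorem order_listIdx (L : List (Fin 3)) : order (listIdx L) = L.length := by
  rw [← length_multiList, (multiList_listIdx_perm L).length_eq]

/-- Symmetry of second derivatives allows sorting the list. Lists suit inductions that add one
derivative at a time; multi-indices are what the norms sum over. -/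
theorem listD_eq_multiD {U : Set R3} (hU : IsOpen U) {f : R3 → ℝ} (hf : ContDiffOn ℝ ∞ f U)
    (L : List (Fin 3)) : EqOn (listD L f) (multiD (listIdx L) f) U := by
  rw [multiD_eq_listD]
  exact listD_perm hU hf (multiList_listIdx_perm L).symm

/-! ### Geometry of the graph: depth, distance to the boundary, distance to the axis. -/

/-- The vertical height of the graph of `w` above `x`. -/
noncomputable def depth (w : EuclideanSpace ℝ (Fin 2) → ℝ) (x : R3) : ℝ := w (horiz x) - x 2

/-- The vertical vector of length `s`. -/
noncomputable def vert (s : ℝ) : R3 := EuclideanSpace.single 2 s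

theorem vert_eq_smul (s : ℝ) : vert s = s • EuclideanSpace.single (2 : Fin 3) (1 : ℝ) := by
  ext i; fin_cases i <;> simp [vert]

theorem norm_vert (s : ℝ) : ‖vert s‖ = |s| := by simp [vert]

theorem continuous_vert : Continuous vert := by
  have : vert = fun s => s • EuclideanSpace.single (2 : Fin 3) (1 : ℝ) := funext vert_eq_smul
  rw [this]; fun_prop

@[simp] theorem vert_zero : vert 0 = 0 := by simp [vert]

theorem horiz_add_vert (x : R3) (s : ℝ) : horiz (x + vert s) = horiz x := by
  ext i; fin_cases i <;> simp [horiz, vert]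

theorem norm_horiz_sub_le (x y : R3) : ‖horiz x - horiz y‖ ≤ ‖x - y‖ := by
  rw [EuclideanSpace.norm_eq, EuclideanSpace.norm_eq]
  apply Real.sqrt_le_sqrt
  simp only [Fin.sum_univ_two, Fin.sum_univ_three]
  simp [horiz]
  positivity

section
variable {M : ℝ≥0} {w : EuclideanSpace ℝ (Fin 2) → ℝ}

theorem depth_add_vert (w : EuclideanSpace ℝ (Fin 2) → ℝ) (x : R3) (s : ℝ) :
    depth w (x + vert s) = depth w x - s := by
  simp only [depth, horiz_add_vert]
  simp [vert]; ring

theorem abs_depth_sub_le (hw : LipschitzWith M w) (x y : R3) :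
    |depth w x - depth w y| ≤ (M + 1) * ‖x - y‖ := by
  have h1 : |w (horiz x) - w (horiz y)| ≤ M * ‖x - y‖ := by
    have := hw.dist_le_mul (horiz x) (horiz y)
    rw [dist_eq_norm, dist_eq_norm, Real.norm_eq_abs] at this
    exact this.trans (mul_le_mul_of_nonneg_left (norm_horiz_sub_le x y) M.2)
  have h2 : |x 2 - y 2| ≤ ‖x - y‖ := by
    simpa using PiLp.norm_apply_le (x - y) 2
  calc |depth w x - depth w y| = |(w (horiz x) - w (horiz y)) - (x 2 - y 2)| := by
        simp only [depth]; ring_nf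
    _ ≤ _ := (abs_sub _ _).trans (by linarith)

theorem continuous_depth (hw : LipschitzWith M w) : Continuous (depth w) := by
  have : LipschitzWith (M + 1) (depth w) := LipschitzWith.of_dist_le_mul fun x y => by
    rw [dist_eq_norm, dist_eq_norm, Real.norm_eq_abs]; exact abs_depth_sub_le hw x y
  exact this.continuous

theorem mem_aboveGraph_iff {x : R3} : x ∈ aboveGraph w ↔ depth w x < 0 := by
  simp [aboveGraph, depth]

theorem isOpen_aboveGraph (hw : LipschitzWith M w) : IsOpen (aboveGraph w) := by
  have : aboveGraph w = {x | depth w x < 0} := by ext; exact mem_aboveGraph_iff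
  rw [this]
  exact isOpen_lt (continuous_depth hw) continuous_const

theorem mem_closure_aboveGraph_iff (hw : LipschitzWith M w) {x : R3} :
    x ∈ closure (aboveGraph w) ↔ depth w x ≤ 0 := by
  constructor
  · intro h
    have hc : IsClosed {x | depth w x ≤ 0} := isClosed_le (continuous_depth hw) continuous_const
    exact closure_minimal (fun y hy => (mem_aboveGraph_iff.1 hy).le) hc h
  · intro h
    rw [Metric.mem_closure_iff]
    intro ε hε
    refine ⟨x + vert (ε / 2), mem_aboveGraph_iff.2 ?_, ?_⟩
    · rw [depth_add_vert]; linarith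
    · rw [dist_eq_norm, sub_add_cancel_left, norm_neg, norm_vert, abs_of_pos (by linarith)]
      linarith

theorem mem_frontier_aboveGraph_iff (hw : LipschitzWith M w) {x : R3} :
    x ∈ frontier (aboveGraph w) ↔ depth w x = 0 := by
  rw [(isOpen_aboveGraph hw).frontier_eq, mem_sdiff, mem_closure_aboveGraph_iff hw,
    mem_aboveGraph_iff, not_lt]
  exact ⟨fun h => le_antisymm h.1 h.2, fun h => ⟨h.le, h.ge⟩⟩

theorem compl_closure_aboveGraph (hw : LipschitzWith M w) :
    (closure (aboveGraph w))ᶜ = {x | 0 < depth w x} := by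
  ext x; rw [mem_compl_iff, mem_closure_aboveGraph_iff hw, not_le]; rfl

theorem isOpen_depth_pos (hw : LipschitzWith M w) : IsOpen {x | 0 < depth w x} :=
  isOpen_lt continuous_const (continuous_depth hw)

/-- The depth is Lipschitz with constant M + 1 and vanishes on S. The sets of interest are the
boundary of the domain and the axis. -/
theorem depth_le_infDist (hw : LipschitzWith M w) {S : Set R3} (hS : ∀ y ∈ S, depth w y = 0)
    (hne : S.Nonempty) (x : R3) : |depth w x| ≤ (M + 1) * Metric.infDist x S := by
  have hM : (0 : ℝ) < M + 1 := by positivity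
  rw [← div_le_iff₀' hM]
  refine (Metric.le_infDist hne).2 fun y hy => ?_
  rw [div_le_iff₀' hM, dist_eq_norm]
  simpa [hS y hy] using abs_depth_sub_le hw x y

/-- The point of the graph vertically above x is a competitor for the distance. With the Lipschitz
bound in the other direction, depth and distance are interchangeable. -/
theorem infDist_frontier_le (hw : LipschitzWith M w) {x : R3} (hx : 0 < depth w x) :
    Metric.infDist x (frontier (aboveGraph w)) ≤ depth w x := by
  refine (Metric.infDist_le_dist_of_mem
    (y := x + vert (depth w x)) ((mem_frontier_aboveGraph_iff hw).2 ?_)).trans_eq ?_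
  · rw [depth_add_vert, sub_self]
  · rw [dist_eq_norm, sub_add_cancel_left, norm_neg, norm_vert, abs_of_pos hx]

theorem depth_le_infDist_frontier (hw : LipschitzWith M w) (x : R3) :
    depth w x ≤ (M + 1) * Metric.infDist x (frontier (aboveGraph w)) := by
  refine (le_abs_self _).trans (depth_le_infDist hw
    (fun y hy => (mem_frontier_aboveGraph_iff hw).1 hy) ⟨x + vert (depth w x), ?_⟩ x)
  rw [mem_frontier_aboveGraph_iff hw, depth_add_vert, sub_self]

theorem infDist_frontier_pos (hw : LipschitzWith M w) {x : R3} (hx : 0 < depth w x) :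
    0 < Metric.infDist x (frontier (aboveGraph w)) := by
  have := depth_le_infDist_frontier hw x
  have hM : (0 : ℝ) < M + 1 := by positivity
  exact pos_of_mul_pos_right (hx.trans_le this) hM.le

theorem zero_mem_axis : (0 : R3) ∈ axis := by simp [axis]

theorem isClosed_axis : IsClosed axis := by
  have : axis = {x : R3 | x 1 = 0} ∩ {x | x 2 = 0} := rfl
  rw [this]
  exact (isClosed_eq (by fun_prop) continuous_const).inter
    (isClosed_eq (by fun_prop) continuous_const)

theorem axisDist_nonneg (x : R3) : 0 ≤ axisDist x := Metric.infDist_nonneg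

theorem axisDist_pos_iff {x : R3} : 0 < axisDist x ↔ x ∉ axis :=
  (isClosed_axis.notMem_iff_infDist_pos ⟨0, zero_mem_axis⟩).symm

theorem continuous_axisDist : Continuous axisDist := Metric.continuous_infDist_pt _

theorem axisDist_le_add (x y : R3) : axisDist x ≤ axisDist y + ‖x - y‖ := by
  rw [← dist_eq_norm]; exact Metric.infDist_le_infDist_add_dist

theorem abs_depth_le_axisDist (hw : LipschitzWith M w) (haxis : axis ⊆ frontier (aboveGraph w))
    (x : R3) : |depth w x| ≤ (M + 1) * axisDist x :=
  depth_le_infDist hw (fun _ hy => (mem_frontier_aboveGraph_iff hw).1 (haxis hy))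
    ⟨0, zero_mem_axis⟩ x

/-- Tonelli's theorem, with translation invariance of Lebesgue measure for each fixed s. -/
theorem lintegral_shear {K : R3 × ℝ → ℝ≥0∞} (hK : Measurable K) :
    ∫⁻ x, ∫⁻ s, K (x, s) = ∫⁻ y, ∫⁻ s, K (y - vert s, s) := by
  rw [lintegral_lintegral_swap (f := fun x s => K (x, s)) hK.aemeasurable,
    lintegral_lintegral_swap (f := fun y s => K (y - vert s, s))]
  · refine lintegral_congr fun s => ?_
    exact (lintegral_sub_right_eq_self (fun x => K (x, s)) (vert s)).symm
  · exact (hK.comp ((measurable_fst.sub (continuous_vert.measurable.comp measurable_snd)).prodMk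
      measurable_snd)).aemeasurable

/-- A vertical line meets the graph in one point. Integrating the indicator of the graph over
vertical shifts s ∈ (0, 1) therefore gives zero, while after the shear the same integral is the
volume of the graph. -/
theorem volume_graph (hw : LipschitzWith M w) : volume {x | depth w x = 0} = 0 := by
  have hS : MeasurableSet {x | depth w x = 0} :=
    (isClosed_eq (continuous_depth hw) continuous_const).measurableSet
  have hK : Measurable fun q : R3 × ℝ =>
      (Ioo (0 : ℝ) 1).indicator (1 : ℝ → ℝ≥0∞) q.2 *
        {x | depth w x = 0}.indicator (1 : R3 → ℝ≥0∞) (q.1 + vert q.2) := by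
    refine ((measurable_one.indicator measurableSet_Ioo).comp measurable_snd).mul
      ((measurable_one.indicator hS).comp ?_)
    exact measurable_fst.add (continuous_vert.measurable.comp measurable_snd)
  have h := lintegral_shear hK
  have h1 : ∀ x, ∫⁻ s, (Ioo (0 : ℝ) 1).indicator (1 : ℝ → ℝ≥0∞) s *
      {x | depth w x = 0}.indicator (1 : R3 → ℝ≥0∞) (x + vert s) = 0 := by
    intro x
    refine (lintegral_congr_ae (g := fun _ => 0) ?_).trans lintegral_zero
    have : ∀ᵐ s : ℝ, s ≠ depth w x := by simp [ae_iff]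
    filter_upwards [this] with s hs
    have : ¬ depth w (x + vert s) = 0 := by
      rw [depth_add_vert]; intro h; exact hs (by linarith)
    simp [this]
  simp only [h1, sub_add_cancel, lintegral_zero] at h
  have h2 : ∀ y : R3, ∫⁻ s, (Ioo (0 : ℝ) 1).indicator (1 : ℝ → ℝ≥0∞) s *
      {x | depth w x = 0}.indicator (1 : R3 → ℝ≥0∞) y =
      {x | depth w x = 0}.indicator (1 : R3 → ℝ≥0∞) y := by
    intro y
    rw [lintegral_mul_const _ (measurable_one.indicator measurableSet_Ioo),
      lintegral_indicator_one measurableSet_Ioo]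
    simp
  simp only [h2] at h
  rwa [lintegral_indicator_one hS, eq_comm] at h

theorem volume_axis (hw : LipschitzWith M w) (haxis : axis ⊆ frontier (aboveGraph w)) :
    volume axis = 0 :=
  measure_mono_null (fun _ hy => (mem_frontier_aboveGraph_iff hw).1 (haxis hy)) (volume_graph hw)

end

/-! ### Rapidly decaying kernels. -/

/-- Continuous functions on `[1, ∞)` that decay faster than every power. -/
structure IsRapid (θ : ℝ → ℝ) : Prop where
  cont : ContinuousOn θ (Ici 1)
  decay : ∀ N : ℕ, ∃ A : ℝ, ∀ t : ℝ, 1 ≤ t → t ^ N * |θ t| ≤ A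

theorem IsRapid.pow_mul {θ : ℝ → ℝ} (h : IsRapid θ) (k : ℕ) : IsRapid fun t => t ^ k * θ t := by
  refine ⟨(continuous_pow k).continuousOn.mul h.cont, fun N => ?_⟩
  obtain ⟨A, hA⟩ := h.decay (N + k)
  refine ⟨A, fun t ht => (hA t ht).trans' (le_of_eq ?_)⟩
  rw [abs_mul, abs_of_nonneg (pow_nonneg (by linarith) k), pow_add]; ring

theorem IsRapid.add {θ η : ℝ → ℝ} (h : IsRapid θ) (h' : IsRapid η) :
    IsRapid fun t => θ t + η t := by
  refine ⟨h.cont.add h'.cont, fun N => ?_⟩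
  obtain ⟨A, hA⟩ := h.decay N
  obtain ⟨B, hB⟩ := h'.decay N
  refine ⟨A + B, fun t ht => ?_⟩
  have : t ^ N * |θ t + η t| ≤ t ^ N * (|θ t| + |η t|) :=
    mul_le_mul_of_nonneg_left (abs_add_le _ _) (pow_nonneg (by linarith) _)
  linarith [hA t ht, hB t ht]

/-- A continuous bounded factor preserves rapid decay. -/
theorem IsRapid.bdd_mul {θ b : ℝ → ℝ} (h : IsRapid θ) (hb : ContinuousOn b (Ici 1)) {B : ℝ}
    (hB : ∀ t, 1 ≤ t → |b t| ≤ B) : IsRapid fun t => b t * θ t := by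
  refine ⟨hb.mul h.cont, fun N => ?_⟩
  obtain ⟨A, hA⟩ := h.decay N
  refine ⟨B * A, fun t ht => ?_⟩
  have h0 : 0 ≤ t ^ N * |θ t| := by positivity
  calc t ^ N * |b t * θ t| = |b t| * (t ^ N * |θ t|) := by rw [abs_mul]; ring
    _ ≤ B * A := mul_le_mul (hB t ht) (hA t ht) h0 ((abs_nonneg _).trans (hB t ht))

theorem IsRapid.polynomial_mul {θ : ℝ → ℝ} (h : IsRapid θ) (p : Polynomial ℝ) :
    IsRapid fun t => p.eval t * θ t := by
  induction p using Polynomial.induction_on' with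
  | add p q hp hq => simpa [add_mul] using hp.add hq
  | monomial n a =>
    have := (h.pow_mul n).bdd_mul (b := fun _ => a) continuousOn_const (B := |a|) (by simp)
    simpa [mul_assoc] using this

theorem IsRapid.exists_le_rpow {θ : ℝ → ℝ} (h : IsRapid θ) (N : ℕ) :
    ∃ A, 0 ≤ A ∧ ∀ t, 1 ≤ t → |θ t| ≤ A * (t ^ N)⁻¹ := by
  obtain ⟨A, hA⟩ := h.decay N
  refine ⟨A, (hA 1 le_rfl).trans' (by positivity), fun t ht => ?_⟩
  have : 0 < t ^ N := by positivity
  rw [← div_eq_mul_inv, le_div_iff₀' this]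
  exact hA t ht

theorem IsRapid.integrableOn {θ : ℝ → ℝ} (h : IsRapid θ) : IntegrableOn θ (Ioi 1) := by
  obtain ⟨A, hA0, hA⟩ := h.exists_le_rpow 2
  have h1 : IntegrableOn (fun t : ℝ => A * t ^ (-2 : ℝ)) (Ioi 1) :=
    (integrableOn_Ioi_rpow_of_lt (by norm_num) one_pos).const_mul A
  refine h1.mono' ((h.cont.mono Ioi_subset_Ici_self).aestronglyMeasurable measurableSet_Ioi) ?_
  filter_upwards [ae_restrict_mem measurableSet_Ioi] with t ht
  have ht' : (1 : ℝ) < t := ht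
  rw [Real.norm_eq_abs, Real.rpow_neg (by linarith)]
  simpa using hA t ht'.le

/-! ### Existence of an averaging kernel. -/

/-- The function `x⁻ⁿ e^{-y²/2} (P(y) sin 2πy + Q(y) cos 2πy)` of `y = log x`, extended by zero. -/
noncomputable def logGauss (n : ℕ) (P Q : Polynomial ℝ) (x : ℝ) : ℝ :=
  if 0 < x then (x ^ n)⁻¹ * (Real.exp (-(Real.log x) ^ 2 / 2) *
    (P.eval (Real.log x) * Real.sin (2 * Real.pi * Real.log x) +
      Q.eval (Real.log x) * Real.cos (2 * Real.pi * Real.log x))) else 0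

/-- A power of |y| is dominated by e^{|y|}, and completing the square absorbs e^{|y|} and any
e^{-ay} in the Gaussian. -/
theorem exists_eval_mul_gauss_le (P : Polynomial ℝ) (a : ℝ) :
    ∃ C, 0 ≤ C ∧ ∀ y, |P.eval y| * Real.exp (-y ^ 2 / 2) ≤ C * Real.exp (a * y) := by
  induction P using Polynomial.induction_on' with
  | add p q hp hq =>
    obtain ⟨A, hA0, hA⟩ := hp
    obtain ⟨B, hB0, hB⟩ := hq
    refine ⟨A + B, by positivity, fun y => ?_⟩
    have : |(p + q).eval y| * Real.exp (-y ^ 2 / 2) ≤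
        (|p.eval y| + |q.eval y|) * Real.exp (-y ^ 2 / 2) := by
      rw [Polynomial.eval_add]
      exact mul_le_mul_of_nonneg_right (abs_add_le _ _) (Real.exp_nonneg _)
    linarith [hA y, hB y]
  | monomial n c =>
    refine ⟨|c| * n.factorial * Real.exp ((|a| + 1) ^ 2 / 2), by positivity, fun y => ?_⟩
    have h1 : |y| ^ n ≤ n.factorial * Real.exp |y| := by
      have := Real.pow_div_factorial_le_exp |y| (abs_nonneg y) n
      rwa [div_le_iff₀' (by positivity)] at this
    have h2 : |y| + -y ^ 2 / 2 ≤ (|a| + 1) ^ 2 / 2 + a * y := by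
      have e1 : -(a * y) ≤ |a| * |y| := by rw [← abs_mul]; exact neg_le_abs _
      have e2 : y ^ 2 = |y| ^ 2 := (sq_abs y).symm
      nlinarith [sq_nonneg (|y| - (|a| + 1))]
    calc |(Polynomial.monomial n c).eval y| * Real.exp (-y ^ 2 / 2)
        = |c| * |y| ^ n * Real.exp (-y ^ 2 / 2) := by simp [abs_mul]
      _ ≤ |c| * (n.factorial * Real.exp |y|) * Real.exp (-y ^ 2 / 2) := by gcongr
      _ = |c| * n.factorial * Real.exp (|y| + -y ^ 2 / 2) := by rw [Real.exp_add]; ring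
      _ ≤ |c| * n.factorial * Real.exp ((|a| + 1) ^ 2 / 2 + a * y) := by gcongr
      _ = _ := by rw [Real.exp_add]; ring

/-- In the variable y = log x powers of x are exponentials, which the Gaussian beats. Since k may
have either sign, this gives infinite-order vanishing at 0 as well as rapid decay at infinity. -/
theorem exists_logGauss_le (n : ℕ) (P Q : Polynomial ℝ) (k : ℤ) :
    ∃ C, 0 ≤ C ∧ ∀ x, 0 < x → |logGauss n P Q x| ≤ C * x ^ k := by
  obtain ⟨A, hA0, hA⟩ := exists_eval_mul_gauss_le P (k + n : ℤ)
  obtain ⟨B, hB0, hB⟩ := exists_eval_mul_gauss_le Q (k + n : ℤ)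
  refine ⟨A + B, by positivity, fun x hx => ?_⟩
  set y := Real.log x with hy
  have hxy : Real.exp ((k + n : ℤ) * y) = x ^ k * x ^ n := by
    rw [mul_comm, Real.exp_mul, hy, Real.exp_log hx, Real.rpow_intCast, zpow_add₀ hx.ne',
      zpow_natCast]
  have hA' := hA y
  have hB' := hB y
  rw [hxy] at hA' hB'
  have e : |P.eval y * Real.sin (2 * Real.pi * y) + Q.eval y * Real.cos (2 * Real.pi * y)| ≤
      |P.eval y| + |Q.eval y| := by
    refine (abs_add_le _ _).trans ?_
    rw [abs_mul, abs_mul]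
    exact add_le_add (mul_le_of_le_one_right (abs_nonneg _) (Real.abs_sin_le_one _))
      (mul_le_of_le_one_right (abs_nonneg _) (Real.abs_cos_le_one _))
  have hxn : 0 < x ^ n := by positivity
  rw [logGauss, if_pos hx, abs_mul, abs_mul, abs_of_pos (inv_pos.2 hxn), abs_of_pos (Real.exp_pos _),
    inv_mul_le_iff₀ hxn]
  calc _ ≤ Real.exp (-y ^ 2 / 2) * (|P.eval y| + |Q.eval y|) := by gcongr
    _ ≤ A * (x ^ k * x ^ n) + B * (x ^ k * x ^ n) := by linarith
    _ = _ := by ring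

open Polynomial in
-- The family is chosen to be closed under differentiation, so smoothness follows by induction. At
-- the origin, where the formula changes, the quadratic bound forces the derivative to vanish.
theorem hasDerivAt_logGauss (n : ℕ) (P Q : ℝ[X]) (x : ℝ) :
    HasDerivAt (logGauss n P Q)
      (logGauss (n + 1) (derivative P - X * P - C (2 * Real.pi) * Q - C (n : ℝ) * P)
        (derivative Q - X * Q + C (2 * Real.pi) * P - C (n : ℝ) * Q) x) x := by
  rcases lt_trichotomy x 0 with hx | rfl | hx
  · rw [logGauss, if_neg (by linarith)]
    refine (hasDerivAt_const x (0 : ℝ)).congr_of_eventuallyEq ?_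
    filter_upwards [Iio_mem_nhds hx] with y hy
    rw [logGauss, if_neg (not_lt.2 (le_of_lt hy))]
  · obtain ⟨C, hC0, hC⟩ := exists_logGauss_le n P Q 2
    rw [logGauss, if_neg (lt_irrefl _), hasDerivAt_iff_isLittleO]
    have h0 : logGauss n P Q 0 = 0 := by simp [logGauss]
    have : (fun x' => logGauss n P Q x' - logGauss n P Q 0 - (x' - 0) • (0 : ℝ)) =O[nhds 0]
        fun x' => (x' - 0) ^ 2 := by
      refine Asymptotics.IsBigO.of_bound C (Filter.Eventually.of_forall fun x => ?_)
      simp only [h0, sub_zero, smul_zero, Real.norm_eq_abs, abs_of_nonneg (sq_nonneg x)]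
      rcases le_or_gt x 0 with hx | hx
      · rw [logGauss, if_neg (not_lt.2 hx), abs_zero]; positivity
      · exact_mod_cast hC x hx
    refine this.trans_isLittleO ?_
    simpa using Asymptotics.isLittleO_pow_id (𝕜 := ℝ) (n := 2) (by norm_num)
  · have hev : (fun x : ℝ => (x ^ n)⁻¹ * (Real.exp (-(Real.log x) ^ 2 / 2) *
        (P.eval (Real.log x) * Real.sin (2 * Real.pi * Real.log x) +
          Q.eval (Real.log x) * Real.cos (2 * Real.pi * Real.log x)))) =ᶠ[nhds x]
        logGauss n P Q := by
      filter_upwards [Ioi_mem_nhds hx] with y hy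
      rw [logGauss, if_pos (show 0 < y from hy)]
    refine HasDerivAt.congr_of_eventuallyEq ?_ hev.symm
    have hl := Real.hasDerivAt_log hx.ne'
    have h1 : HasDerivAt (fun x : ℝ => (x ^ n)⁻¹) (-(n : ℝ) * (x ^ n)⁻¹ * x⁻¹) x := by
      have := hasDerivAt_zpow (-(n : ℤ)) x (Or.inl hx.ne')
      simp only [zpow_neg, zpow_natCast] at this
      refine this.congr_deriv ?_
      rw [zpow_sub_one₀ hx.ne', zpow_neg, zpow_natCast]; push_cast; ring
    have h2 := ((hl.pow 2).neg.div_const 2).exp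
    have h3 := ((P.hasDerivAt (Real.log x)).comp x hl).mul ((hl.const_mul (2 * Real.pi)).sin)
    have h4 := ((Q.hasDerivAt (Real.log x)).comp x hl).mul ((hl.const_mul (2 * Real.pi)).cos)
    refine (h1.mul (h2.mul (h3.add h4))).congr_deriv ?_
    rw [logGauss, if_pos hx]
    simp only [eval_sub, eval_add, eval_mul, eval_X, eval_C, Function.comp_def, pow_succ,
      Pi.add_apply, Pi.mul_apply, Pi.neg_apply, Pi.pow_apply]
    field_simp
    ring

theorem contDiff_logGauss (n : ℕ) (P Q : Polynomial ℝ) : ContDiff ℝ ∞ (logGauss n P Q) := by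
  rw [contDiff_infty]
  intro m
  induction m generalizing n P Q with
  | zero =>
    exact_mod_cast contDiff_zero.2 (continuous_iff_continuousAt.2 fun x =>
      (hasDerivAt_logGauss n P Q x).continuousAt)
  | succ m ih =>
    push_cast
    refine contDiff_succ_iff_deriv.2
      ⟨fun x => (hasDerivAt_logGauss n P Q x).differentiableAt, by simp, ?_⟩
    rw [funext fun x => (hasDerivAt_logGauss n P Q x).deriv]
    exact ih _ _ _

/-- Substituting x = e^y cancels the factor x⁻¹ against the Jacobian and leaves e^{ky − y²/2}
sin(2πy). Completing the square centres the Gaussian at the integer k, and the sine is odd about k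
by periodicity, so the integral vanishes. -/
theorem integral_pow_mul_logGauss (k : ℕ) :
    ∫ x in Ioi (0 : ℝ), x ^ k * logGauss 1 1 0 x = 0 := by
  have himg : Real.exp '' univ = Ioi 0 := by rw [image_univ, Real.range_exp]
  rw [← himg, integral_image_eq_integral_abs_deriv_smul MeasurableSet.univ
    (fun x _ => (Real.hasDerivAt_exp x).hasDerivWithinAt) Real.exp_injective.injOn,
    setIntegral_univ]
  set F : ℝ → ℝ := fun y =>
    Real.exp (k ^ 2 / 2) * (Real.exp (-(y - k) ^ 2 / 2) * Real.sin (2 * Real.pi * (y - k))) with hF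
  have e : ∀ y, |Real.exp y| • (Real.exp y ^ k * logGauss 1 1 0 (Real.exp y)) = F y := by
    intro y
    have h1 : Real.exp y ^ k = Real.exp (k * y) := by rw [Real.exp_nat_mul]
    have h2 : Real.sin (2 * Real.pi * (y - k)) = Real.sin (2 * Real.pi * y) := by
      rw [← Real.sin_sub_nat_mul_two_pi (2 * Real.pi * y) k]; ring_nf
    have h3 : Real.exp (k ^ 2 / 2) * Real.exp (-(y - k) ^ 2 / 2) =
        Real.exp (k * y) * Real.exp (-y ^ 2 / 2) := by
      rw [← Real.exp_add, ← Real.exp_add]; ring_nf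
    have h4 : Real.exp y ≠ 0 := (Real.exp_pos y).ne'
    rw [hF]
    simp only [h2]
    rw [← mul_assoc, h3, h1, abs_of_pos (Real.exp_pos y), logGauss, if_pos (Real.exp_pos y)]
    simp only [Real.log_exp, smul_eq_mul, pow_one, Polynomial.eval_one, Polynomial.eval_zero]
    field_simp
    ring
  simp only [e]
  have h5 : ∫ y, F y = ∫ y, F (y + k) := (integral_add_right_eq_self F (k : ℝ)).symm
  have h6 : ∫ y, F (y + k) = ∫ y, F (-y + k) := (integral_neg_eq_self (fun y => F (y + k)) volume).symm
  have h7 : ∀ y, F (-y + k) = -F (y + k) := by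
    intro y
    simp [hF]
  simp only [h7, integral_neg] at h6
  rw [h5]; linarith

theorem isRapid_shifted_logGauss : IsRapid fun t => logGauss 1 1 0 (t - 1) := by
  refine ⟨((contDiff_logGauss 1 1 0).continuous.comp (continuous_sub_right 1)).continuousOn,
    fun N => ?_⟩
  obtain ⟨A, hA0, hA⟩ := exists_logGauss_le 1 1 0 0
  obtain ⟨B, hB0, hB⟩ := exists_logGauss_le 1 1 0 (-(N : ℤ))
  refine ⟨2 ^ N * (A + B), fun t ht => ?_⟩
  rcases ht.eq_or_lt with rfl | ht
  · simp [logGauss]; positivity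
  have hx : 0 < t - 1 := by linarith
  have hA' := hA _ hx
  have hB' := hB _ hx
  rw [zpow_zero, mul_one] at hA'
  rw [zpow_neg, zpow_natCast, ← div_eq_mul_inv, le_div_iff₀' (by positivity)] at hB'
  -- Near t = 1 boundedness suffices; beyond t = 2 one has t ≤ 2(t − 1), so decay in t − 1 is decay
  -- in t.
  rcases le_or_gt t 2 with h2 | h2
  · calc t ^ N * |logGauss 1 1 0 (t - 1)| ≤ 2 ^ N * A := by gcongr
      _ ≤ _ := by gcongr; linarith
  · calc t ^ N * |logGauss 1 1 0 (t - 1)| ≤ (2 * (t - 1)) ^ N * |logGauss 1 1 0 (t - 1)| := by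
          gcongr; linarith
      _ = 2 ^ N * ((t - 1) ^ N * |logGauss 1 1 0 (t - 1)|) := by rw [mul_pow]; ring
      _ ≤ 2 ^ N * (A + B) := by gcongr; linarith

/-- Expanding t^k = ((t − 1) + 1)^k reduces this to the moments on (0, ∞). -/
theorem integral_pow_mul_shifted_logGauss (k : ℕ) :
    ∫ t in Ioi (1 : ℝ), t ^ k * logGauss 1 1 0 (t - 1) = 0 := by
  have h0 : ∀ j : ℕ, ∫ t in Ioi (1 : ℝ), (t - 1) ^ j * logGauss 1 1 0 (t - 1) = 0 := by
    intro j
    have hz : ∀ (a t : ℝ), t ∉ Ioi a → logGauss 1 1 0 (t - a) = 0 := fun a t ht => by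
      rw [logGauss, if_neg]; simpa using ht
    rw [setIntegral_eq_integral_of_forall_compl_eq_zero (fun t ht => by rw [hz 1 t ht, mul_zero]),
      integral_sub_right_eq_self (fun t => t ^ j * logGauss 1 1 0 t) 1,
      ← setIntegral_eq_integral_of_forall_compl_eq_zero (s := Ioi 0), integral_pow_mul_logGauss]
    intro t ht
    have := hz 0 t ht
    rw [sub_zero] at this
    rw [this, mul_zero]
  have e : ∀ t : ℝ, t ^ k * logGauss 1 1 0 (t - 1) = ∑ j ∈ Finset.range (k + 1),
      (k.choose j : ℝ) * ((t - 1) ^ j * logGauss 1 1 0 (t - 1)) := by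
    intro t
    have := add_pow (t - 1) 1 k
    simp only [sub_add_cancel, one_pow, mul_one] at this
    rw [this, Finset.sum_mul]
    exact Finset.sum_congr rfl fun j _ => by ring
  simp only [e]
  rw [integral_finsetSum]
  · simp [integral_const_mul, h0]
  · intro j _
    have := (isRapid_shifted_logGauss.polynomial_mul ((Polynomial.X - 1) ^ j)).integrableOn
    simp only [Polynomial.eval_pow, Polynomial.eval_sub, Polynomial.eval_X,
      Polynomial.eval_one] at this
    exact this.const_mul _

/-- A rapidly decaying function all of whose negative moments vanish is zero. -/
theorem IsRapid.eq_zero_of_inv_moments {θ : ℝ → ℝ} (h : IsRapid θ)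
    (h0 : ∀ m : ℕ, ∫ t in Ioi (1 : ℝ), t⁻¹ ^ m * θ t = 0) : EqOn θ 0 (Ioi 1) := by
  have hinv : ContinuousOn (fun t : ℝ => t⁻¹) (Ici 1) :=
    continuousOn_inv₀.mono fun t ht => (lt_of_lt_of_le one_pos ht).ne'
  have hinv1 : ∀ t : ℝ, 1 ≤ t → t⁻¹ ∈ Icc (0 : ℝ) 1 := fun t ht =>
    ⟨by positivity, inv_le_one_of_one_le₀ ht⟩
  have hpint : ∀ p : Polynomial ℝ, IntegrableOn (fun t => p.eval t⁻¹ * θ t) (Ioi 1) := by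
    intro p
    obtain ⟨B, hB⟩ := isCompact_Icc.exists_bound_of_continuousOn (s := Icc (0 : ℝ) 1)
      p.continuous.continuousOn
    exact (h.bdd_mul (p.continuous.comp_continuousOn hinv)
      (fun t ht => hB _ (hinv1 t ht))).integrableOn
  have hp : ∀ p : Polynomial ℝ, ∫ t in Ioi (1 : ℝ), p.eval t⁻¹ * θ t = 0 := by
    intro p
    induction p using Polynomial.induction_on' with
    | add p q hp hq =>
      simp only [Polynomial.eval_add, add_mul]
      rw [integral_add (hpint p) (hpint q), hp, hq, add_zero]
    | monomial n a => simp [mul_assoc, integral_const_mul] at h0 ⊢; right; exact h0 n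
  have hθ0 : IntegrableOn θ (Ioi 1) := h.integrableOn
  obtain ⟨B, -, hB⟩ := h.exists_le_rpow 0
  obtain ⟨A, hA0, hA⟩ := h.exists_le_rpow 1
  have hsq : IntegrableOn (fun t => θ t * θ t) (Ioi 1) :=
    (h.bdd_mul h.cont (B := B) (by simpa using hB)).integrableOn
  -- The kernel in the variable μ = 1/t; decay of θ at infinity makes it continuous at μ = 0 with
  -- value 0.
  set q : ℝ → ℝ := fun μ => if μ ≤ 0 then 0 else θ μ⁻¹ with hq
  have hqc : ContinuousOn q (Icc 0 1) := by
    intro μ hμ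
    rcases hμ.1.eq_or_lt with rfl | hpos
    · have hq0 : q 0 = 0 := by simp [hq]
      rw [ContinuousWithinAt, hq0]
      refine squeeze_zero_norm' (a := fun μ => A * μ) ?_ ?_
      · filter_upwards [self_mem_nhdsWithin] with μ hμ
        rcases hμ.1.eq_or_lt with rfl | hpos
        · simp [hq]
        · have := hA μ⁻¹ (one_le_inv_iff₀.2 ⟨hpos, hμ.2⟩)
          simpa [hq, not_le.2 hpos] using this
      · have : ContinuousWithinAt (fun μ : ℝ => A * μ) (Icc 0 1) 0 := by fun_prop
        simpa [ContinuousWithinAt] using this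
    · have h1 : ContinuousWithinAt (fun μ => θ μ⁻¹) (Icc 0 1 ∩ Ioi 0) μ := by
        refine ((h.cont μ⁻¹ (one_le_inv_iff₀.2 ⟨hpos, hμ.2⟩)).comp
          (f := fun μ : ℝ => μ⁻¹) (continuousAt_inv₀ hpos.ne').continuousWithinAt ?_)
        exact fun ν hν => one_le_inv_iff₀.2 ⟨hν.2, hν.1.2⟩
      have h2 : ContinuousWithinAt q (Icc 0 1 ∩ Ioi 0) μ :=
        h1.congr (fun ν hν => by simp [hq, not_le.2 (show 0 < ν from hν.2)])
          (by simp [hq, not_le.2 hpos])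
      exact (continuousWithinAt_inter (Ioi_mem_nhds hpos)).1 h2
  -- Weierstrass approximation: subtracting from one factor θ a polynomial in 1/t does not change
  -- the integral of θ², and leaves a factor of size ε.
  have hsmall : ∀ ε > 0, ∫ t in Ioi (1 : ℝ), θ t * θ t ≤ ε * ∫ t in Ioi (1 : ℝ), |θ t| := by
    intro ε hε
    obtain ⟨p, hpq⟩ := exists_polynomial_near_of_continuousOn 0 1 q hqc ε hε
    have e1 : ∫ t in Ioi (1 : ℝ), θ t * θ t =
        ∫ t in Ioi (1 : ℝ), (θ t * θ t - p.eval t⁻¹ * θ t) := by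
      rw [integral_sub hsq (hpint p), hp p, sub_zero]
    rw [e1, ← integral_const_mul]
    refine integral_mono_ae (hsq.sub (hpint p)) (hθ0.abs.const_mul ε) ?_
    filter_upwards [ae_restrict_mem measurableSet_Ioi] with t ht
    have ht' : (1 : ℝ) ≤ t := le_of_lt ht
    have h1 := (hpq t⁻¹ (hinv1 t ht')).le
    have hqt : q t⁻¹ = θ t := by
      have : 0 < t⁻¹ := by positivity
      simp [hq, not_le.2 (show (0 : ℝ) < t by linarith)]
    rw [hqt, abs_sub_comm] at h1
    calc θ t * θ t - p.eval t⁻¹ * θ t = (θ t - p.eval t⁻¹) * θ t := by ring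
      _ ≤ |θ t - p.eval t⁻¹| * |θ t| := by rw [← abs_mul]; exact le_abs_self _
      _ ≤ ε * |θ t| := by gcongr
  have hzero : ∫ t in Ioi (1 : ℝ), θ t * θ t = 0 := by
    refine le_antisymm ?_ (integral_nonneg fun t => mul_self_nonneg _)
    by_contra hcon
    push Not at hcon
    set I := ∫ t in Ioi (1 : ℝ), |θ t|
    have hI : 0 ≤ I := integral_nonneg fun t => abs_nonneg _
    have := hsmall ((∫ t in Ioi (1 : ℝ), θ t * θ t) / (2 * (I + 1))) (by positivity)
    set S := ∫ t in Ioi (1 : ℝ), θ t * θ t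
    have h2 : S / (2 * (I + 1)) * I ≤ S / 2 := by
      rw [div_mul_eq_mul_div, div_le_div_iff₀ (by positivity) (by positivity)]
      nlinarith
    linarith
  have hae := (integral_eq_zero_iff_of_nonneg_ae
    (Filter.Eventually.of_forall fun t => mul_self_nonneg (θ t)) hsq).1 hzero
  refine Measure.eqOn_open_of_ae_eq (μ := volume) ?_ isOpen_Ioi (h.cont.mono Ioi_subset_Ici_self)
    continuousOn_const
  filter_upwards [hae] with t ht
  simpa using ht

/-- All nonnegative moments of the shifted log-Gaussian θ vanish, its mass included, so θ itself
cannot be normalized. Some negative moment is nonzero; with m the first such order, t^{-m} θ has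
nonzero mass. Its k-th moment is a lower negative moment of θ when 1 ≤ k < m, zero by minimality,
and a nonnegative moment when k ≥ m. -/
theorem exists_isSteinKernel : ∃ ψ : ℝ → ℝ, IsSteinKernel ψ := by
  set θ : ℝ → ℝ := fun t => logGauss 1 1 0 (t - 1) with hθ
  have hr : IsRapid θ := isRapid_shifted_logGauss
  have hex : ∃ m : ℕ, ∫ t in Ioi (1 : ℝ), t⁻¹ ^ m * θ t ≠ 0 := by
    by_contra hcon
    push Not at hcon
    -- At t = 1 + e^{1/4} the logarithm of t − 1 is 1/4, where sin(2πy) = 1, so θ is not identically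
    -- zero.
    have h1 : (1 : ℝ) < 1 + Real.exp (1 / 4) := by linarith [Real.exp_pos (1 / 4)]
    have h := hr.eq_zero_of_inv_moments hcon h1
    simp only [hθ, add_sub_cancel_left, logGauss, if_pos (Real.exp_pos (1 / 4)), Real.log_exp,
      Pi.zero_apply] at h
    have h2 : 2 * Real.pi * (1 / 4) = Real.pi / 2 := by ring
    rw [h2] at h
    simp at h
  obtain ⟨m, hc, hmin⟩ : ∃ m : ℕ, ∫ t in Ioi (1 : ℝ), t⁻¹ ^ m * θ t ≠ 0 ∧
      ∀ j < m, ∫ t in Ioi (1 : ℝ), t⁻¹ ^ j * θ t = 0 := by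
    classical
    exact ⟨Nat.find hex, Nat.find_spec hex, fun j hj => by simpa using Nat.find_min hex hj⟩
  set c := ∫ t in Ioi (1 : ℝ), t⁻¹ ^ m * θ t
  have hinv : ContDiffOn ℝ ∞ (fun t : ℝ => t⁻¹) (Ici 1) :=
    contDiffOn_id.inv fun t ht => (lt_of_lt_of_le one_pos ht).ne'
  refine ⟨fun t => c⁻¹ * (t⁻¹ ^ m * θ t), ?_, ?_, ?_, ?_⟩
  · exact contDiffOn_const.mul ((hinv.pow m).mul
      ((contDiff_logGauss 1 1 0).comp (contDiff_id.sub contDiff_const)).contDiffOn)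
  · refine IsRapid.decay ?_
    refine (hr.bdd_mul (hinv.continuousOn.pow m) (B := 1) fun t ht => ?_).bdd_mul
      (b := fun _ => c⁻¹) continuousOn_const (B := |c⁻¹|) (by simp)
    have : (0 : ℝ) ≤ t⁻¹ := by positivity
    rw [Pi.pow_apply, abs_of_nonneg (by positivity)]
    exact pow_le_one₀ this (inv_le_one_of_one_le₀ ht)
  · rw [integral_const_mul, inv_mul_cancel₀ hc]
  · intro k hk
    have e : ∀ t ∈ Ioi (1 : ℝ), t ^ k * (c⁻¹ * (t⁻¹ ^ m * θ t)) =
        c⁻¹ * ((if k < m then t⁻¹ ^ (m - k) else t ^ (k - m)) * θ t) := by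
      intro t ht
      have ht0 : t ≠ 0 := (lt_trans one_pos ht).ne'
      split_ifs with hkm
      · obtain ⟨j, rfl⟩ := Nat.exists_eq_add_of_lt hkm
        rw [show k + j + 1 - k = j + 1 by omega, show k + j + 1 = k + (j + 1) by omega, pow_add t⁻¹,
          inv_pow t k]
        field_simp
      · obtain ⟨j, rfl⟩ := Nat.exists_eq_add_of_le (not_lt.1 hkm)
        rw [show m + j - m = j by omega, pow_add, inv_pow t m]
        field_simp
    rw [setIntegral_congr_fun measurableSet_Ioi e, integral_const_mul]
    split_ifs with hkm
    · rw [hmin _ (by omega), mul_zero]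
    · rw [integral_pow_mul_shifted_logGauss, mul_zero]

/-! ### Construction of a regularized distance. -/

section
variable {M : ℝ≥0} {w : EuclideanSpace ℝ (Fin 2) → ℝ}
variable {E : Type} [NormedAddCommGroup E] [NormedSpace ℝ E]

/-- Average of translates of `φ`, rescaled by the depth of the centre, below the graph of `w`. -/
noncomputable def depthAverage (w : EuclideanSpace ℝ (Fin 2) → ℝ) (k : ℕ) (φ : R3 → E) (x : R3) :
    E := ∫ y in {y | 0 < depth w y}, (depth w y ^ k)⁻¹ • φ ((depth w y)⁻¹ • (x - y))

/-- The relative radius of the averaging balls. -/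
noncomputable def avgRadius (M : ℝ≥0) : ℝ := 1 / (2 * (M + 1))

theorem avgRadius_pos (M : ℝ≥0) : 0 < avgRadius M := by unfold avgRadius; positivity

theorem avgRadius_mul (M : ℝ≥0) : (M + 1) * avgRadius M = 1 / 2 := by
  unfold avgRadius; field_simp

theorem avgRadius_le (M : ℝ≥0) : avgRadius M ≤ 1 / 2 := by
  have := avgRadius_mul M
  have h := avgRadius_pos M
  have : (0 : ℝ) ≤ M * avgRadius M := by positivity
  linarith

/-- The averaging radius is half the reciprocal of the Lipschitz constant of the depth, so within it
the depth changes by at most half of its value at the centre. -/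
theorem depth_comparable (hw : LipschitzWith M w) {x y : R3} (hy : 0 < depth w y)
    (hxy : ‖x - y‖ ≤ avgRadius M * depth w y) :
    depth w y ≤ 2 * depth w x ∧ depth w x ≤ 2 * depth w y ∧ ‖x - y‖ ≤ depth w x := by
  have h := abs_depth_sub_le hw x y
  have h1 : ((M : ℝ) + 1) * ‖x - y‖ ≤ depth w y / 2 := by
    calc ((M : ℝ) + 1) * ‖x - y‖ ≤ (M + 1) * (avgRadius M * depth w y) := by gcongr
      _ = depth w y / 2 := by rw [← mul_assoc, avgRadius_mul]; ring
  have h2 := abs_le.1 (h.trans h1)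
  have h3 : avgRadius M * depth w y ≤ 1 / 2 * depth w y := by
    have := avgRadius_le M
    gcongr
  refine ⟨by linarith, by linarith, by linarith⟩

theorem norm_sub_le_of_ne_zero {F : Type} [NormedAddCommGroup F] {φ : R3 → F}
    (hφ : tsupport φ ⊆ Metric.closedBall 0 (avgRadius M)) {x y : R3} (hy : 0 < depth w y)
    (h : φ ((depth w y)⁻¹ • (x - y)) ≠ 0) : ‖x - y‖ ≤ avgRadius M * depth w y := by
  have := hφ (subset_tsupport _ h)
  rw [mem_closedBall_zero_iff, norm_smul, norm_inv, Real.norm_eq_abs, abs_of_pos hy,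
    inv_mul_le_iff₀ hy] at this
  linarith

/-- Where the integrand is nonzero, y lies in the ball about x of radius the depth of x, and the
depth at y may be replaced by half of that at x. Integrability, domination and size estimates all
rest on this. -/
theorem norm_integrand_le (hw : LipschitzWith M w) {φ : R3 → E}
    (hφ : tsupport φ ⊆ Metric.closedBall 0 (avgRadius M)) {C : ℝ} (hC : ∀ z, ‖φ z‖ ≤ C) (k : ℕ)
    {x y : R3} (hy : 0 < depth w y) :
    ‖(depth w y ^ k)⁻¹ • φ ((depth w y)⁻¹ • (x - y))‖ ≤
      (Metric.closedBall x (depth w x)).indicator (fun _ => C * ((depth w x / 2) ^ k)⁻¹) y := by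
  by_cases h : φ ((depth w y)⁻¹ • (x - y)) = 0
  · rw [h, smul_zero, norm_zero]
    refine indicator_nonneg (fun z hz => ?_) y
    have h1 : 0 ≤ depth w x := dist_nonneg.trans (Metric.mem_closedBall.1 hz)
    have h2 : 0 ≤ C := (norm_nonneg _).trans (hC 0)
    positivity
  · obtain ⟨h1, h2, h3⟩ := depth_comparable hw hy (norm_sub_le_of_ne_zero hφ hy h)
    rw [indicator_of_mem (by rwa [Metric.mem_closedBall, dist_comm, dist_eq_norm]), norm_smul,
      norm_inv, norm_pow, Real.norm_eq_abs, abs_of_pos hy, mul_comm]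
    have hC0 : 0 ≤ C := (norm_nonneg _).trans (hC 0)
    have hx : 0 < depth w x := by linarith
    have : ((depth w y) ^ k)⁻¹ ≤ ((depth w x / 2) ^ k)⁻¹ := by
      gcongr; linarith
    exact mul_le_mul (hC _) this (by positivity) hC0

theorem aestronglyMeasurable_integrand (hw : LipschitzWith M w) {φ : R3 → E} (hφ : Continuous φ)
    (k : ℕ) (x : R3) : AEStronglyMeasurable
      (fun y => (depth w y ^ k)⁻¹ • φ ((depth w y)⁻¹ • (x - y)))
      (volume.restrict {y | 0 < depth w y}) := by
  refine ContinuousOn.aestronglyMeasurable ?_ (isOpen_depth_pos hw).measurableSet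
  have hd := (continuous_depth hw).continuousOn (s := {y | 0 < depth w y})
  have hne : ∀ y ∈ {y | 0 < depth w y}, depth w y ≠ 0 := fun y hy => ne_of_gt hy
  refine ((hd.pow k).inv₀ fun y hy => pow_ne_zero k (hne y hy)).smul ?_
  exact hφ.comp_continuousOn ((hd.inv₀ hne).smul (by fun_prop))

theorem integrableOn_integrand (hw : LipschitzWith M w) {φ : R3 → E} (hc : Continuous φ)
    (hφ : tsupport φ ⊆ Metric.closedBall 0 (avgRadius M)) {C : ℝ} (hC : ∀ z, ‖φ z‖ ≤ C) (k : ℕ)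
    (x : R3) : IntegrableOn
      (fun y => (depth w y ^ k)⁻¹ • φ ((depth w y)⁻¹ • (x - y))) {y | 0 < depth w y} := by
  refine Integrable.mono' (g := (Metric.closedBall x (depth w x)).indicator
    (fun _ => C * ((depth w x / 2) ^ k)⁻¹)) ?_ (aestronglyMeasurable_integrand hw hc k x) ?_
  · refine Integrable.integrableOn ((integrable_indicator_iff measurableSet_closedBall).2 ?_)
    exact integrableOn_const measure_closedBall_lt_top.ne
  · filter_upwards [ae_restrict_mem (isOpen_depth_pos hw).measurableSet] with y hy
    exact norm_integrand_le hw hφ hC k hy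

/-- The ball contributes a volume of order depth³, the factor in the integrand depth^{-k}. -/
theorem exists_norm_depthAverage_le (hw : LipschitzWith M w) {φ : R3 → E}
    (hφ : tsupport φ ⊆ Metric.closedBall 0 (avgRadius M)) {C : ℝ} (hC : ∀ z, ‖φ z‖ ≤ C) (k : ℕ) :
    ∃ B, 0 < B ∧ ∀ x, 0 < depth w x → ‖depthAverage w k φ x‖ ≤ B * depth w x ^ (3 - (k : ℤ)) := by
  have hC0 : 0 ≤ C := (norm_nonneg _).trans (hC 0)
  refine ⟨(C + 1) * 2 ^ k * (volume.real (Metric.ball (0 : R3) 1) + 1), by positivity,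
    fun x hx => ?_⟩
  have h1 : ‖depthAverage w k φ x‖ ≤ ∫ y, (Metric.closedBall x (depth w x)).indicator
      (fun _ => C * ((depth w x / 2) ^ k)⁻¹) y := by
    have hint : Integrable ((Metric.closedBall x (depth w x)).indicator
        (fun _ => C * ((depth w x / 2) ^ k)⁻¹)) :=
      (integrable_indicator_iff measurableSet_closedBall).2
        (integrableOn_const measure_closedBall_lt_top.ne)
    refine (norm_integral_le_of_norm_le hint.integrableOn ?_).trans
      (setIntegral_le_integral hint (Filter.Eventually.of_forall fun y =>
        indicator_nonneg (fun _ _ => by positivity) y))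
    filter_upwards [ae_restrict_mem (isOpen_depth_pos hw).measurableSet] with y hy
    exact norm_integrand_le hw hφ hC k hy
  refine h1.trans ?_
  rw [integral_indicator measurableSet_closedBall, setIntegral_const, smul_eq_mul,
    Measure.addHaar_real_closedBall _ _ hx.le, finrank_euclideanSpace_fin, zpow_sub₀ hx.ne',
    zpow_natCast]
  set V := volume.real (Metric.ball (0 : R3) 1)
  have hV : 0 ≤ V := measureReal_nonneg
  have e : depth w x ^ 3 * V * (C * ((depth w x / 2) ^ k)⁻¹) =
      C * 2 ^ k * V * (depth w x ^ 3 / depth w x ^ k) := by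
    rw [div_pow]; field_simp
  rw [e]
  have e2 : depth w x ^ (3 : ℤ) = depth w x ^ 3 := by norm_cast
  rw [e2]
  gcongr <;> linarith

/-- The depth is taken at the integration variable y and not at x. Differentiation in x therefore
only hits φ, at the cost of one factor of inverse depth, and a merely Lipschitz graph still yields a
smooth average. -/
theorem hasFDerivAt_depthAverage (hw : LipschitzWith M w) {φ : R3 → E} (hc : ContDiff ℝ ∞ φ)
    (hφ : tsupport φ ⊆ Metric.closedBall 0 (avgRadius M)) (k : ℕ) {x : R3} (hx : 0 < depth w x) :
    HasFDerivAt (depthAverage w k φ) (depthAverage w (k + 1) (fderiv ℝ φ) x) x := by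
  have hcs : HasCompactSupport φ := HasCompactSupport.of_support_subset_isCompact
    (isCompact_closedBall 0 (avgRadius M)) ((subset_tsupport φ).trans hφ)
  obtain ⟨C, hC⟩ := hcs.exists_bound_of_continuous hc.continuous
  obtain ⟨C', hC'⟩ := (hcs.fderiv ℝ).exists_bound_of_continuous (hc.continuous_fderiv (by simp))
  have hφ' : tsupport (fderiv ℝ φ) ⊆ Metric.closedBall 0 (avgRadius M) :=
    (tsupport_fderiv_subset ℝ).trans hφ
  -- On the ball of this radius the depth stays between half and twice its value at x, which makes
  -- the dominating function uniform.
  set r := depth w x / (2 * (M + 1)) with hr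
  have hr0 : 0 < r := by positivity
  have hball : ∀ z ∈ Metric.ball x r, depth w x / 2 ≤ depth w z ∧ depth w z ≤ 2 * depth w x := by
    intro z hz
    have h1 : ‖z - x‖ ≤ r := by rw [← dist_eq_norm]; exact (Metric.mem_ball.1 hz).le
    have h2 : ((M : ℝ) + 1) * ‖z - x‖ ≤ depth w x / 2 := by
      calc ((M : ℝ) + 1) * ‖z - x‖ ≤ (M + 1) * r := by gcongr
        _ = depth w x / 2 := by rw [hr]; field_simp
    have h3 := abs_le.1 ((abs_depth_sub_le hw z x).trans h2)
    constructor <;> linarith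
  have hC0 : 0 ≤ C' := (norm_nonneg _).trans (hC' 0)
  refine hasFDerivAt_integral_of_dominated_of_fderiv_le
    (F := fun z y => (depth w y ^ k)⁻¹ • φ ((depth w y)⁻¹ • (z - y)))
    (F' := fun z y => (depth w y ^ (k + 1))⁻¹ • fderiv ℝ φ ((depth w y)⁻¹ • (z - y)))
    (bound := (Metric.closedBall x (r + 2 * depth w x)).indicator
      (fun _ => C' * ((depth w x / 4) ^ (k + 1))⁻¹))
    (Metric.ball_mem_nhds x hr0)
    (Filter.Eventually.of_forall fun z => aestronglyMeasurable_integrand hw hc.continuous k z)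
    (integrableOn_integrand hw hc.continuous hφ hC k x)
    (aestronglyMeasurable_integrand hw (hc.continuous_fderiv (by simp)) (k + 1) x) ?_ ?_ ?_
  · filter_upwards [ae_restrict_mem (isOpen_depth_pos hw).measurableSet] with y hy z hz
    obtain ⟨h1, h2⟩ := hball z hz
    have hz0 : 0 < depth w z := by linarith
    refine (norm_integrand_le hw hφ' hC' (k + 1) hy).trans ?_
    by_cases hyz : y ∈ Metric.closedBall z (depth w z)
    · rw [indicator_of_mem hyz, indicator_of_mem]
      · have : depth w x / 4 ≤ depth w z / 2 := by linarith
        gcongr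
      · rw [Metric.mem_closedBall] at hyz ⊢
        rw [Metric.mem_ball] at hz
        linarith [dist_triangle y z x]
    · rw [indicator_of_notMem hyz]
      exact indicator_nonneg (fun _ _ => by positivity) y
  · refine Integrable.integrableOn ((integrable_indicator_iff measurableSet_closedBall).2 ?_)
    exact integrableOn_const measure_closedBall_lt_top.ne
  · filter_upwards [ae_restrict_mem (isOpen_depth_pos hw).measurableSet] with y hy z _
    have h1 : HasFDerivAt (fun z : R3 => (depth w y)⁻¹ • (z - y))
        ((depth w y)⁻¹ • ContinuousLinearMap.id ℝ R3) z :=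
      ((hasFDerivAt_id z).sub_const y).fun_const_smul _
    have h2 := (hc.differentiable (by simp) ((depth w y)⁻¹ • (z - y))).hasFDerivAt
    refine ((h2.comp z h1).const_smul ((depth w y ^ k)⁻¹)).congr_fderiv ?_
    rw [ContinuousLinearMap.comp_smul, ContinuousLinearMap.comp_id, smul_smul, pow_succ, mul_inv]

theorem contDiffOn_depthAverage (hw : LipschitzWith M w) {φ : R3 → E} (hc : ContDiff ℝ ∞ φ)
    (hφ : tsupport φ ⊆ Metric.closedBall 0 (avgRadius M)) (k : ℕ) :
    ContDiffOn ℝ ∞ (depthAverage w k φ) {x | 0 < depth w x} := by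
  rw [contDiffOn_infty]
  intro n
  -- The target space varies in the induction because the derivative is again such an average, with
  -- values in a space of linear maps.
  induction n generalizing E k with
  | zero =>
    exact_mod_cast contDiffOn_zero.2 fun x hx =>
      (hasFDerivAt_depthAverage hw hc hφ k hx).continuousAt.continuousWithinAt
  | succ n ih =>
    push_cast
    rw [contDiffOn_succ_iff_fderiv_of_isOpen (isOpen_depth_pos hw)]
    refine ⟨fun x hx => (hasFDerivAt_depthAverage hw hc hφ k
      hx).differentiableAt.differentiableWithinAt, by simp, ?_⟩
    refine (ih (φ := fderiv ℝ φ) (hc.fderiv_right (by simp))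
      ((tsupport_fderiv_subset ℝ).trans hφ) (k + 1)).congr fun x hx => ?_
    exact (hasFDerivAt_depthAverage hw hc hφ k hx).fderiv

theorem tsupport_partialD_subset (f : R3 → ℝ) (i : Fin 3) :
    tsupport (partialD i f) ⊆ tsupport f := by
  refine (closure_mono fun x hx => ?_).trans (tsupport_fderiv_subset ℝ)
  intro h
  exact hx (by simp [partialD, h])

theorem tsupport_listD_subset (f : R3 → ℝ) (L : List (Fin 3)) :
    tsupport (listD L f) ⊆ tsupport f := by
  induction L with
  | nil => exact subset_rfl
  | cons i L ih => exact (tsupport_partialD_subset _ i).trans ih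

theorem listD_depthAverage (hw : LipschitzWith M w) {φ : R3 → ℝ} (hc : ContDiff ℝ ∞ φ)
    (hφ : tsupport φ ⊆ Metric.closedBall 0 (avgRadius M)) (k : ℕ) (L : List (Fin 3)) :
    EqOn (listD L (depthAverage w k φ)) (depthAverage w (k + L.length) (listD L φ))
      {x | 0 < depth w x} := by
  induction L with
  | nil => exact fun _ _ => rfl
  | cons i L ih =>
    intro x hx
    rw [listD_cons, partialD_congr (isOpen_depth_pos hw) ih i hx]
    have hc' := hc.listD L
    have hφ' := (tsupport_listD_subset φ L).trans hφ
    have hcs : HasCompactSupport (listD L φ) := HasCompactSupport.of_support_subset_isCompact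
      (isCompact_closedBall 0 (avgRadius M)) ((subset_tsupport _).trans hφ')
    obtain ⟨C, hC⟩ := (hcs.fderiv ℝ).exists_bound_of_continuous
      (hc'.continuous_fderiv (by simp))
    rw [partialD, (hasFDerivAt_depthAverage hw hc' hφ' _ hx).fderiv, depthAverage,
      ContinuousLinearMap.integral_apply]
    · rfl
    · exact integrableOn_integrand hw (hc'.continuous_fderiv (by simp))
        ((tsupport_fderiv_subset ℝ).trans hφ') hC _ x

/-- With exponent k = 2 the average of a bump function has size depth^{3−2}, and a derivative of
order j has size depth^{1−j}. The lower bound comes from a ball on which the bump equals one. -/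
theorem exists_isRegularizedDist (hw : LipschitzWith M w) :
    ∃ Δ : R3 → ℝ, IsRegularizedDist (aboveGraph w) Δ ∧
      ∃ c, 0 < c ∧ ∀ x, 0 < depth w x → depth w x ≤ c * Δ x := by
  have hε := avgRadius_pos M
  set ε := avgRadius M with hεdef
  let φ : ContDiffBump (0 : R3) := ⟨ε / 2, ε, by positivity, by linarith⟩
  have hφ : tsupport φ ⊆ Metric.closedBall 0 (avgRadius M) := φ.tsupport_eq.subset
  have hc : ContDiff ℝ ∞ φ := φ.contDiff
  have hbd : ∀ z, ‖φ z‖ ≤ 1 := fun z => by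
    rw [Real.norm_eq_abs, abs_of_nonneg φ.nonneg]; exact φ.le_one
  have hM : (0 : ℝ) < M + 1 := by positivity
  have hlow : ∃ c, 0 < c ∧ ∀ x, 0 < depth w x → depth w x ≤ c * depthAverage w 2 φ x := by
    set V := volume.real (Metric.ball (0 : R3) 1)
    have hV : 0 < V := ENNReal.toReal_pos (Metric.measure_ball_pos _ _ one_pos).ne'
      measure_ball_lt_top.ne
    refine ⟨((ε / 4) ^ 3 * V * 4⁻¹)⁻¹, by positivity, fun x hx => ?_⟩
    rw [← div_eq_inv_mul, le_div_iff₀' (by positivity)]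
    -- For y within this radius of x the depth at y is close to that at x, so the rescaled argument
    -- stays within ε/2, where the bump is one, and the depth at y is at most twice that at x.
    set r := ε / 4 * depth w x with hr
    have hr0 : 0 < r := by positivity
    have hball : ∀ y ∈ Metric.closedBall x r, 0 < depth w y ∧
        (4 * depth w x ^ 2)⁻¹ ≤ (depth w y ^ 2)⁻¹ • φ ((depth w y)⁻¹ • (x - y)) := by
      intro y hy
      have h1 : ‖x - y‖ ≤ r := by
        rw [← dist_eq_norm, dist_comm]; exact hy
      have h2 : ((M : ℝ) + 1) * ‖x - y‖ ≤ depth w x / 8 := by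
        calc ((M : ℝ) + 1) * ‖x - y‖ ≤ (M + 1) * r := by gcongr
          _ = (M + 1) * ε * depth w x / 4 := by rw [hr]; ring
          _ = depth w x / 8 := by rw [avgRadius_mul]; ring
      have h3 := abs_le.1 ((abs_depth_sub_le hw x y).trans h2)
      have h4 : 0 < depth w y := by linarith
      refine ⟨h4, ?_⟩
      have h5 : φ ((depth w y)⁻¹ • (x - y)) = 1 := by
        refine φ.one_of_mem_closedBall ?_
        rw [mem_closedBall_zero_iff, norm_smul, norm_inv, Real.norm_eq_abs, abs_of_pos h4,
          inv_mul_le_iff₀ h4]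
        change _ ≤ depth w y * (ε / 2)
        nlinarith
      rw [h5, smul_eq_mul, mul_one]
      have : depth w y ^ 2 ≤ 4 * depth w x ^ 2 := by nlinarith
      gcongr
    have hint := integrableOn_integrand hw hc.continuous hφ hbd 2 x
    calc (ε / 4) ^ 3 * V * 4⁻¹ * depth w x
        = ∫ _ in Metric.closedBall x r, (4 * depth w x ^ 2)⁻¹ := by
          rw [setIntegral_const, smul_eq_mul, Measure.addHaar_real_closedBall _ _ hr0.le,
            finrank_euclideanSpace_fin, hr]
          change _ = _ * V * _
          field_simp
      _ ≤ ∫ y in Metric.closedBall x r, (depth w y ^ 2)⁻¹ • φ ((depth w y)⁻¹ • (x - y)) := by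
          refine setIntegral_mono_on (integrableOn_const measure_closedBall_lt_top.ne)
            (hint.mono_set fun y hy => (hball y hy).1) measurableSet_closedBall
            fun y hy => (hball y hy).2
      _ ≤ depthAverage w 2 φ x := by
          refine setIntegral_mono_set hint ?_
            (Filter.Eventually.of_forall fun y hy => (hball y hy).1)
          filter_upwards [ae_restrict_mem (isOpen_depth_pos hw).measurableSet] with y hy
          have : (0 : ℝ) ≤ φ ((depth w y)⁻¹ • (x - y)) := φ.nonneg
          simp only [smul_eq_mul, Pi.zero_apply]; positivity
  refine ⟨depthAverage w 2 φ, ⟨?_, ?_, ?_⟩, hlow⟩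
  · rw [compl_closure_aboveGraph hw]
    exact contDiffOn_depthAverage hw hc hφ 2
  · obtain ⟨c, hc0, hcl⟩ := hlow
    obtain ⟨B, hB0, hB⟩ := exists_norm_depthAverage_le hw hφ hbd 2
    refine ⟨c⁻¹, B * (M + 1), by positivity, by positivity, fun x hx => ?_⟩
    have hx' : 0 < depth w x := by
      rwa [mem_closure_aboveGraph_iff hw, not_le] at hx
    constructor
    · rw [inv_mul_le_iff₀ hc0]
      exact (infDist_frontier_le hw hx').trans (hcl x hx')
    · have h1 := (le_abs_self _).trans (hB x hx')
      norm_num at h1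
      calc _ ≤ B * depth w x := h1
        _ ≤ B * ((M + 1) * Metric.infDist x (frontier (aboveGraph w))) := by
          have := depth_le_infDist_frontier hw x
          gcongr
        _ = _ := by ring
  · intro α
    have hc' := hc.listD (multiList α)
    have hφ' := (tsupport_listD_subset φ (multiList α)).trans hφ
    have hcs : HasCompactSupport (listD (multiList α) φ) :=
      HasCompactSupport.of_support_subset_isCompact
        (isCompact_closedBall 0 (avgRadius M)) ((subset_tsupport _).trans hφ')
    obtain ⟨C, hC⟩ := hcs.exists_bound_of_continuous hc'.continuous
    obtain ⟨B, hB0, hB⟩ := exists_norm_depthAverage_le hw hφ' hC (2 + (multiList α).length)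
    refine ⟨B * (1 + (M + 1)), fun x hx => ?_⟩
    have hx' : 0 < depth w x := by
      rwa [mem_closure_aboveGraph_iff hw, not_le] at hx
    have h1 := hB x hx'
    rw [← listD_depthAverage hw hc hφ 2 (multiList α) hx', ← multiD_eq_listD,
      length_multiList, Real.norm_eq_abs] at h1
    have e : 3 - ((2 + order α : ℕ) : ℤ) = 1 - (order α : ℤ) := by push_cast; ring
    rw [e] at h1
    refine h1.trans ?_
    rw [mul_assoc]
    refine mul_le_mul_of_nonneg_left ?_ hB0.le
    have hi := infDist_frontier_pos hw hx'
    set ι := Metric.infDist x (frontier (aboveGraph w))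
    -- The exponent is positive only at order zero, where the depth must be bounded above by the
    -- distance; for higher orders the distance is bounded by the depth and the power is
    -- nonincreasing.
    rcases Nat.eq_zero_or_pos (order α) with h0 | h0
    · simp only [h0, Nat.cast_zero, sub_zero, zpow_one]
      have := depth_le_infDist_frontier hw x
      change depth w x ≤ (1 + (M + 1)) * ι
      nlinarith
    · obtain ⟨j, hj⟩ := Nat.exists_eq_add_of_lt h0
      have e2 : 1 - (order α : ℤ) = -(j : ℤ) := by rw [hj]; push_cast; ring
      rw [e2, zpow_neg, zpow_neg, zpow_natCast, zpow_natCast]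
      have h2 : (depth w x ^ j)⁻¹ ≤ (ι ^ j)⁻¹ := by
        have := infDist_frontier_le hw hx'
        gcongr
      have h3 : 0 < (ι ^ j)⁻¹ := by positivity
      nlinarith

theorem exists_isSteinDist (hw : LipschitzWith M w) : ∃ δs : R3 → ℝ, IsSteinDist w δs := by
  obtain ⟨Δ, hΔ, c, -, hc⟩ := exists_isRegularizedDist hw
  refine ⟨fun x => 2 * c * Δ x, Δ, c, hΔ, fun x hx => ⟨hc x ?_, rfl⟩⟩
  rwa [mem_closure_aboveGraph_iff hw, not_le] at hx

end

/-! ### Null kernels and their primitives. -/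

/-- Rapidly decaying functions on `[1, ∞)` all of whose moments vanish. -/
structure IsNull (θ : ℝ → ℝ) : Prop where
  rapid : IsRapid θ
  moments : ∀ k : ℕ, ∫ t in Ioi (1 : ℝ), t ^ k * θ t = 0

theorem IsSteinKernel.isRapid {ψ : ℝ → ℝ} (h : IsSteinKernel ψ) : IsRapid ψ :=
  ⟨h.smooth.continuousOn, h.decay⟩

/-- A positive power of t turns every moment of ψ into one of order at least 1, so the nonzero mass
no longer appears. -/
theorem IsSteinKernel.isNull {ψ : ℝ → ℝ} (h : IsSteinKernel ψ) {k : ℕ} (hk : 1 ≤ k) :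
    IsNull fun t => t ^ k * ψ t := by
  refine ⟨h.isRapid.pow_mul k, fun j => ?_⟩
  rw [← h.moments (j + k) (by omega)]
  simp only [pow_add, mul_assoc]

/-- A factor of polynomial growth preserves integrability against a rapidly decaying function. -/
theorem IsRapid.integrableOn_mul {θ : ℝ → ℝ} (h : IsRapid θ) {G : ℝ → ℝ}
    (hG : ContinuousOn G (Ioi 1)) {B : ℝ} {K : ℕ} (hB : ∀ t, 1 ≤ t → |G t| ≤ B * t ^ K) :
    IntegrableOn (fun t => G t * θ t) (Ioi 1) := by
  refine (((h.pow_mul K).integrableOn.abs).const_mul B).mono'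
    ((hG.mul (h.cont.mono Ioi_subset_Ici_self)).aestronglyMeasurable measurableSet_Ioi) ?_
  filter_upwards [ae_restrict_mem measurableSet_Ioi] with t ht
  have ht' : (1 : ℝ) ≤ t := le_of_lt ht
  rw [Real.norm_eq_abs, abs_mul, abs_mul, ← mul_assoc, abs_of_nonneg (by positivity : 0 ≤ t ^ K)]
  exact mul_le_mul_of_nonneg_right (hB t ht') (abs_nonneg _)

/-- The antiderivative vanishing at `1`. -/
noncomputable def primitive (θ : ℝ → ℝ) (t : ℝ) : ℝ := ∫ s in (1 : ℝ)..t, θ s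

theorem IsRapid.intervalIntegrable {θ : ℝ → ℝ} (h : IsRapid θ) {a b : ℝ} (ha : 1 ≤ a)
    (hb : 1 ≤ b) : IntervalIntegrable θ volume a b :=
  (h.cont.mono fun _ hx => (le_min ha hb).trans hx.1).intervalIntegrable

theorem IsRapid.hasDerivAt_primitive {θ : ℝ → ℝ} (h : IsRapid θ) {t : ℝ} (ht : 1 < t) :
    HasDerivAt (primitive θ) (θ t) t := by
  refine intervalIntegral.integral_hasDerivAt_right (h.intervalIntegrable le_rfl ht.le) ?_
    (h.cont.continuousAt (Ici_mem_nhds ht))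
  exact (h.cont.mono Ioi_subset_Ici_self).stronglyMeasurableAtFilter isOpen_Ioi t ht

/-- Since the total integral is zero, the primitive equals minus the tail integral, which inherits
rapid decay. -/
theorem IsNull.isRapid_primitive {θ : ℝ → ℝ} (h : IsNull θ) : IsRapid (primitive θ) := by
  have h0 : ∫ t in Ioi (1 : ℝ), θ t = 0 := by simpa using h.moments 0
  have hint := h.rapid.integrableOn
  have htail : ∀ t, 1 ≤ t → primitive θ t = -∫ s in Ioi t, θ s := by
    intro t ht
    have := intervalIntegral.integral_interval_add_Ioi hint
      (hint.mono_set (Ioi_subset_Ioi ht))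
    rw [h0] at this
    rw [primitive]; linarith
  constructor
  · intro t ht
    have h1 : ContinuousOn (primitive θ) (Icc 1 (t + 1)) := by
      have hu : uIcc 1 (t + 1) = Icc 1 (t + 1) := uIcc_of_le (by linarith [show (1 : ℝ) ≤ t from ht])
      rw [← hu]
      refine intervalIntegral.continuousOn_primitive_interval ?_
      rw [hu]
      exact (h.rapid.cont.mono Icc_subset_Ici_self).integrableOn_Icc
    have h2 : ContinuousWithinAt (primitive θ) (Icc 1 (t + 1)) t := h1 t ⟨ht, by linarith⟩
    refine h2.mono_of_mem_nhdsWithin ?_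
    filter_upwards [self_mem_nhdsWithin, mem_nhdsWithin_of_mem_nhds (Iio_mem_nhds (lt_add_one t))]
      with s hs hs'
    exact ⟨hs, le_of_lt hs'⟩
  · intro N
    -- Two extra powers make the tail integrable; N powers are kept for the bound.
    obtain ⟨A, hA0, hA⟩ := h.rapid.exists_le_rpow (N + 2)
    refine ⟨A, fun t ht => ?_⟩
    have ht0 : 0 < t := by linarith
    have hi2 : IntegrableOn (fun s : ℝ => s ^ (-2 : ℝ)) (Ioi t) :=
      integrableOn_Ioi_rpow_of_lt (by norm_num) ht0
    have h1 : |primitive θ t| ≤ ∫ s in Ioi t, A * (t ^ N)⁻¹ * s ^ (-2 : ℝ) := by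
      rw [htail t ht, abs_neg, ← Real.norm_eq_abs]
      refine norm_integral_le_of_norm_le (hi2.const_mul _) ?_
      filter_upwards [ae_restrict_mem measurableSet_Ioi] with s hs
      have hs' : t < s := hs
      have hs0 : 0 < s := ht0.trans hs'
      rw [Real.norm_eq_abs, Real.rpow_neg hs0.le]
      refine (hA s (by linarith)).trans ?_
      rw [pow_add, mul_inv, mul_assoc]
      norm_num
      gcongr
    rw [integral_const_mul, integral_Ioi_rpow_of_lt (by norm_num) ht0] at h1
    norm_num at h1
    rw [Real.rpow_neg_one] at h1
    have h2 : t⁻¹ ≤ 1 := inv_le_one_of_one_le₀ ht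
    calc t ^ N * |primitive θ t| ≤ t ^ N * (A * (t ^ N)⁻¹ * t⁻¹) := by gcongr
      _ = A * t⁻¹ := by field_simp
      _ ≤ A := mul_le_of_le_one_right hA0 h2

/-- Integration by parts against a null kernel. -/
theorem IsNull.integral_mul_eq {θ : ℝ → ℝ} (h : IsNull θ) {G G' : ℝ → ℝ}
    (hG : ∀ t, HasDerivAt G (G' t) t) (hG' : Continuous G') {B : ℝ} {K : ℕ}
    (hB : ∀ t, 1 ≤ t → |G t| ≤ B * t ^ K) (hB' : ∀ t, 1 ≤ t → |G' t| ≤ B * t ^ K) :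
    ∫ t in Ioi (1 : ℝ), G t * θ t = -∫ t in Ioi (1 : ℝ), G' t * primitive θ t := by
  have hr := h.isRapid_primitive
  have hGc : Continuous G := continuous_iff_continuousAt.2 fun t => (hG t).continuousAt
  have hp1 : primitive θ 1 = 0 := by simp [primitive]
  have hB0 : 0 ≤ B := by simpa using (abs_nonneg _).trans (hB 1 le_rfl)
  have := integral_Ioi_mul_deriv_eq_deriv_mul (a := (1 : ℝ)) (u := G) (v := primitive θ) (u' := G')
    (v' := θ) (a' := 0) (b' := 0) (fun t _ => hG t) (fun t ht => h.rapid.hasDerivAt_primitive ht)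
    (h.rapid.integrableOn_mul hGc.continuousOn hB) (hr.integrableOn_mul hG'.continuousOn hB') ?_ ?_
  · simpa using this
  · have hc : ContinuousWithinAt (G * primitive θ) (Ioi 1) 1 :=
      hGc.continuousWithinAt.mul ((hr.cont 1 self_mem_Ici).mono Ioi_subset_Ici_self)
    simpa [ContinuousWithinAt, hp1] using hc
  · obtain ⟨A, hA0, hA⟩ := hr.exists_le_rpow (K + 1)
    refine squeeze_zero_norm' (a := fun t : ℝ => B * A * t⁻¹) ?_ ?_
    · filter_upwards [Filter.eventually_ge_atTop 1] with t ht
      have ht0 : 0 < t := by linarith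
      rw [Pi.mul_apply, norm_mul, Real.norm_eq_abs, Real.norm_eq_abs]
      calc |G t| * |primitive θ t| ≤ (B * t ^ K) * (A * (t ^ (K + 1))⁻¹) :=
            mul_le_mul (hB t ht) (hA t ht) (abs_nonneg _) (by positivity)
        _ = B * A * t⁻¹ := by rw [pow_succ]; field_simp
    · simpa using tendsto_inv_atTop_zero.const_mul (B * A)

/-- Integration by parts against t^{k+1} expresses the k-th moment of the primitive through the (k +
1)-st moment of θ. This closure is what allows integrating by parts arbitrarily often. -/
theorem IsNull.isNull_primitive {θ : ℝ → ℝ} (h : IsNull θ) : IsNull (primitive θ) := by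
  refine ⟨h.isRapid_primitive, fun k => ?_⟩
  have hk : (0 : ℝ) < k + 1 := by positivity
  have h1 := h.integral_mul_eq (G := fun t => t ^ (k + 1)) (G' := fun t => (k + 1) * t ^ k)
    (fun t => by simpa using hasDerivAt_pow (k + 1) t) (by fun_prop) (B := k + 1) (K := k + 1)
    (fun t ht => by
      rw [abs_of_nonneg (by positivity)]
      exact le_mul_of_one_le_left (by positivity) (by linarith [hk, k.cast_nonneg (α := ℝ)]))
    (fun t ht => by
      rw [abs_of_nonneg (by positivity)]
      gcongr
      · omega)
  rw [h.moments] at h1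
  simp only [mul_assoc, integral_const_mul] at h1
  have h2 := neg_eq_zero.1 h1.symm
  exact (mul_eq_zero.1 h2).resolve_left hk.ne'

/-! ### Vertical averages with a constant step. -/

/-- Smooth functions all of whose partial derivatives are bounded. -/
structure IsBddSmooth (f : R3 → ℝ) : Prop where
  smooth : ContDiff ℝ ∞ f
  bdd : ∀ L, ∃ B : ℝ, ∀ x, |listD L f x| ≤ B

theorem IsBddSmooth.listDeriv {f : R3 → ℝ} (h : IsBddSmooth f) (L : List (Fin 3)) :
    IsBddSmooth (listD L f) :=
  ⟨h.smooth.listD L, fun L' => by simpa [listD_append] using h.bdd (L' ++ L)⟩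

theorem IsBddSmooth.partialDeriv {f : R3 → ℝ} (h : IsBddSmooth f) (i : Fin 3) :
    IsBddSmooth (partialD i f) := h.listDeriv [i]

theorem isBddSmooth_of_hasCompactSupport {f : R3 → ℝ} (hf : ContDiff ℝ ∞ f)
    (hc : HasCompactSupport f) : IsBddSmooth f := by
  refine ⟨hf, fun L => ?_⟩
  have h1 : HasCompactSupport (listD L f) :=
    hc.of_isClosed_subset (isClosed_tsupport _) (tsupport_listD_subset f L)
  exact h1.exists_bound_of_continuous (hf.listD L).continuous

theorem hasDerivAt_comp_vert {f : R3 → ℝ} (hf : ContDiff ℝ ∞ f) (x : R3) (s : ℝ) :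
    HasDerivAt (fun s => f (x + vert s)) (partialD 2 f (x + vert s)) s := by
  have h1 : HasDerivAt (fun s => x + vert s) (EuclideanSpace.single (2 : Fin 3) (1 : ℝ)) s := by
    have : (fun s => x + vert s) = fun s => x + s • EuclideanSpace.single (2 : Fin 3) (1 : ℝ) :=
      funext fun s => by rw [vert_eq_smul]
    rw [this]
    simpa using ((hasDerivAt_id s).smul_const
      (EuclideanSpace.single (2 : Fin 3) (1 : ℝ))).const_add x
  exact (hf.differentiable (by simp) _).hasFDerivAt.comp_hasDerivAt s h1

theorem hasDerivAt_comp_vert_mul {f : R3 → ℝ} (hf : ContDiff ℝ ∞ f) (x : R3) (η t : ℝ) :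
    HasDerivAt (fun t => f (x + vert (t * η))) (η * partialD 2 f (x + vert (t * η))) t := by
  have := (hasDerivAt_comp_vert hf x (t * η)).comp t ((hasDerivAt_id t).mul_const η)
  simpa [Function.comp_def, mul_comm] using this

theorem continuous_comp_vert_mul {f : R3 → ℝ} (hf : Continuous f) (x : R3) (η : ℝ) :
    Continuous fun t => f (x + vert (t * η)) :=
  hf.comp (continuous_const.add (continuous_vert.comp (continuous_mul_const η)))

theorem IsRapid.integrableOn_comp_mul {θ : ℝ → ℝ} (h : IsRapid θ) {f : R3 → ℝ}
    (hf : IsBddSmooth f) (x : R3) (η : ℝ) :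
    IntegrableOn (fun t => f (x + vert (t * η)) * θ t) (Ioi 1) := by
  obtain ⟨B, hB⟩ := hf.bdd []
  exact h.integrableOn_mul (continuous_comp_vert_mul hf.smooth.continuous x η).continuousOn
    (B := B) (K := 0) fun t _ => by simpa using hB _

/-- Integration against a null kernel gains any number of powers of the step and of vertical
derivatives. -/
theorem IsNull.exists_integral_eq {θ : ℝ → ℝ} (h : IsNull θ) (m : ℕ) :
    ∃ Θ, IsNull Θ ∧ ∀ f, IsBddSmooth f → ∀ x η,
      ∫ t in Ioi (1 : ℝ), f (x + vert (t * η)) * θ t =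
        (-η) ^ m * ∫ t in Ioi (1 : ℝ), listD (List.replicate m 2) f (x + vert (t * η)) * Θ t := by
  induction m with
  | zero => exact ⟨θ, h, fun f _ x η => by simp⟩
  | succ m ih =>
    obtain ⟨Θ, hΘ, hf⟩ := ih
    refine ⟨primitive Θ, hΘ.isNull_primitive, fun f hfs x η => ?_⟩
    have hg := hfs.listDeriv (List.replicate m 2)
    obtain ⟨B, hB⟩ := hg.bdd []
    obtain ⟨B', hB'⟩ := hg.bdd [2]
    have hB0 : 0 ≤ B := (abs_nonneg _).trans (hB 0)
    have hB0' : 0 ≤ B' := (abs_nonneg _).trans (hB' 0)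
    rw [hf f hfs x η, hΘ.integral_mul_eq (hasDerivAt_comp_vert_mul hg.smooth x η)
      (B := B + |η| * B') (K := 0)]
    · simp only [mul_assoc, integral_const_mul, List.replicate_succ, listD_cons]
      rw [pow_succ]; ring
    · exact continuous_const.mul
        (continuous_comp_vert_mul (hg.smooth.partialD 2).continuous x η)
    · intro t _
      have := hB (x + vert (t * η))
      simp only [listD_nil] at this
      have : 0 ≤ |η| * B' := by positivity
      rw [pow_zero, mul_one]; linarith
    · intro t _
      have := mul_le_mul_of_nonneg_left (hB' (x + vert (t * η))) (abs_nonneg η)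
      simp only [listD_cons, listD_nil] at this
      rw [pow_zero, mul_one, abs_mul]; linarith

/-- Taylor's formula in the vertical direction, uniform in the base point. -/
theorem IsBddSmooth.exists_taylor (N : ℕ) : ∀ {f : R3 → ℝ}, IsBddSmooth f →
    ∃ C, ∀ x, ∃ c : ℕ → ℝ, c 0 = f x ∧ ∀ s, 0 ≤ s →
      |f (x + vert s) - ∑ j ∈ Finset.range N, c j * s ^ j| ≤ C * s ^ N := by
  induction N with
  | zero =>
    intro f hf
    obtain ⟨B, hB⟩ := hf.bdd []
    exact ⟨B, fun x => ⟨fun _ => f x, rfl, fun s _ => by simpa using hB _⟩⟩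
  | succ N ih =>
    intro f hf
    obtain ⟨C, hC⟩ := ih (hf.partialDeriv 2)
    refine ⟨C, fun x => ?_⟩
    obtain ⟨c, -, hc⟩ := hC x
    -- The coefficients are those of the expansion of the vertical derivative, integrated term by
    -- term; the remainder then follows from the mean value inequality on [0, s].
    refine ⟨fun j => if j = 0 then f x else c (j - 1) / j, by simp, fun s hs => ?_⟩
    set H : ℝ → ℝ := fun s => f (x + vert s) -
      ∑ j ∈ Finset.range (N + 1), (if j = 0 then f x else c (j - 1) / j) * s ^ j with hH
    have hC0 : 0 ≤ C := by
      have := (abs_nonneg _).trans (hc 1 zero_le_one)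
      simpa using this
    have hder : ∀ u, HasDerivAt H
        (partialD 2 f (x + vert u) - ∑ j ∈ Finset.range N, c j * u ^ j) u := by
      intro u
      refine (hasDerivAt_comp_vert hf.smooth x u).sub ?_
      have h1 := HasDerivAt.fun_sum (u := Finset.range (N + 1))
        (A := fun (j : ℕ) (s : ℝ) => (if j = 0 then f x else c (j - 1) / j) * s ^ j)
        (A' := fun j => (if j = 0 then f x else c (j - 1) / j) * (j * u ^ (j - 1)))
        fun j _ => (hasDerivAt_pow j u).const_mul _
      convert h1 using 1
      rw [Finset.sum_range_succ']
      simp only [Nat.cast_zero, zero_mul, mul_zero, add_zero]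
      refine Finset.sum_congr rfl fun j _ => ?_
      have : ((j + 1 : ℕ) : ℝ) ≠ 0 := by positivity
      rw [if_neg (by omega), Nat.add_sub_cancel]
      field_simp
    have h0 : H 0 = 0 := by
      simp [hH, Finset.sum_range_succ']
    have := (convex_Icc 0 s).norm_image_sub_le_of_norm_hasDerivWithin_le (f := H) (C := C * s ^ N)
      (fun u _ => (hder u).hasDerivWithinAt) (fun u hu => by
        refine (hc u hu.1).trans ?_
        have := hu.1
        have := hu.2
        gcongr) (left_mem_Icc.2 hs) (right_mem_Icc.2 hs)
    rw [h0, sub_zero, sub_zero, Real.norm_eq_abs, Real.norm_eq_abs, abs_of_nonneg hs, mul_assoc,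
      ← pow_succ] at this
    exact this

/-- Averages with a Stein kernel reproduce smooth functions up to any power of the step. -/
theorem IsSteinKernel.exists_abs_integral_sub_le {ψ : ℝ → ℝ} (h : IsSteinKernel ψ) {f : R3 → ℝ}
    (hf : IsBddSmooth f) {N : ℕ} (hN : 1 ≤ N) : ∃ C, ∀ x η, 0 ≤ η →
      |(∫ t in Ioi (1 : ℝ), f (x + vert (t * η)) * ψ t) - f x| ≤ C * η ^ N := by
  obtain ⟨C', hC'⟩ := hf.exists_taylor N
  refine ⟨C' * ∫ t in Ioi (1 : ℝ), |t ^ N * ψ t|, fun x η hη => ?_⟩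
  obtain ⟨c, hc0, hc⟩ := hC' x
  have hr := h.isRapid
  have hi := hr.integrableOn_comp_mul hf x η
  have hterm : ∀ j, IntegrableOn (fun t => c j * (t * η) ^ j * ψ t) (Ioi 1) := fun j => by
    have := (hr.pow_mul j).integrableOn.const_mul (c j * η ^ j)
    refine this.congr (Filter.Eventually.of_forall fun t => ?_)
    simp only [mul_pow]; ring
  -- The kernel sees only the constant term of the Taylor polynomial: it has mass one and its higher
  -- moments vanish.
  have hp : ∫ t in Ioi (1 : ℝ), (∑ j ∈ Finset.range N, c j * (t * η) ^ j) * ψ t = f x := by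
    simp only [Finset.sum_mul]
    rw [integral_finsetSum _ fun j _ => hterm j,
      Finset.sum_eq_single_of_mem 0 (Finset.mem_range.2 hN)]
    · simp [integral_const_mul, h.mass, hc0]
    · intro j _ hj
      have e : ∀ t, c j * (t * η) ^ j * ψ t = (c j * η ^ j) * (t ^ j * ψ t) := fun t => by
        rw [mul_pow]; ring
      simp only [e]
      rw [integral_const_mul, h.moments j (by omega), mul_zero]
  have hpi : IntegrableOn (fun t => (∑ j ∈ Finset.range N, c j * (t * η) ^ j) * ψ t) (Ioi 1) := by
    simp only [Finset.sum_mul]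
    exact integrable_finsetSum _ fun j _ => hterm j
  have e : (∫ t in Ioi (1 : ℝ), f (x + vert (t * η)) * ψ t) - f x =
      ∫ t in Ioi (1 : ℝ), (f (x + vert (t * η)) * ψ t -
        (∑ j ∈ Finset.range N, c j * (t * η) ^ j) * ψ t) := by
    rw [integral_sub hi hpi, hp]
  rw [e, mul_assoc, mul_comm _ (η ^ N), ← mul_assoc, ← integral_const_mul, ← Real.norm_eq_abs]
  refine norm_integral_le_of_norm_le ((hr.pow_mul N).integrableOn.abs.const_mul _) ?_
  filter_upwards [ae_restrict_mem measurableSet_Ioi] with t ht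
  have ht0 : (0 : ℝ) ≤ t := by linarith [show (1 : ℝ) < t from ht]
  rw [← sub_mul, norm_mul, Real.norm_eq_abs, Real.norm_eq_abs]
  calc _ ≤ C' * (t * η) ^ N * |ψ t| :=
        mul_le_mul_of_nonneg_right (hc _ (by positivity)) (abs_nonneg _)
    _ = _ := by rw [mul_pow, abs_mul, abs_of_nonneg (pow_nonneg ht0 N)]; ring

/-- Averages with a null kernel are small of any order in the step. -/
theorem IsNull.exists_abs_integral_le {θ : ℝ → ℝ} (h : IsNull θ) {f : R3 → ℝ}
    (hf : IsBddSmooth f) (N : ℕ) : ∃ C, ∀ x η, 0 ≤ η →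
      |∫ t in Ioi (1 : ℝ), f (x + vert (t * η)) * θ t| ≤ C * η ^ N := by
  obtain ⟨Θ, hΘ, he⟩ := h.exists_integral_eq N
  obtain ⟨B, hB⟩ := hf.bdd (List.replicate N 2)
  refine ⟨∫ t in Ioi (1 : ℝ), B * |Θ t|, fun x η hη => ?_⟩
  rw [he f hf x η, abs_mul, abs_pow, abs_neg, abs_of_nonneg hη, mul_comm]
  gcongr
  rw [← Real.norm_eq_abs]
  refine norm_integral_le_of_norm_le (hΘ.rapid.integrableOn.abs.const_mul B) ?_
  filter_upwards with t
  rw [norm_mul]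
  exact mul_le_mul_of_nonneg_right (hB _) (norm_nonneg _)

theorem fderiv_eq_sum_proj (f : R3 → ℝ) (x : R3) :
    fderiv ℝ f x = ∑ i, partialD i f x • (EuclideanSpace.proj i : R3 →L[ℝ] ℝ) := by
  ext v
  rw [fderiv_eq_sum_partialD]
  simp [mul_comm]

theorem contDiffOn_succ_of_partialD {U : Set R3} (hU : IsOpen U) {f : R3 → ℝ} {n : ℕ}
    (hd : DifferentiableOn ℝ f U) (h : ∀ i, ContDiffOn ℝ n (partialD i f) U) :
    ContDiffOn ℝ (n + 1 : ℕ) f U := by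
  push_cast
  rw [contDiffOn_succ_iff_fderiv_of_isOpen hU]
  refine ⟨hd, by simp, ?_⟩
  rw [funext (fderiv_eq_sum_proj f)]
  exact ContDiffOn.sum fun i _ => (h i).smul contDiffOn_const

/-! ### Vertical averages with a variable step, and their derivatives. -/

/-- Functions on the region below the graph of `w` that behave, together with all their
derivatives, like the power `m` of the depth. -/
structure IsSymbol (w : EuclideanSpace ℝ (Fin 2) → ℝ) (m : ℤ) (a : R3 → ℝ) : Prop where
  smooth : ContDiffOn ℝ ∞ a {x | 0 < depth w x}
  bdd : ∀ L : List (Fin 3), ∃ B, ∀ x, 0 < depth w x →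
    |listD L a x| ≤ B * depth w x ^ (m - L.length)

/-- The average of `f` over the vertical half-line above `x`, with step `η x` and kernel `θ`. -/
noncomputable def kernelAvg (η : R3 → ℝ) (θ : ℝ → ℝ) (f : R3 → ℝ) (x : R3) : ℝ :=
  ∫ t in Ioi (1 : ℝ), f (x + vert (t * η x)) * θ t

section
variable {M : ℝ≥0} {w : EuclideanSpace ℝ (Fin 2) → ℝ} {η : R3 → ℝ}

theorem IsSymbol.partialDeriv (hw : LipschitzWith M w) {m : ℤ} {a : R3 → ℝ} (h : IsSymbol w m a)
    (i : Fin 3) : IsSymbol w (m - 1) (partialD i a) := by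
  refine ⟨h.smooth.partialD (isOpen_depth_pos hw) i, fun L => ?_⟩
  obtain ⟨B, hB⟩ := h.bdd (L ++ [i])
  refine ⟨B, fun x hx => ?_⟩
  have := hB x hx
  rw [listD_append] at this
  have e : m - 1 - (L.length : ℤ) = m - ((L ++ [i]).length : ℤ) := by
    push_cast [List.length_append, List.length_singleton]; ring
  rw [e]; exact this

theorem IsSymbol.exists_uniform_bdd {m : ℤ} {a : R3 → ℝ} (h : IsSymbol w m a) (n : ℕ) :
    ∃ B, ∀ L : List (Fin 3), L.length ≤ n → ∀ x ∈ {x | 0 < depth w x},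
      |listD L a x| ≤ B * depth w x ^ (m - L.length) := by
  choose B hB using h.bdd
  obtain ⟨C, hC⟩ := ((List.finite_length_le (Fin 3) n).image B).bddAbove
  refine ⟨C, fun L hL x hx => (hB L x hx).trans ?_⟩
  have h1 : B L ≤ C := hC (mem_image_of_mem B hL)
  have h2 : 0 ≤ depth w x ^ (m - (L.length : ℤ)) := zpow_nonneg (le_of_lt hx) _
  exact mul_le_mul_of_nonneg_right h1 h2

theorem IsSymbol.mul (hw : LipschitzWith M w) {m n : ℤ} {a b : R3 → ℝ} (ha : IsSymbol w m a)
    (hb : IsSymbol w n b) : IsSymbol w (m + n) fun x => a x * b x := by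
  refine ⟨ha.smooth.mul hb.smooth, fun L => ?_⟩
  obtain ⟨A, hA⟩ := ha.exists_uniform_bdd L.length
  obtain ⟨B, hB⟩ := hb.exists_uniform_bdd L.length
  exact ⟨_, abs_listD_mul_le (isOpen_depth_pos hw) (fun x hx => hx) L.length a b ha.smooth hb.smooth
    m n A B hA hB L le_rfl⟩

/-- The derivative of the shifted point x + tη(x) e₃ grows linearly in t, uniformly near x because
the derivative of η is continuous there. Rapid decay of the kernel still provides a dominating
function. -/
theorem hasFDerivAt_kernelAvg {x : R3} (hηc : ∀ᶠ y in nhds x, DifferentiableAt ℝ η y) (hη' : ContinuousAt (fderiv ℝ η) x)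
    {θ : ℝ → ℝ} (hθ : IsRapid θ) {f : R3 → ℝ} (hf : IsBddSmooth f) :
    IntegrableOn (fun t => θ t • (fderiv ℝ f (x + vert (t * η x)) ∘L
        (ContinuousLinearMap.id ℝ R3 + t • (fderiv ℝ η x).smulRight
          (EuclideanSpace.single (2 : Fin 3) (1 : ℝ))))) (Ioi 1) ∧
    HasFDerivAt (kernelAvg η θ f)
      (∫ t in Ioi (1 : ℝ), θ t • (fderiv ℝ f (x + vert (t * η x)) ∘L
        (ContinuousLinearMap.id ℝ R3 +
          t • (fderiv ℝ η x).smulRight (EuclideanSpace.single (2 : Fin 3) (1 : ℝ))))) x := by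
  choose B hB using fun i : Fin 3 => hf.bdd [i]
  have hfd : ∀ y, ‖fderiv ℝ f y‖ ≤ ∑ i, B i := by
    intro y
    rw [fderiv_eq_sum_proj]
    refine (norm_sum_le _ _).trans (Finset.sum_le_sum fun i _ => ?_)
    rw [norm_smul]
    have h1 : ‖(EuclideanSpace.proj i : R3 →L[ℝ] ℝ)‖ ≤ 1 :=
      ContinuousLinearMap.opNorm_le_bound _ zero_le_one fun v => by
        simpa using PiLp.norm_apply_le v i
    calc _ ≤ ‖partialD i f y‖ * 1 := by gcongr
      _ ≤ B i := by rw [mul_one]; exact hB i y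
  set S := ∑ i, B i
  have hS : 0 ≤ S := (norm_nonneg _).trans (hfd 0)
  set K := ‖fderiv ℝ η x‖ + 1
  have hK : ∀ᶠ y in nhds x, DifferentiableAt ℝ η y ∧ ‖fderiv ℝ η y‖ < K :=
    hηc.and (hη'.norm.eventually_lt continuousAt_const (by simp [K]))
  have hK0 : 0 ≤ K := by positivity
  set e : R3 := EuclideanSpace.single (2 : Fin 3) (1 : ℝ) with he
  have hcont : ∀ y, ContinuousOn (fun t => f (y + vert (t * η y)) * θ t) (Ioi 1) := fun y =>
    (continuous_comp_vert_mul hf.smooth.continuous y (η y)).continuousOn.mul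
      (hθ.cont.mono Ioi_subset_Ici_self)
  have hmeas : AEStronglyMeasurable (fun t => θ t • (fderiv ℝ f (x + vert (t * η x)) ∘L
      (ContinuousLinearMap.id ℝ R3 + t • (fderiv ℝ η x).smulRight e)))
      (volume.restrict (Ioi 1)) := by
    refine ContinuousOn.aestronglyMeasurable ?_ measurableSet_Ioi
    refine (hθ.cont.mono Ioi_subset_Ici_self).smul (Continuous.continuousOn ?_)
    exact ((hf.smooth.continuous_fderiv (by simp)).comp (continuous_const.add
      (continuous_vert.comp (continuous_mul_const (η x))))).clm_comp (by fun_prop)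
  have hbound : ∀ᵐ t ∂(volume.restrict (Ioi (1 : ℝ))),
      ∀ y ∈ {y | DifferentiableAt ℝ η y ∧ ‖fderiv ℝ η y‖ < K},
      ‖θ t • (fderiv ℝ f (y + vert (t * η y)) ∘L
        (ContinuousLinearMap.id ℝ R3 + t • (fderiv ℝ η y).smulRight e))‖ ≤
        S * (1 + K) * |t ^ 1 * θ t| := by
    filter_upwards [ae_restrict_mem measurableSet_Ioi] with t ht y hy
    have ht1 : (1 : ℝ) < t := ht
    have h1 : ‖ContinuousLinearMap.id ℝ R3 + t • (fderiv ℝ η y).smulRight e‖ ≤ t * (1 + K) := by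
      refine (norm_add_le _ _).trans ?_
      have h2 : ‖t • (fderiv ℝ η y).smulRight e‖ ≤ t * K := by
        rw [norm_smul, ContinuousLinearMap.norm_smulRight_apply, Real.norm_eq_abs,
          abs_of_pos (by linarith)]
        have : ‖e‖ = 1 := by simp [he]
        rw [this, mul_one]
        exact mul_le_mul_of_nonneg_left hy.2.le (by linarith)
      have h3 : ‖ContinuousLinearMap.id ℝ R3‖ ≤ 1 := ContinuousLinearMap.norm_id_le
      linarith
    rw [norm_smul, abs_mul, pow_one, abs_of_pos (by linarith : 0 < t), Real.norm_eq_abs]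
    calc _ ≤ |θ t| * (S * (t * (1 + K))) := by
          gcongr
          exact (ContinuousLinearMap.opNorm_comp_le _ _).trans
            (mul_le_mul (hfd _) h1 (norm_nonneg _) hS)
      _ = _ := by ring
  have hbint := (hθ.pow_mul 1).integrableOn.abs.const_mul (S * (1 + K))
  refine ⟨hbint.mono' hmeas (hbound.mono fun t ht => ht x hK.self_of_nhds), ?_⟩
  refine hasFDerivAt_integral_of_dominated_of_fderiv_le
    (F := fun y t => f (y + vert (t * η y)) * θ t)
    (F' := fun y t => θ t • (fderiv ℝ f (y + vert (t * η y)) ∘L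
        (ContinuousLinearMap.id ℝ R3 + t • (fderiv ℝ η y).smulRight e)))
    (bound := fun t => S * (1 + K) * |t ^ 1 * θ t|) hK
    (Filter.Eventually.of_forall fun y => (hcont y).aestronglyMeasurable measurableSet_Ioi)
    (hθ.integrableOn_comp_mul hf x (η x)) hmeas hbound hbint ?_
  filter_upwards with t y hy
  have h1 : HasFDerivAt (fun y => y + vert (t * η y))
      (ContinuousLinearMap.id ℝ R3 + t • (fderiv ℝ η y).smulRight e) y := by
    have h2 : HasFDerivAt (fun y => (t * η y) • e) ((t • fderiv ℝ η y).smulRight e) y :=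
      (hy.1.hasFDerivAt.const_mul t).smul_const e
    have h3 : (fun y => y + vert (t * η y)) = fun y => y + (t * η y) • e :=
      funext fun y => by rw [vert_eq_smul]
    rw [h3]
    refine ((hasFDerivAt_id y).add h2).congr_fderiv ?_
    ext v; simp [mul_assoc]
  exact ((hf.smooth.differentiable (by simp) _).hasFDerivAt.comp y h1).mul_const (θ t)

/-- The second term, from the dependence of the step on x, has the kernel multiplied by t. For a
Stein kernel this is a null kernel, and that is the reason for the moment conditions. -/
theorem partialD_kernelAvg {U : Set R3} (hU : IsOpen U) (hη : ContDiffOn ℝ ∞ η U) {x : R3}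
    (hx : x ∈ U) {θ : ℝ → ℝ} (hθ : IsRapid θ) {f : R3 → ℝ} (hf : IsBddSmooth f) :
    DifferentiableAt ℝ (kernelAvg η θ f) x ∧ ∀ i, partialD i (kernelAvg η θ f) x =
      kernelAvg η θ (partialD i f) x +
        partialD i η x * kernelAvg η (fun t => t ^ 1 * θ t) (partialD 2 f) x := by
  have hd : ∀ y ∈ U, DifferentiableAt ℝ η y := fun y hy => hη.differentiableAt_of_isOpen hU hy
  have hc : ContinuousAt (fderiv ℝ η) x :=
    (hη.fderiv_of_isOpen hU (m := ∞) (by simp)).continuousOn.continuousAt (hU.mem_nhds hx)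
  obtain ⟨hint, h⟩ := hasFDerivAt_kernelAvg (Filter.eventually_of_mem (hU.mem_nhds hx) hd) hc hθ hf
  refine ⟨h.differentiableAt, fun i => ?_⟩
  have key : partialD i (kernelAvg η θ f) x = ∫ t in Ioi (1 : ℝ),
      (partialD i f (x + vert (t * η x)) * θ t +
        partialD i η x * (partialD 2 f (x + vert (t * η x)) * (t ^ 1 * θ t))) := by
    rw [partialD, h.fderiv, ContinuousLinearMap.integral_apply hint]
    refine integral_congr_ae (Filter.Eventually.of_forall fun t => ?_)
    simp [partialD]; ring
  rw [key, integral_add (hθ.integrableOn_comp_mul (hf.partialDeriv i) x (η x))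
    (((hθ.pow_mul 1).integrableOn_comp_mul (hf.partialDeriv 2) x (η x)).const_mul _),
    integral_const_mul]
  rfl

theorem contDiffOn_kernelAvg {U : Set R3} (hU : IsOpen U) (hη : ContDiffOn ℝ ∞ η U)
    {θ : ℝ → ℝ} (hθ : IsRapid θ) {f : R3 → ℝ} (hf : IsBddSmooth f) :
    ContDiffOn ℝ ∞ (kernelAvg η θ f) U := by
  rw [contDiffOn_infty]
  intro n
  induction n generalizing θ f with
  | zero =>
    exact_mod_cast contDiffOn_zero.2 fun x hx =>
      (partialD_kernelAvg hU hη hx hθ hf).1.continuousAt.continuousWithinAt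
  | succ n ih =>
    refine contDiffOn_succ_of_partialD hU (fun x hx =>
      (partialD_kernelAvg hU hη hx hθ hf).1.differentiableWithinAt) fun i => ?_
    refine ContDiffOn.congr ?_ fun x hx => (partialD_kernelAvg hU hη hx hθ hf).2 i
    exact (ih hθ (hf.partialDeriv i)).add ((((hη.partialD hU i)).of_le
      (by exact_mod_cast le_top)).mul (ih (hθ.pow_mul 1) (hf.partialDeriv 2)))

/-- The operators of order `n` that appear, besides the average of the derivative, when an average
is differentiated `n` times. -/
inductive IsRemainder (w : EuclideanSpace ℝ (Fin 2) → ℝ) (η : R3 → ℝ)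
    (n : ℕ) : ((R3 → ℝ) → R3 → ℝ) → Prop
  | zero : IsRemainder w η n fun _ _ => 0
  | term {m : ℕ} {L : List (Fin 3)} {θ : ℝ → ℝ} {a : R3 → ℝ} (h : L.length + m = n)
      (hθ : IsNull θ) (ha : IsSymbol w (-m) a) :
      IsRemainder w η n fun φ x => a x * kernelAvg η θ (listD L φ) x
  | add {R R' : (R3 → ℝ) → R3 → ℝ} (h : IsRemainder w η n R) (h' : IsRemainder w η n R') :
      IsRemainder w η n fun φ x => R φ x + R' φ x

theorem IsNull.pow_mul {θ : ℝ → ℝ} (h : IsNull θ) (k : ℕ) : IsNull fun t => t ^ k * θ t := by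
  refine ⟨h.rapid.pow_mul k, fun j => ?_⟩
  rw [← h.moments (j + k)]
  simp only [pow_add, mul_assoc]

/-- The derivative may fall on the coefficient, making it one order more singular, on φ directly, or
on the step, which gives a vertical derivative of φ, a bounded factor ∂η in the coefficient and a
factor t in the kernel. In each case |L| + m grows by exactly one and the kernel stays null. -/
theorem IsRemainder.exists_partialD (hw : LipschitzWith M w) (hη : IsSymbol w 1 η) {n : ℕ}
    {R : (R3 → ℝ) → R3 → ℝ} (h : IsRemainder w η n R) (i : Fin 3) :
    ∃ R', IsRemainder w η (n + 1) R' ∧ ∀ φ, IsBddSmooth φ → ∀ x, 0 < depth w x →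
      DifferentiableAt ℝ (R φ) x ∧ partialD i (R φ) x = R' φ x := by
  induction h with
  | zero =>
    exact ⟨_, .zero, fun φ _ x _ => ⟨by simp, by rw [partialD_const]⟩⟩
  | @term m L θ a h hθ ha =>
    have h1 : IsSymbol w (-(m + 1 : ℕ)) (partialD i a) := by
      have := ha.partialDeriv hw i
      rwa [show (-(m : ℤ) - 1) = -(m + 1 : ℕ) by push_cast; ring] at this
    have h2 : IsSymbol w (-m) fun x => a x * partialD i η x := by
      have := ha.mul hw (hη.partialDeriv hw i)
      simpa using this
    refine ⟨_, .add (.term (L := L) (by omega) hθ h1) (.add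
      (.term (L := i :: L) (by simp; omega) hθ ha)
      (.term (L := 2 :: L) (by simp; omega) (hθ.pow_mul 1) h2)), fun φ hφ x hx => ?_⟩
    obtain ⟨hd, he⟩ := partialD_kernelAvg (isOpen_depth_pos hw) hη.smooth hx hθ.rapid
      (hφ.listDeriv L)
    have hda := ha.smooth.differentiableAt_of_isOpen (isOpen_depth_pos hw) hx
    refine ⟨hda.mul hd, ?_⟩
    rw [partialD_mul hda hd, he i]
    simp only [listD_cons]
    ring
  | add _ _ ih ih' =>
    obtain ⟨R1, h1, e1⟩ := ih
    obtain ⟨R2, h2, e2⟩ := ih'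
    refine ⟨_, h1.add h2, fun φ hφ x hx => ?_⟩
    obtain ⟨d1, e1⟩ := e1 φ hφ x hx
    obtain ⟨d2, e2⟩ := e2 φ hφ x hx
    exact ⟨d1.add d2, by rw [partialD_add d1 d2, e1, e2]⟩

/-- Each differentiation of the main average yields the next main average and one term with kernel
tψ. So ψ itself, which is not null, only ever meets the full derivative of φ without a singular
coefficient. -/
theorem exists_listD_kernelAvg_eq (hw : LipschitzWith M w) (hη : IsSymbol w 1 η) {ψ : ℝ → ℝ}
    (hψ : IsSteinKernel ψ) (L : List (Fin 3)) :
    ∃ R, IsRemainder w η L.length R ∧ ∀ φ, IsBddSmooth φ → ∀ x, 0 < depth w x →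
      listD L (kernelAvg η ψ φ) x = kernelAvg η ψ (listD L φ) x + R φ x := by
  induction L with
  | nil => exact ⟨_, .zero, fun φ _ x _ => by simp⟩
  | cons i L ih =>
    obtain ⟨R, hR, e⟩ := ih
    obtain ⟨R', hR', e'⟩ := hR.exists_partialD hw hη i
    have h0 : IsSymbol w (-(0 : ℕ)) (partialD i η) := by simpa using hη.partialDeriv hw i
    refine ⟨_, .add (.term (L := 2 :: L) (by simp) (hψ.isNull le_rfl) h0) hR', fun φ hφ x hx => ?_⟩
    obtain ⟨d1, e1⟩ := partialD_kernelAvg (isOpen_depth_pos hw) hη.smooth hx hψ.isRapid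
      (hφ.listDeriv L)
    obtain ⟨d2, e2⟩ := e' φ hφ x hx
    rw [listD_cons, partialD_congr (isOpen_depth_pos hw) (fun y hy => e φ hφ y hy) i hx,
      partialD_add d1 d2, e1 i, e2]
    simp only [listD_cons, add_assoc]

/-- The finite set of multi-indices of order `n`. -/
def multiIdxEq (n : ℕ) : Finset (Fin 3 → ℕ) := (multiIdx n).filter fun α => order α = n

theorem mem_multiIdxEq {n : ℕ} {α : Fin 3 → ℕ} : α ∈ multiIdxEq n ↔ order α = n := by
  simp only [multiIdxEq, Finset.mem_filter, mem_multiIdx, and_iff_right_iff_imp]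
  exact fun h => h.le

/-- The sum over the derivatives of order `n` of the averages of their absolute values, with a
kernel of power type. -/
noncomputable def powerAvg (η : R3 → ℝ) (n N : ℕ) (φ : R3 → ℝ) (x : R3) : ℝ≥0∞ :=
  ∑ α ∈ multiIdxEq n, ∫⁻ t in Ioi (1 : ℝ),
    ‖multiD α φ (x + vert (t * η x))‖ₑ * ENNReal.ofReal ((t ^ N)⁻¹)

theorem enorm_kernelAvg_le {θ : ℝ → ℝ} {A : ℝ} {N : ℕ}
    (hA : ∀ t, 1 ≤ t → |θ t| ≤ A * (t ^ N)⁻¹) {φ : R3 → ℝ}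
    (hφ : ContDiff ℝ ∞ φ) (L : List (Fin 3)) (x : R3) :
    ‖kernelAvg η θ (listD L φ) x‖ₑ ≤ ENNReal.ofReal A * powerAvg η L.length N φ x := by
  have h1 : listD L φ = multiD (listIdx L) φ := funext fun y =>
    listD_eq_multiD isOpen_univ hφ.contDiffOn L (mem_univ y)
  have hA0 : 0 ≤ A := by simpa using (abs_nonneg _).trans (hA 1 le_rfl)
  rw [h1]
  calc _ ≤ ∫⁻ t in Ioi (1 : ℝ), ‖multiD (listIdx L) φ (x + vert (t * η x)) * θ t‖ₑ :=
        enorm_integral_le_lintegral_enorm _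
    _ ≤ ∫⁻ t in Ioi (1 : ℝ), ENNReal.ofReal A *
          (‖multiD (listIdx L) φ (x + vert (t * η x))‖ₑ * ENNReal.ofReal ((t ^ N)⁻¹)) := by
        refine setLIntegral_mono' measurableSet_Ioi fun t ht => ?_
        rw [enorm_mul, mul_left_comm, ← ENNReal.ofReal_mul hA0]
        gcongr
        rw [Real.enorm_eq_ofReal_abs]
        exact ENNReal.ofReal_le_ofReal (hA t (le_of_lt ht))
    _ = ENNReal.ofReal A * ∫⁻ t in Ioi (1 : ℝ),
          ‖multiD (listIdx L) φ (x + vert (t * η x))‖ₑ * ENNReal.ofReal ((t ^ N)⁻¹) :=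
        lintegral_const_mul' _ _ ENNReal.ofReal_ne_top
    _ ≤ _ := by
        gcongr
        exact Finset.single_le_sum (f := fun α => ∫⁻ t in Ioi (1 : ℝ),
          ‖multiD α φ (x + vert (t * η x))‖ₑ * ENNReal.ofReal ((t ^ N)⁻¹))
          (fun _ _ => zero_le) (mem_multiIdxEq.2 (order_listIdx L))

/-- The blow-up depth^{-m} of the coefficient is compensated by m powers of the step, itself of the
order of the depth. -/
theorem IsSymbol.exists_abs_mul_pow_le {m : ℕ} {a : R3 → ℝ} (ha : IsSymbol w (-m) a)
    (hη : IsSymbol w 1 η) : ∃ C, 0 ≤ C ∧ ∀ x, 0 < depth w x → |a x| * |η x| ^ m ≤ C := by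
  obtain ⟨A, hA⟩ := ha.bdd []
  obtain ⟨B, hB⟩ := hη.bdd []
  refine ⟨|A| * |B| ^ m, by positivity, fun x hx => ?_⟩
  have h1 := hA x hx
  have h2 := hB x hx
  simp only [listD_nil, List.length_nil, Nat.cast_zero, sub_zero, zpow_one, zpow_neg,
    zpow_natCast] at h1 h2
  have h3 : |a x| ≤ |A| * (depth w x ^ m)⁻¹ := h1.trans (by gcongr; exact le_abs_self A)
  have h4 : |η x| ≤ |B| * depth w x := h2.trans (by gcongr; exact le_abs_self B)
  calc |a x| * |η x| ^ m ≤ (|A| * (depth w x ^ m)⁻¹) * (|B| * depth w x) ^ m := by gcongr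
    _ = _ := by rw [mul_pow]; field_simp

/-- In a term with |L| = n − m derivatives and a coefficient of order −m, integrating by parts m
times supplies the m missing derivatives in the vertical direction, together with η^m, which cancels
the singularity of the coefficient. Hence only derivatives of order exactly n remain. -/
theorem IsRemainder.exists_enorm_le (hη : IsSymbol w 1 η) {n : ℕ}
    {R : (R3 → ℝ) → R3 → ℝ} (h : IsRemainder w η n R) (N : ℕ) :
    ∃ C : ℝ≥0, ∀ φ, IsBddSmooth φ → ∀ x, 0 < depth w x → ‖R φ x‖ₑ ≤ C * powerAvg η n N φ x := by
  induction h with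
  | zero => exact ⟨0, fun φ _ x _ => by simp⟩
  | @term m L θ a h hθ ha =>
    obtain ⟨Θ, hΘ, e⟩ := hθ.exists_integral_eq m
    obtain ⟨A, hA0, hA⟩ := hΘ.rapid.exists_le_rpow N
    obtain ⟨C, hC0, hC⟩ := ha.exists_abs_mul_pow_le hη
    refine ⟨(C * A).toNNReal, fun φ hφ x hx => ?_⟩
    have e1 : kernelAvg η θ (listD L φ) x =
        (-η x) ^ m * kernelAvg η Θ (listD (List.replicate m 2 ++ L) φ) x := by
      rw [listD_append]
      exact e _ (hφ.listDeriv L) x (η x)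
    have hlen : (List.replicate m (2 : Fin 3) ++ L).length = n := by simp; omega
    beta_reduce
    rw [e1, ← mul_assoc, enorm_mul]
    have h1 : ‖a x * (-η x) ^ m‖ₑ ≤ ENNReal.ofReal C := by
      rw [Real.enorm_eq_ofReal_abs, abs_mul, abs_pow, abs_neg]
      exact ENNReal.ofReal_le_ofReal (hC x hx)
    have h2 := enorm_kernelAvg_le (η := η) hA hφ.smooth (List.replicate m 2 ++ L) x
    rw [hlen] at h2
    calc _ ≤ ENNReal.ofReal C * (ENNReal.ofReal A * powerAvg η n N φ x) := by gcongr
      _ = _ := by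
        rw [← mul_assoc, ← ENNReal.ofReal_mul hC0]; rfl
  | add _ _ ih ih' =>
    obtain ⟨C, hC⟩ := ih
    obtain ⟨C', hC'⟩ := ih'
    refine ⟨C + C', fun φ hφ x hx => (enorm_add_le _ _).trans ?_⟩
    push_cast
    rw [add_mul]
    exact add_le_add (hC φ hφ x hx) (hC' φ hφ x hx)

/-- The derivatives of averages are bounded by averages of the derivatives of the same order. -/
theorem exists_enorm_listD_kernelAvg_le (hw : LipschitzWith M w) (hη : IsSymbol w 1 η)
    {ψ : ℝ → ℝ} (hψ : IsSteinKernel ψ) (L : List (Fin 3)) (N : ℕ) :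
    ∃ C : ℝ≥0, ∀ φ, IsBddSmooth φ → ∀ x, 0 < depth w x →
      ‖listD L (kernelAvg η ψ φ) x‖ₑ ≤ C * powerAvg η L.length N φ x := by
  obtain ⟨R, hR, e⟩ := exists_listD_kernelAvg_eq hw hη hψ L
  obtain ⟨C, hC⟩ := hR.exists_enorm_le hη N
  obtain ⟨A, hA0, hA⟩ := hψ.isRapid.exists_le_rpow N
  refine ⟨A.toNNReal + C, fun φ hφ x hx => ?_⟩
  rw [e φ hφ x hx]
  refine (enorm_add_le _ _).trans ?_
  push_cast
  rw [add_mul]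
  exact add_le_add (enorm_kernelAvg_le hA hφ.smooth L x) (hC φ hφ x hx)

theorem IsSymbol.exists_abs_le {a : R3 → ℝ} {m : ℤ} (ha : IsSymbol w m a) :
    ∃ A, 0 ≤ A ∧ ∀ x, 0 < depth w x → |a x| ≤ A * depth w x ^ m := by
  obtain ⟨A, hA⟩ := ha.bdd []
  refine ⟨|A|, abs_nonneg A, fun x hx => ?_⟩
  have h1 := hA x hx
  simp only [listD_nil, List.length_nil, Nat.cast_zero, sub_zero] at h1
  exact h1.trans (mul_le_mul_of_nonneg_right (le_abs_self A) (zpow_nonneg hx.le _))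

/-- For a fixed smooth φ one may gain N + m powers of the step: m cancel the coefficient and N are
left. -/
theorem IsRemainder.exists_abs_le (hη : IsSymbol w 1 η) (hη0 : ∀ x, 0 < depth w x → 0 ≤ η x)
    {n : ℕ} {R : (R3 → ℝ) → R3 → ℝ} (h : IsRemainder w η n R) {φ : R3 → ℝ} (hφ : IsBddSmooth φ)
    (N : ℕ) : ∃ C, ∀ x, 0 < depth w x → |R φ x| ≤ C * depth w x ^ N := by
  induction h with
  | zero => exact ⟨0, fun x _ => by simp⟩
  | @term m L θ a h hθ ha =>
    obtain ⟨C, hC⟩ := hθ.exists_abs_integral_le (hφ.listDeriv L) (N + m)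
    obtain ⟨A, hA0, hA⟩ := ha.exists_abs_le
    obtain ⟨B, hB0, hB⟩ := hη.exists_abs_le
    refine ⟨A * |C| * B ^ (N + m), fun x hx => ?_⟩
    have h1 := hA x hx
    have h2 := hB x hx
    rw [zpow_neg, zpow_natCast] at h1
    rw [zpow_one, abs_of_nonneg (hη0 x hx)] at h2
    have h3 : |kernelAvg η θ (listD L φ) x| ≤ |C| * (B * depth w x) ^ (N + m) := by
      refine (hC x (η x) (hη0 x hx)).trans ?_
      have := hη0 x hx
      gcongr
      exact le_abs_self C
    rw [abs_mul]
    calc _ ≤ (A * (depth w x ^ m)⁻¹) * (|C| * (B * depth w x) ^ (N + m)) := by gcongr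
      _ = _ := by rw [mul_pow, pow_add (depth w x)]; field_simp
  | add _ _ ih ih' =>
    obtain ⟨C, hC⟩ := ih
    obtain ⟨C', hC'⟩ := ih'
    refine ⟨C + C', fun x hx => (abs_add_le _ _).trans ?_⟩
    rw [add_mul]
    exact add_le_add (hC x hx) (hC' x hx)

/-- Averages of a smooth function agree with it at the graph to infinite order. -/
theorem exists_abs_listD_kernelAvg_sub_le (hw : LipschitzWith M w) (hη : IsSymbol w 1 η)
    (hη0 : ∀ x, 0 < depth w x → 0 ≤ η x) {ψ : ℝ → ℝ} (hψ : IsSteinKernel ψ) {φ : R3 → ℝ}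
    (hφ : IsBddSmooth φ) (L : List (Fin 3)) {N : ℕ} (hN : 1 ≤ N) :
    ∃ C, ∀ x, 0 < depth w x →
      |listD L (fun y => kernelAvg η ψ φ y - φ y) x| ≤ C * depth w x ^ N := by
  obtain ⟨R, hR, e⟩ := exists_listD_kernelAvg_eq hw hη hψ L
  obtain ⟨C, hC⟩ := hR.exists_abs_le hη hη0 hφ N
  obtain ⟨C', hC'⟩ := hψ.exists_abs_integral_sub_le (hφ.listDeriv L) hN
  obtain ⟨B, hB0, hB⟩ := hη.exists_abs_le
  refine ⟨|C'| * B ^ N + C, fun x hx => ?_⟩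
  rw [listD_sub (isOpen_depth_pos hw)
    (contDiffOn_kernelAvg (isOpen_depth_pos hw) hη.smooth hψ.isRapid hφ) hφ.smooth.contDiffOn L hx]
  simp only [e φ hφ x hx]
  have h2 := hB x hx
  rw [zpow_one, abs_of_nonneg (hη0 x hx)] at h2
  have h3 : |kernelAvg η ψ (listD L φ) x - listD L φ x| ≤ |C'| * (B * depth w x) ^ N := by
    refine (hC' x (η x) (hη0 x hx)).trans ?_
    have := hη0 x hx
    gcongr
    exact le_abs_self C'
  calc _ = |(kernelAvg η ψ (listD L φ) x - listD L φ x) + R φ x| := by ring_nf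
    _ ≤ |C'| * (B * depth w x) ^ N + C * depth w x ^ N :=
        (abs_add_le _ _).trans (add_le_add h3 (hC x hx))
    _ = _ := by rw [mul_pow]; ring

end

/-! ### Weighted estimates for the averages. -/

/-- Admissible steps: regularized distances that are at least twice the depth. -/
structure IsStep (w : EuclideanSpace ℝ (Fin 2) → ℝ) (η : R3 → ℝ) : Prop where
  symbol : IsSymbol w 1 η
  lower : ∀ x, 0 < depth w x → 2 * depth w x ≤ η x

/-- The `p`-th power of the `L^p`-norm of `f` on `G` with the weight `r^a`. -/
noncomputable def wInt (G : Set R3) (a p : ℝ) (f : R3 → ℝ) : ℝ≥0∞ :=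
  ∫⁻ x in G, (ENNReal.ofReal (axisDist x ^ a) * ‖f x‖ₑ) ^ p

section
variable {M : ℝ≥0} {w : EuclideanSpace ℝ (Fin 2) → ℝ} {η : R3 → ℝ}

theorem IsStep.pos (h : IsStep w η) {x : R3} (hx : 0 < depth w x) : 0 < η x :=
  (by linarith : 0 < 2 * depth w x).trans_le (h.lower x hx)

theorem IsStep.exists_upper (h : IsStep w η) :
    ∃ K, 0 ≤ K ∧ ∀ x, 0 < depth w x → η x ≤ K * depth w x := by
  obtain ⟨K, hK0, hK⟩ := h.symbol.exists_abs_le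
  exact ⟨K, hK0, fun x hx => (le_abs_self _).trans (by simpa using hK x hx)⟩

theorem IsStep.measurable_indicator (hw : LipschitzWith M w) (h : IsStep w η) :
    Measurable ({x | 0 < depth w x}.indicator η) := by
  classical
  rw [← piecewise_eq_indicator]
  exact h.symbol.smooth.continuousOn.measurable_piecewise continuousOn_const
    (isOpen_depth_pos hw).measurableSet

/-- Depth and distance to the boundary are comparable, so bounds in one translate into the other.
The factor 2 in δ* = 2cΔ is what gives η ≥ 2 · depth. -/
theorem isSteinDist_isStep (hw : LipschitzWith M w) (h : IsSteinDist w η) : IsStep w η := by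
  obtain ⟨Δ, c, hΔ, hc⟩ := h
  have hcl : ∀ {x}, 0 < depth w x → x ∉ closure (aboveGraph w) := fun {x} hx => by
    rwa [mem_closure_aboveGraph_iff hw, not_le]
  have hU := isOpen_depth_pos hw
  have hs : ContDiffOn ℝ ∞ Δ {x | 0 < depth w x} := by
    rw [← compl_closure_aboveGraph hw]; exact hΔ.smooth
  have he : EqOn η (fun x => (2 * c) * Δ x) {x | 0 < depth w x} := fun x hx => (hc x (hcl hx)).2
  refine ⟨⟨(contDiffOn_const.mul hs).congr he, fun L => ?_⟩, fun x hx => ?_⟩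
  · obtain ⟨B, hB⟩ := hΔ.deriv_bound (listIdx L)
    have hM : (0 : ℝ) < M + 1 := by positivity
    refine ⟨|2 * c| * (|B| * (1 + (M + 1) ^ L.length)), fun x hx => ?_⟩
    rw [listD_congr hU he L hx, listD_const_mul hU hs _ L hx]
    beta_reduce
    rw [listD_eq_multiD hU hs L hx, abs_mul, mul_assoc]
    gcongr
    have h1 := hB x (hcl hx)
    rw [order_listIdx] at h1
    have hi := infDist_frontier_pos hw hx
    have h2 := depth_le_infDist_frontier hw x
    have h3 := infDist_frontier_le hw hx
    set ι := Metric.infDist x (frontier (aboveGraph w))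
    refine h1.trans ?_
    rw [mul_assoc]
    refine mul_le_mul (le_abs_self B) ?_ (zpow_nonneg hi.le _) (abs_nonneg B)
    -- At order zero the distance is bounded by the depth; for higher orders the power is
    -- nonpositive and the Lipschitz comparison in the other direction is needed.
    rcases Nat.eq_zero_or_pos L.length with h0 | h0
    · simp only [h0, Nat.cast_zero, sub_zero, zpow_one, pow_zero]
      linarith
    · obtain ⟨j, hj⟩ := Nat.exists_eq_add_of_lt h0
      have e2 : 1 - (L.length : ℤ) = -(j : ℤ) := by rw [hj]; push_cast; ring
      rw [e2, zpow_neg, zpow_neg, zpow_natCast, zpow_natCast, hj]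
      have h4 : depth w x ^ j ≤ (M + 1) ^ j * ι ^ j := by rw [← mul_pow]; gcongr
      have h5 : (ι ^ j)⁻¹ ≤ (M + 1) ^ j * (depth w x ^ j)⁻¹ := by
        rw [← div_eq_mul_inv, le_div_iff₀ (by positivity), inv_mul_le_iff₀ (by positivity)]
        linarith
      have h6 : ((M : ℝ) + 1) ^ j ≤ 1 + (M + 1) ^ (0 + j + 1) := by
        have : ((M : ℝ) + 1) ^ j ≤ (M + 1) ^ (0 + j + 1) :=
          pow_le_pow_right₀ (by linarith [M.2]) (by omega)
        linarith
      exact h5.trans (by gcongr)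
  · obtain ⟨h1, h2⟩ := hc x (hcl hx)
    have h3 : depth w x ≤ c * Δ x := h1
    rw [h2]; linarith

/-- Substituting s = tb makes the actual vertical displacement the variable, as the shear requires.
-/
theorem setLIntegral_comp_mul_inv_sq {G : ℝ → ℝ≥0∞} {b : ℝ} (hb : 0 < b) :
    ∫⁻ t in Ioi (1 : ℝ), G (t * b) * ENNReal.ofReal ((t ^ 2)⁻¹) =
      ∫⁻ s in Ioi b, G s * ENNReal.ofReal (b / s ^ 2) := by
  have himg : (fun t : ℝ => t * b) '' Ioi 1 = Ioi b := by
    ext s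
    constructor
    · rintro ⟨t, ht, rfl⟩
      exact lt_mul_of_one_lt_left hb ht
    · intro hs
      exact ⟨s / b, (one_lt_div hb).2 hs, div_mul_cancel₀ s hb.ne'⟩
  rw [← himg, lintegral_image_eq_lintegral_abs_deriv_mul (f' := fun _ => b) measurableSet_Ioi
    (fun t _ => (hasDerivAt_mul_const b).hasDerivWithinAt)
    (fun s _ t _ h => mul_right_cancel₀ hb.ne' h)]
  refine setLIntegral_congr_fun measurableSet_Ioi fun t ht => ?_
  have ht' : 0 < t := lt_trans one_pos ht
  rw [abs_of_pos hb, mul_left_comm, ← ENNReal.ofReal_mul hb.le]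
  congr 2
  field_simp

/-- Averages along vertical half-lines map `L^1` above the graph to `L^1` below it. -/
theorem IsStep.exists_lintegral_avg_le (hw : LipschitzWith M w) (h : IsStep w η) :
    ∃ K : ℝ≥0, ∀ F : R3 → ℝ≥0∞, Measurable F →
      ∫⁻ x in {x | 0 < depth w x},
        ∫⁻ t in Ioi (1 : ℝ), F (x + vert (t * η x)) * ENNReal.ofReal ((t ^ 2)⁻¹) ≤
      K * ∫⁻ y in aboveGraph w, F y := by
  obtain ⟨K, hK0, hK⟩ := h.exists_upper
  refine ⟨K.toNNReal, fun F hF => ?_⟩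
  have hUm := (isOpen_depth_pos hw).measurableSet
  have hdm : Measurable (depth w) := (continuous_depth hw).measurable
  set S : Set (R3 × ℝ) := {q | 0 < depth w q.1 ∧ 2 * depth w q.1 < q.2} with hS
  have hSm : MeasurableSet S :=
    (measurableSet_lt measurable_const (hdm.comp measurable_fst)).inter
      (measurableSet_lt ((hdm.comp measurable_fst).const_mul 2) measurable_snd)
  set Q : R3 × ℝ → ℝ≥0∞ := S.indicator fun q =>
    F (q.1 + vert q.2) * ENNReal.ofReal (K * depth w q.1 / q.2 ^ 2) with hQ
  have hQm : Measurable Q := by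
    refine Measurable.indicator ?_ hSm
    refine (hF.comp (measurable_fst.add (continuous_vert.measurable.comp measurable_snd))).mul ?_
    exact (((hdm.comp measurable_fst).const_mul K).div (measurable_snd.pow_const 2)).ennreal_ofReal
  have h1 : ∀ x ∈ {x | 0 < depth w x},
      ∫⁻ t in Ioi (1 : ℝ), F (x + vert (t * η x)) * ENNReal.ofReal ((t ^ 2)⁻¹) ≤
        ∫⁻ s, Q (x, s) := by
    intro x hx
    rw [setLIntegral_comp_mul_inv_sq (G := fun s => F (x + vert s)) (h.pos hx),
      ← lintegral_indicator measurableSet_Ioi]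
    refine lintegral_mono fun s => indicator_apply_le' (fun hs => ?_) fun _ => zero_le
    have hs' : η x < s := hs
    have hmem : (x, s) ∈ S := ⟨hx, (h.lower x hx).trans_lt hs'⟩
    rw [hQ, indicator_of_mem hmem]
    have := hK x hx
    gcongr
  have h2 : ∀ y, ∫⁻ s, Q (y - vert s, s) ≤
      (aboveGraph w).indicator (fun y => F y * ENNReal.ofReal K) y := by
    intro y
    have hd : ∀ s, depth w (y - vert s) = depth w y + s := by
      intro s
      have := depth_add_vert w (y - vert s) s
      rw [sub_add_cancel] at this
      linarith
    by_cases hy : depth w y < 0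
    · rw [indicator_of_mem (mem_aboveGraph_iff.2 hy)]
      set b := -depth w y with hb
      have hb0 : 0 < b := by linarith
      -- For y at height b above the graph, the point y − s e₃ has depth s − b, and the conditions 0
      -- < s − b and 2(s − b) < s leave only b < s < 2b. There the kernel is at most K/b, on an
      -- interval of length b, so the bound does not depend on b.
      have h3 : ∀ s, Q (y - vert s, s) ≤
          (Ioo b (2 * b)).indicator (fun _ => F y * ENNReal.ofReal (K / b)) s := by
        intro s
        refine indicator_apply_le' (fun hs => ?_) fun _ => zero_le
        obtain ⟨hs1, hs2⟩ := hs
        simp only [hd] at hs1 hs2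
        rw [indicator_of_mem (show s ∈ Ioo b (2 * b) from ⟨by linarith, by linarith⟩)]
        simp only [hd, sub_add_cancel]
        refine mul_le_mul_right (ENNReal.ofReal_le_ofReal ?_) _
        have h4 : depth w y + s ≤ b := by linarith
        have h5 : b ^ 2 ≤ s ^ 2 := by gcongr; linarith
        calc K * (depth w y + s) / s ^ 2 ≤ K * b / b ^ 2 := by gcongr
          _ = K / b := by field_simp
      calc ∫⁻ s, Q (y - vert s, s)
          ≤ ∫⁻ s, (Ioo b (2 * b)).indicator (fun _ => F y * ENNReal.ofReal (K / b)) s :=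
            lintegral_mono h3
        _ = F y * (ENNReal.ofReal (K / b) * ENNReal.ofReal b) := by
            rw [lintegral_indicator measurableSet_Ioo, setLIntegral_const, Real.volume_Ioo,
              mul_assoc, show 2 * b - b = b by ring]
        _ ≤ F y * ENNReal.ofReal K := by
            rw [← ENNReal.ofReal_mul (by positivity), div_mul_cancel₀ _ hb0.ne']
    · refine le_of_eq_of_le (lintegral_congr (g := fun _ => 0) fun s => ?_) (by simp)
      refine indicator_of_notMem ?_ _
      rintro ⟨hs1, hs2⟩
      simp only [hd] at hs1 hs2
      linarith
  calc _ ≤ ∫⁻ x in {x | 0 < depth w x}, ∫⁻ s, Q (x, s) := setLIntegral_mono' hUm h1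
    _ ≤ ∫⁻ x, ∫⁻ s, Q (x, s) := setLIntegral_le_lintegral _ _
    _ = ∫⁻ y, ∫⁻ s, Q (y - vert s, s) := lintegral_shear hQm
    _ ≤ ∫⁻ y, (aboveGraph w).indicator (fun y => F y * ENNReal.ofReal K) y := lintegral_mono h2
    _ = _ := by
      rw [lintegral_indicator (isOpen_aboveGraph hw).measurableSet, lintegral_mul_const _ hF,
        mul_comm]
      rfl

/-- The probability measure `t⁻² dt` on `(1, ∞)`. -/
noncomputable def invSqMeasure : Measure ℝ :=
  (volume.restrict (Ioi 1)).withDensity fun t => ENNReal.ofReal ((t ^ 2)⁻¹)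

theorem measurable_ofReal_inv_pow (N : ℕ) :
    Measurable fun t : ℝ => ENNReal.ofReal ((t ^ N)⁻¹) := by fun_prop

theorem lintegral_invSqMeasure {G : ℝ → ℝ≥0∞} (hG : Measurable G) :
    ∫⁻ t, G t ∂invSqMeasure = ∫⁻ t in Ioi (1 : ℝ), G t * ENNReal.ofReal ((t ^ 2)⁻¹) := by
  rw [invSqMeasure, lintegral_withDensity_eq_lintegral_mul _ (measurable_ofReal_inv_pow 2) hG]
  exact lintegral_congr fun t => mul_comm _ _

instance isProbabilityMeasure_invSqMeasure : IsProbabilityMeasure invSqMeasure := by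
  constructor
  rw [← setLIntegral_one, Measure.restrict_univ, lintegral_invSqMeasure measurable_const]
  simp only [one_mul]
  have hi : IntegrableOn (fun t : ℝ => t ^ (-2 : ℝ)) (Ioi 1) :=
    integrableOn_Ioi_rpow_of_lt (by norm_num) one_pos
  have e : ∀ t ∈ Ioi (1 : ℝ), ENNReal.ofReal ((t ^ 2)⁻¹) = ENNReal.ofReal (t ^ (-2 : ℝ)) := by
    intro t ht
    have ht' : 0 < t := lt_trans one_pos ht
    rw [Real.rpow_neg ht'.le]
    norm_num
  rw [setLIntegral_congr_fun measurableSet_Ioi e, ← ofReal_integral_eq_lintegral_ofReal hi]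
  · rw [integral_Ioi_rpow_of_lt (by norm_num) one_pos]
    norm_num
  · filter_upwards [ae_restrict_mem measurableSet_Ioi] with t ht
    have ht' : 0 < t := lt_trans one_pos ht
    simp only [Pi.zero_apply]
    positivity

/-- Jensen's inequality for the probability measure t⁻² dt, as monotonicity of L^p norms in the
exponent. -/
theorem rpow_lintegral_inv_sq_le {G : ℝ → ℝ≥0∞} (hG : Measurable G) {p : ℝ} (hp : 1 ≤ p) :
    (∫⁻ t in Ioi (1 : ℝ), G t * ENNReal.ofReal ((t ^ 2)⁻¹)) ^ p ≤
      ∫⁻ t in Ioi (1 : ℝ), G t ^ p * ENNReal.ofReal ((t ^ 2)⁻¹) := by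
  have h := eLpNorm'_le_eLpNorm'_of_exponent_le one_pos hp invSqMeasure hG.aestronglyMeasurable
  simp only [eLpNorm'_eq_lintegral_enorm, ENNReal.rpow_one, div_one, enorm_eq_self] at h
  rw [lintegral_invSqMeasure hG, lintegral_invSqMeasure (hG.pow_const p)] at h
  have hp0 : 0 < p := by linarith
  calc _ ≤ ((∫⁻ t in Ioi (1 : ℝ), G t ^ p * ENNReal.ofReal ((t ^ 2)⁻¹)) ^ (1 / p)) ^ p :=
        ENNReal.rpow_le_rpow h hp0.le
    _ = _ := by rw [← ENNReal.rpow_mul, one_div_mul_cancel hp0.ne', ENNReal.rpow_one]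

/-- The weights at the two ends of a vertical segment across the graph are comparable. -/
theorem IsStep.exists_axisDist_rpow_le (hw : LipschitzWith M w)
    (haxis : axis ⊆ frontier (aboveGraph w)) (h : IsStep w η) (a : ℝ) :
    ∃ C, 0 ≤ C ∧ ∀ x, 0 < depth w x → ∀ t, 1 ≤ t →
      axisDist x ^ a ≤ C * t ^ ⌈|a|⌉₊ * axisDist (x + vert (t * η x)) ^ a := by
  obtain ⟨K, hK0, hK⟩ := h.exists_upper
  set c : ℝ := 1 + K * (M + 1) + 2 * (M + 1) with hc
  have hM : (0 : ℝ) < M + 1 := by positivity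
  have hc1 : 1 ≤ c := by
    have : 0 ≤ K * (M + 1) := by positivity
    linarith
  refine ⟨c ^ |a|, by positivity, fun x hx t ht => ?_⟩
  set y := x + vert (t * η x) with hy
  have hη := h.pos hx
  have hdx := (le_abs_self _).trans (abs_depth_le_axisDist hw haxis x)
  have hdy := (neg_le_abs _).trans (abs_depth_le_axisDist hw haxis y)
  have hyd : depth w y = depth w x - t * η x := depth_add_vert w x _
  have hl := h.lower x hx
  have hu := hK x hx
  have hnorm : ‖vert (t * η x)‖ = t * η x := by rw [norm_vert, abs_of_nonneg (by positivity)]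
  have hxy : axisDist x ≤ axisDist y + t * η x := by
    have := axisDist_le_add x y
    rwa [hy, sub_add_cancel_left, norm_neg, hnorm] at this
  have hyx : axisDist y ≤ axisDist x + t * η x := by
    have := axisDist_le_add y x
    rwa [hy, add_sub_cancel_left, hnorm] at this
  have hrx : 0 < axisDist x := pos_of_mul_pos_right (hx.trans_le hdx) hM.le
  have hη1 : η x ≤ t * η x := le_mul_of_one_le_left hη.le ht
  have hry0 : 0 ≤ axisDist y := axisDist_nonneg y
  -- Since 2 · depth(x) ≤ η(x) ≤ tη(x), the end point y lies at height at least tη/2 above the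
  -- graph, so tη ≤ 2(M + 1) r(y).
  have b1 : axisDist x ≤ c * t * axisDist y := by
    have h1 : axisDist x ≤ (1 + 2 * (M + 1)) * axisDist y := by nlinarith
    have h2 : 1 + 2 * ((M : ℝ) + 1) ≤ c * t := by
      have : 0 ≤ K * (M + 1) := by positivity
      nlinarith
    exact h1.trans (mul_le_mul_of_nonneg_right h2 hry0)
  have hry : 0 < axisDist y := by
    rcases hry0.eq_or_lt with h0 | h0
    · rw [← h0, mul_zero] at b1; linarith
    · exact h0
  -- Conversely η is at most K times the depth of x, hence at most K(M + 1) r(x); here the factor t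
  -- is lost.
  have b2 : axisDist y ≤ c * t * axisDist x := by
    have h1 : t * η x ≤ t * (K * ((M + 1) * axisDist x)) := by gcongr; exact hu.trans (by gcongr)
    have h2 : axisDist x ≤ t * axisDist x := le_mul_of_one_le_left hrx.le ht
    have h3 : 0 ≤ 2 * ((M : ℝ) + 1) * (t * axisDist x) := by positivity
    calc axisDist y ≤ t * axisDist x + t * (K * ((M + 1) * axisDist x)) := by linarith
      _ ≤ c * t * axisDist x := by rw [hc]; linarith
  have hct : 1 ≤ c * t := by nlinarith
  have key : axisDist x ^ a ≤ (c * t) ^ |a| * axisDist y ^ a := by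
    rcases le_total 0 a with ha | ha
    · rw [abs_of_nonneg ha, ← Real.mul_rpow (by positivity) hry0]
      exact Real.rpow_le_rpow hrx.le b1 ha
    · have : (axisDist y / (c * t)) ≤ axisDist x := by
        rw [div_le_iff₀' (by positivity)]; exact b2
      have h1 := Real.rpow_le_rpow_of_nonpos (by positivity) this ha
      rw [Real.div_rpow hry0 (by positivity)] at h1
      rw [abs_of_nonpos ha, Real.rpow_neg (by positivity)]
      rwa [div_eq_inv_mul] at h1
  refine key.trans ?_
  rw [Real.mul_rpow (by positivity) (by positivity)]
  have : t ^ |a| ≤ t ^ ⌈|a|⌉₊ := by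
    rw [← Real.rpow_natCast]
    exact Real.rpow_le_rpow_of_exponent_le ht (Nat.le_ceil _)
  gcongr

/-- Of the decay t^{−(⌈|a|⌉ + 2)}, the first ⌈|a|⌉ powers pay for moving the weight from x to the
shifted point. The remaining t⁻² is the measure for Jensen's inequality and for the L¹ bound. -/
theorem IsStep.exists_lintegral_rpow_avg_le (hw : LipschitzWith M w)
    (haxis : axis ⊆ frontier (aboveGraph w)) (h : IsStep w η) (a : ℝ) {p : ℝ} (hp : 1 ≤ p) :
    ∃ C : ℝ≥0, ∀ f : R3 → ℝ, Measurable f →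
      ∫⁻ x in {x | 0 < depth w x}, (ENNReal.ofReal (axisDist x ^ a) *
        ∫⁻ t in Ioi (1 : ℝ), ‖f (x + vert (t * η x))‖ₑ *
          ENNReal.ofReal ((t ^ (⌈|a|⌉₊ + 2))⁻¹)) ^ p ≤ C * wInt (aboveGraph w) a p f := by
  obtain ⟨c, hc0, hc⟩ := h.exists_axisDist_rpow_le hw haxis a
  obtain ⟨K, hK⟩ := h.exists_lintegral_avg_le hw
  have hp0 : 0 ≤ p := by linarith
  refine ⟨c.toNNReal ^ p * K, fun f hf => ?_⟩
  set g : R3 → ℝ≥0∞ := fun y => ENNReal.ofReal (axisDist y ^ a) * ‖f y‖ₑ with hg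
  have hgm : Measurable g :=
    ((continuous_axisDist.measurable.pow_const a).ennreal_ofReal).mul hf.enorm
  have hline : ∀ x : R3, Measurable fun t : ℝ => x + vert (t * η x) := fun x =>
    (continuous_const.add (continuous_vert.comp (continuous_mul_const (η x)))).measurable
  have h1 : ∀ x ∈ {x | 0 < depth w x}, (ENNReal.ofReal (axisDist x ^ a) *
        ∫⁻ t in Ioi (1 : ℝ), ‖f (x + vert (t * η x))‖ₑ *
          ENNReal.ofReal ((t ^ (⌈|a|⌉₊ + 2))⁻¹)) ^ p ≤
      ENNReal.ofReal c ^ p * ∫⁻ t in Ioi (1 : ℝ), g (x + vert (t * η x)) ^ p *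
        ENNReal.ofReal ((t ^ 2)⁻¹) := by
    intro x hx
    have h2 : ENNReal.ofReal (axisDist x ^ a) *
        ∫⁻ t in Ioi (1 : ℝ), ‖f (x + vert (t * η x))‖ₑ *
          ENNReal.ofReal ((t ^ (⌈|a|⌉₊ + 2))⁻¹) ≤
        ENNReal.ofReal c * ∫⁻ t in Ioi (1 : ℝ), g (x + vert (t * η x)) *
          ENNReal.ofReal ((t ^ 2)⁻¹) := by
      rw [← lintegral_const_mul' _ _ ENNReal.ofReal_ne_top,
        ← lintegral_const_mul' _ _ ENNReal.ofReal_ne_top]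
      refine setLIntegral_mono' measurableSet_Ioi fun t ht => ?_
      have ht1 : 1 ≤ t := le_of_lt ht
      have ht0 : 0 < t := by linarith
      set y := x + vert (t * η x)
      have h3 : axisDist x ^ a * (t ^ (⌈|a|⌉₊ + 2))⁻¹ ≤ c * (axisDist y ^ a * (t ^ 2)⁻¹) := by
        calc _ ≤ (c * t ^ ⌈|a|⌉₊ * axisDist y ^ a) * (t ^ (⌈|a|⌉₊ + 2))⁻¹ := by
              gcongr; exact hc x hx t ht1
          _ = _ := by rw [pow_add]; field_simp
      have hr1 : 0 ≤ axisDist x ^ a := Real.rpow_nonneg (axisDist_nonneg x) a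
      have hr2 : 0 ≤ axisDist y ^ a := Real.rpow_nonneg (axisDist_nonneg y) a
      calc _ = ‖f y‖ₑ * ENNReal.ofReal (axisDist x ^ a * (t ^ (⌈|a|⌉₊ + 2))⁻¹) := by
            rw [ENNReal.ofReal_mul hr1]; ring
        _ ≤ ‖f y‖ₑ * ENNReal.ofReal (c * (axisDist y ^ a * (t ^ 2)⁻¹)) := by gcongr
        _ = _ := by rw [ENNReal.ofReal_mul hc0, ENNReal.ofReal_mul hr2, hg]; ring
    refine (ENNReal.rpow_le_rpow h2 hp0).trans ?_
    rw [ENNReal.mul_rpow_of_nonneg _ _ hp0]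
    gcongr
    exact rpow_lintegral_inv_sq_le (hgm.comp (hline x)) hp
  have e : ((c.toNNReal ^ p * K : ℝ≥0) : ℝ≥0∞) = ENNReal.ofReal c ^ p * K := by
    rw [ENNReal.coe_mul, ENNReal.coe_rpow_of_nonneg _ hp0]; rfl
  rw [e]
  calc _ ≤ ∫⁻ x in {x | 0 < depth w x}, ENNReal.ofReal c ^ p *
        ∫⁻ t in Ioi (1 : ℝ), g (x + vert (t * η x)) ^ p * ENNReal.ofReal ((t ^ 2)⁻¹) :=
        setLIntegral_mono' (isOpen_depth_pos hw).measurableSet h1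
    _ = ENNReal.ofReal c ^ p * ∫⁻ x in {x | 0 < depth w x},
        ∫⁻ t in Ioi (1 : ℝ), g (x + vert (t * η x)) ^ p * ENNReal.ofReal ((t ^ 2)⁻¹) :=
        lintegral_const_mul' _ _ (ENNReal.rpow_ne_top_of_nonneg hp0 ENNReal.ofReal_ne_top)
    _ ≤ ENNReal.ofReal c ^ p * (K * ∫⁻ y in aboveGraph w, g y ^ p) := by
        gcongr
        exact hK _ (hgm.pow_const p)
    _ = _ := by rw [mul_assoc]; rfl

theorem ContDiff.multiD {f : R3 → ℝ} (hf : ContDiff ℝ ∞ f) (α : Fin 3 → ℕ) :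
    ContDiff ℝ ∞ (multiD α f) := by
  rw [multiD_eq_listD]; exact hf.listD _

theorem measurable_line {ζ : R3 → ℝ} (hζ : Measurable ζ) :
    Measurable fun q : R3 × ℝ => q.1 + vert (q.2 * ζ q.1) :=
  measurable_fst.add (continuous_vert.measurable.comp (measurable_snd.mul (hζ.comp measurable_fst)))

theorem measurable_lintegral_line {ζ : R3 → ℝ} (hζ : Measurable ζ) {F : R3 → ℝ≥0∞}
    (hF : Measurable F) {k : ℝ → ℝ≥0∞} (hk : Measurable k) :
    Measurable fun x => ∫⁻ t in Ioi (1 : ℝ), F (x + vert (t * ζ x)) * k t :=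
  ((hF.comp (measurable_line hζ)).mul (hk.comp measurable_snd)).lintegral_prod_right'

/-- The weighted norms of derivatives of averages are bounded by those above the graph. -/
theorem IsStep.exists_wInt_multiD_le (hw : LipschitzWith M w)
    (haxis : axis ⊆ frontier (aboveGraph w)) (h : IsStep w η) {ψ : ℝ → ℝ} (hψ : IsSteinKernel ψ)
    (a : ℝ) {p : ℝ} (hp : 1 ≤ p) (α : Fin 3 → ℕ) :
    ∃ C : ℝ≥0, ∀ φ, IsBddSmooth φ →
      wInt {x | 0 < depth w x} a p (multiD α (kernelAvg η ψ φ)) ≤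
        C * ∑ β ∈ multiIdxEq (order α), wInt (aboveGraph w) a p (multiD β φ) := by
  obtain ⟨C, hC⟩ := exists_enorm_listD_kernelAvg_le hw h.symbol hψ (multiList α) (⌈|a|⌉₊ + 2)
  obtain ⟨C', hC'⟩ := h.exists_lintegral_rpow_avg_le hw haxis a hp
  have hp0 : 0 ≤ p := by linarith
  set s := multiIdxEq (order α) with hs
  set U := {x | 0 < depth w x} with hU
  refine ⟨C ^ p * ((s.card : ℝ≥0) ^ (p - 1) * C'), fun φ hφ => ?_⟩
  have hUm : MeasurableSet U := (isOpen_depth_pos hw).measurableSet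
  set k : ℝ → ℝ≥0∞ := fun t => ENNReal.ofReal ((t ^ (⌈|a|⌉₊ + 2))⁻¹) with hk
  -- Nothing is known about η on or above the graph; its truncation is globally measurable and
  -- agrees with it below.
  set ζ := U.indicator η
  set J : (Fin 3 → ℕ) → R3 → ℝ≥0∞ := fun β x => ENNReal.ofReal (axisDist x ^ a) *
    ∫⁻ t in Ioi (1 : ℝ), ‖multiD β φ (x + vert (t * ζ x))‖ₑ * k t with hJ
  have hJm : ∀ β, Measurable fun x => J β x ^ p := fun β =>
    (((continuous_axisDist.measurable.pow_const a).ennreal_ofReal).mul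
      (measurable_lintegral_line (h.measurable_indicator hw)
        (hφ.smooth.multiD β).continuous.measurable.enorm (measurable_ofReal_inv_pow _))).pow_const p
  have h1 : ∀ x ∈ U, (ENNReal.ofReal (axisDist x ^ a) * ‖multiD α (kernelAvg η ψ φ) x‖ₑ) ^ p ≤
        (C : ℝ≥0∞) ^ p * ((s.card : ℝ≥0∞) ^ (p - 1) * ∑ β ∈ s, J β x ^ p) := by
    intro x hx
    have hζ : ζ x = η x := indicator_of_mem hx η
    have h2 := hC φ hφ x hx
    rw [length_multiList, ← multiD_eq_listD] at h2
    have h3 : ENNReal.ofReal (axisDist x ^ a) *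
        (C * powerAvg η (order α) (⌈|a|⌉₊ + 2) φ x) = C * ∑ β ∈ s, J β x := by
      simp only [hJ, hζ]
      rw [← Finset.mul_sum, mul_left_comm]
      rfl
    calc _ ≤ (ENNReal.ofReal (axisDist x ^ a) * (C * powerAvg η (order α) (⌈|a|⌉₊ + 2) φ x)) ^ p :=
          by gcongr
      _ ≤ _ := by
          rw [h3, ENNReal.mul_rpow_of_nonneg _ _ hp0]
          gcongr
          exact ENNReal.rpow_sum_le_const_mul_sum_rpow s _ hp
  have h4 : ∀ β, ∫⁻ x in U, J β x ^ p ≤ C' * wInt (aboveGraph w) a p (multiD β φ) := by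
    intro β
    refine le_trans (le_of_eq (setLIntegral_congr_fun hUm fun x hx => ?_))
      (hC' _ (hφ.smooth.multiD β).continuous.measurable)
    have hζ : ζ x = η x := indicator_of_mem hx η
    simp only [hJ, hζ, hk]
  have e : ((C ^ p * ((s.card : ℝ≥0) ^ (p - 1) * C') : ℝ≥0) : ℝ≥0∞) =
      (C : ℝ≥0∞) ^ p * ((s.card : ℝ≥0∞) ^ (p - 1) * C') := by
    rw [ENNReal.coe_mul, ENNReal.coe_mul, ENNReal.coe_rpow_of_nonneg _ hp0,
      ENNReal.coe_rpow_of_nonneg _ (by linarith : 0 ≤ p - 1), ENNReal.coe_natCast]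
  rw [e]
  calc _ ≤ ∫⁻ x in U, (C : ℝ≥0∞) ^ p * ((s.card : ℝ≥0∞) ^ (p - 1) * ∑ β ∈ s, J β x ^ p) :=
        setLIntegral_mono' hUm h1
    _ = (C : ℝ≥0∞) ^ p * ((s.card : ℝ≥0∞) ^ (p - 1) * ∑ β ∈ s, ∫⁻ x in U, J β x ^ p) := by
        have hm : Measurable fun x => ∑ β ∈ s, J β x ^ p :=
          Finset.measurable_fun_sum s fun β _ => hJm β
        rw [lintegral_const_mul _ (hm.const_mul _), lintegral_const_mul _ hm,
          lintegral_finsetSum _ fun β _ => hJm β]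
    _ ≤ (C : ℝ≥0∞) ^ p * ((s.card : ℝ≥0∞) ^ (p - 1) *
          ∑ β ∈ s, C' * wInt (aboveGraph w) a p (multiD β φ)) := by
        gcongr with β _
        exact h4 β
    _ = _ := by rw [← Finset.mul_sum]; ring

end

/-! ### Smoothness of the extension across the graph and its flatness on the axis. -/

section
variable {M : ℝ≥0} {w : EuclideanSpace ℝ (Fin 2) → ℝ} {η : R3 → ℝ}

theorem listD_zero (L : List (Fin 3)) : listD L (fun _ => 0) = fun _ => 0 := by
  induction L with
  | nil => rfl
  | cons i L ih => rw [listD_cons, ih, partialD_const]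

theorem listD_const {L : List (Fin 3)} (hL : L ≠ []) (c : ℝ) : listD L (fun _ => c) = fun _ => 0 := by
  obtain ⟨L, i, rfl⟩ := List.eq_nil_or_concat L |>.resolve_left hL
  rw [List.concat_eq_append, listD_append, listD_cons, listD_nil, partialD_const, listD_zero]

/-- Functions that are smooth below the graph, zero elsewhere, and vanish to second order, with all
derivatives, at the graph. -/
structure IsFlat (w : EuclideanSpace ℝ (Fin 2) → ℝ) (h : R3 → ℝ) : Prop where
  smooth : ContDiffOn ℝ ∞ h {x | 0 < depth w x}
  zero : ∀ x, depth w x ≤ 0 → h x = 0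
  bdd : ∀ L, ∃ C, ∀ x, 0 < depth w x → |listD L h x| ≤ C * depth w x ^ 2

/-- At a point on or above the graph the depth of a nearby point is at most a multiple of the
distance to it, so quadratic vanishing in the depth makes the first-order Taylor remainder o(‖y −
x‖). -/
theorem IsFlat.hasFDerivAt (hw : LipschitzWith M w) {h : R3 → ℝ} (hf : IsFlat w h) {x : R3}
    (hx : depth w x ≤ 0) : HasFDerivAt h (0 : R3 →L[ℝ] ℝ) x := by
  obtain ⟨C, hC⟩ := hf.bdd []
  rw [hasFDerivAt_iff_isLittleO]
  have : (fun y => h y - h x - (0 : R3 →L[ℝ] ℝ) (y - x)) =O[nhds x] fun y => ‖y - x‖ ^ 2 := by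
    refine Asymptotics.IsBigO.of_bound (|C| * (M + 1) ^ 2) (Filter.Eventually.of_forall fun y => ?_)
    simp only [hf.zero x hx, sub_zero, zero_apply, Real.norm_eq_abs, abs_pow, abs_norm]
    rcases le_or_gt (depth w y) 0 with hy | hy
    · rw [hf.zero y hy, abs_zero]; positivity
    · have h1 : depth w y ≤ (M + 1) * ‖y - x‖ := by
        linarith [(abs_le.1 (abs_depth_sub_le hw y x)).2]
      calc |h y| ≤ |C| * depth w y ^ 2 :=
            (hC y hy).trans (mul_le_mul_of_nonneg_right (le_abs_self C) (sq_nonneg _))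
        _ ≤ |C| * ((M + 1) * ‖y - x‖) ^ 2 := by gcongr
        _ = _ := by rw [mul_pow]; ring
  refine this.trans_isLittleO ?_
  have h2 : Filter.Tendsto (fun y => y - x) (nhds x) (nhds 0) := by
    have : ContinuousAt (fun y => y - x) x := by fun_prop
    simpa [ContinuousAt] using this
  have h3 := (Asymptotics.isLittleO_norm_pow_id (E' := R3) (n := 2) (by norm_num)).comp_tendsto h2
  exact h3

theorem IsFlat.partialD (hw : LipschitzWith M w) {h : R3 → ℝ} (hf : IsFlat w h) (i : Fin 3) :
    IsFlat w (partialD i h) := by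
  refine ⟨hf.smooth.partialD (isOpen_depth_pos hw) i, fun x hx => ?_, fun L => ?_⟩
  · simp [_root_.partialD, (hf.hasFDerivAt hw hx).fderiv]
  · simpa [listD_append] using hf.bdd (L ++ [i])

/-- A flat function is differentiable everywhere and its partial derivatives are again flat;
smoothness follows by induction. -/
theorem IsFlat.contDiff (hw : LipschitzWith M w) {h : R3 → ℝ} (hf : IsFlat w h) :
    ContDiff ℝ ∞ h := by
  have hd : ∀ {h}, IsFlat w h → Differentiable ℝ h := by
    intro h hf x
    rcases le_or_gt (depth w x) 0 with hx | hx
    · exact (hf.hasFDerivAt hw hx).differentiableAt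
    · exact hf.smooth.differentiableAt_of_isOpen (isOpen_depth_pos hw) hx
  rw [contDiff_infty]
  intro n
  induction n generalizing h with
  | zero => exact_mod_cast contDiff_zero.2 (hd hf).continuous
  | succ n ih =>
    rw [← contDiffOn_univ]
    exact contDiffOn_succ_of_partialD isOpen_univ (hd hf).differentiableOn
      fun i => (ih (hf.partialD hw i)).contDiffOn

theorem IsFlat.listD_eq_zero (hw : LipschitzWith M w) {h : R3 → ℝ} (hf : IsFlat w h)
    (L : List (Fin 3)) {x : R3} (hx : depth w x ≤ 0) : listD L h x = 0 := by
  have : IsFlat w (listD L h) := by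
    induction L with
    | nil => exact hf
    | cons i L ih => exact ih.partialD hw i
  exact this.zero x hx

theorem steinExt_of_depth_pos {ψ : ℝ → ℝ} {x : R3} (hx : 0 < depth w x) (u : R3 → ℝ) :
    steinExt w η ψ u x = kernelAvg η ψ u x := by
  rw [steinExt, if_pos (by simpa [depth] using hx)]
  rfl

theorem steinExt_of_depth_nonpos {ψ : ℝ → ℝ} {x : R3} (hx : depth w x ≤ 0) (u : R3 → ℝ) :
    steinExt w η ψ u x = u x := by
  rw [steinExt, if_neg (by simpa [depth] using hx)]

/-- The difference of the extension and the given function is flat. -/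
theorem isFlat_steinExt_sub (hw : LipschitzWith M w) (h : IsStep w η) {ψ : ℝ → ℝ}
    (hψ : IsSteinKernel ψ) {φ : R3 → ℝ} (hφ : IsBddSmooth φ) :
    IsFlat w fun x => steinExt w η ψ φ x - φ x := by
  have hU := isOpen_depth_pos hw
  have he : EqOn (fun x => steinExt w η ψ φ x - φ x) (fun x => kernelAvg η ψ φ x - φ x)
      {x | 0 < depth w x} := fun x hx => by
    beta_reduce; rw [steinExt_of_depth_pos hx]
  refine ⟨ContDiffOn.congr ?_ he, fun x hx => ?_, fun L => ?_⟩
  · exact (contDiffOn_kernelAvg hU h.symbol.smooth hψ.isRapid hφ).sub hφ.smooth.contDiffOn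
  · rw [steinExt_of_depth_nonpos hx, sub_self]
  · obtain ⟨C, hC⟩ := exists_abs_listD_kernelAvg_sub_le hw h.symbol (fun x hx => (h.pos hx).le) hψ hφ
      L one_le_two
    exact ⟨C, fun x hx => by rw [listD_congr hU he L hx]; exact hC x hx⟩

theorem contDiff_steinExt (hw : LipschitzWith M w) (h : IsStep w η) {ψ : ℝ → ℝ}
    (hψ : IsSteinKernel ψ) {φ : R3 → ℝ} (hφ : IsBddSmooth φ) :
    ContDiff ℝ ∞ (steinExt w η ψ φ) := by
  have := ((isFlat_steinExt_sub hw h hψ hφ).contDiff hw).add hφ.smooth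
  simpa using this

/-- If the half-line above x meets the support of φ at x + tη e₃, then the height of that point
above the graph is bounded, since 0 lies on the graph. That height is at least tη/2, so x is within
bounded distance of the support. -/
theorem hasCompactSupport_steinExt (hw : LipschitzWith M w)
    (haxis : axis ⊆ frontier (aboveGraph w)) (h : IsStep w η) {φ : R3 → ℝ} {ψ : ℝ → ℝ}
    (hφ : HasCompactSupport φ) : HasCompactSupport (steinExt w η ψ φ) := by
  obtain ⟨R, hR⟩ := hφ.isCompact.isBounded.subset_closedBall 0
  have hz : ∀ y, φ y ≠ 0 → ‖y‖ ≤ R := fun y hy => by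
    simpa using hR (subset_tsupport φ hy)
  refine HasCompactSupport.of_support_subset_isCompact
    (isCompact_closedBall (0 : R3) (R + 2 * (M + 1) * |R|)) fun x hx => ?_
  rw [mem_closedBall_zero_iff]
  by_contra hcon
  push Not at hcon
  have hM : (0 : ℝ) ≤ M := M.2
  refine hx ?_
  rcases le_or_gt (depth w x) 0 with hd | hd
  · rw [steinExt_of_depth_nonpos hd]
    by_contra hne
    have h1 := hz x hne
    have : 0 ≤ 2 * (M + 1) * |R| := by positivity
    linarith
  · rw [steinExt_of_depth_pos hd, kernelAvg]
    refine setIntegral_eq_zero_of_forall_eq_zero fun t ht => ?_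
    have ht1 : 1 < t := ht
    suffices hzero : φ (x + vert (t * η x)) = 0 by rw [hzero, zero_mul]
    by_contra hne
    have h1 := hz _ hne
    have h2 := abs_depth_sub_le hw (x + vert (t * η x)) 0
    have h3 : depth w 0 = 0 := (mem_frontier_aboveGraph_iff hw).1 (haxis zero_mem_axis)
    rw [h3, sub_zero, sub_zero, depth_add_vert] at h2
    have h4 := (neg_le_abs _).trans h2
    have h5 := h.lower x hd
    have h6 : η x ≤ t * η x := le_mul_of_one_le_left (h.pos hd).le ht1.le
    have h7 : ((M : ℝ) + 1) * ‖x + vert (t * η x)‖ ≤ (M + 1) * |R| := by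
      gcongr; exact h1.trans (le_abs_self R)
    have h8 : ‖x‖ ≤ ‖x + vert (t * η x)‖ + t * η x := by
      have h9 := norm_sub_le (x + vert (t * η x)) (vert (t * η x))
      rwa [add_sub_cancel_right, norm_vert (t * η x), abs_of_nonneg (by linarith [h.pos hd])] at h9
    linarith

/-- Smooth functions with compact support that vanish to infinite order on the axis. -/
structure IsAxisFlat (f : R3 → ℝ) : Prop where
  smooth : ContDiff ℝ ∞ f
  compact : HasCompactSupport f
  bdd : ∀ (L : List (Fin 3)) (N : ℕ), 1 ≤ N → ∃ C, 0 ≤ C ∧ ∀ x, |listD L f x| ≤ C * axisDist x ^ N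

theorem IsTestFunction.isBddSmooth {U : Set R3} {φ : R3 → ℝ} (h : IsTestFunction U φ) :
    IsBddSmooth φ := isBddSmooth_of_hasCompactSupport h.smooth h.compact

/-- The support is compact and off the axis, hence at a positive distance from it. -/
theorem IsTestFunction.isAxisFlat {φ : R3 → ℝ} (h : IsTestFunction axisᶜ φ) : IsAxisFlat φ := by
  refine ⟨h.smooth, h.compact, fun L N _ => ?_⟩
  obtain ⟨B, hB⟩ := h.isBddSmooth.bdd L
  have hB0 : 0 ≤ B := (abs_nonneg _).trans (hB 0)
  obtain ⟨ρ, hρ0, hρ⟩ : ∃ ρ, 0 < ρ ∧ ∀ x ∈ tsupport φ, ρ ≤ axisDist x := by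
    rcases (tsupport φ).eq_empty_or_nonempty with he | hne
    · exact ⟨1, one_pos, by simp [he]⟩
    · obtain ⟨x, hx, hmin⟩ := h.compact.isCompact.exists_isMinOn hne
        continuous_axisDist.continuousOn
      exact ⟨axisDist x, axisDist_pos_iff.2 (h.support hx), hmin⟩
  refine ⟨B * (ρ ^ N)⁻¹, by positivity, fun x => ?_⟩
  by_cases hx : x ∈ tsupport (listD L φ)
  · have h1 := hρ x (tsupport_listD_subset φ L hx)
    have h2 : 1 ≤ (ρ ^ N)⁻¹ * axisDist x ^ N := by
      rw [← div_eq_inv_mul, one_le_div (by positivity)]; gcongr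
    rw [mul_assoc]
    exact (hB x).trans (le_mul_of_one_le_right hB0 h2)
  · have := axisDist_nonneg x
    rw [image_eq_zero_of_notMem_tsupport hx, abs_zero]; positivity

/-- The extension need not vanish near the axis, because half-lines starting there can reach the
support of φ. But its difference from φ vanishes to infinite order in the depth, and the depth is at
most (M + 1) r. -/
theorem isAxisFlat_steinExt (hw : LipschitzWith M w) (haxis : axis ⊆ frontier (aboveGraph w))
    (h : IsStep w η) {ψ : ℝ → ℝ} (hψ : IsSteinKernel ψ) {φ : R3 → ℝ}
    (hφ : IsTestFunction axisᶜ φ) : IsAxisFlat (steinExt w η ψ φ) := by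
  have hb := hφ.isBddSmooth
  have hflat := isFlat_steinExt_sub hw h hψ hb
  refine ⟨contDiff_steinExt hw h hψ hb, hasCompactSupport_steinExt hw haxis h hφ.compact,
    fun L N hN => ?_⟩
  obtain ⟨C, hC0, hC⟩ := hφ.isAxisFlat.bdd L N hN
  obtain ⟨C', hC'⟩ := exists_abs_listD_kernelAvg_sub_le hw h.symbol (fun x hx => (h.pos hx).le) hψ hb
      L hN
  refine ⟨C + |C'| * (M + 1) ^ N, by positivity, fun x => ?_⟩
  have hr := axisDist_nonneg x
  have h1 : listD L (fun x => steinExt w η ψ φ x - φ x) x =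
      listD L (steinExt w η ψ φ) x - listD L φ x :=
    listD_sub isOpen_univ (contDiff_steinExt hw h hψ hb).contDiffOn hφ.smooth.contDiffOn L
      (mem_univ x)
  have h2 : |listD L (fun x => steinExt w η ψ φ x - φ x) x| ≤
      |C'| * (M + 1) ^ N * axisDist x ^ N := by
    rcases le_or_gt (depth w x) 0 with hd | hd
    · rw [hflat.listD_eq_zero hw L hd, abs_zero]; positivity
    · have he : EqOn (fun x => steinExt w η ψ φ x - φ x) (fun x => kernelAvg η ψ φ x - φ x)
          {x | 0 < depth w x} := fun x hx => by
        beta_reduce; rw [steinExt_of_depth_pos hx]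
      rw [listD_congr (isOpen_depth_pos hw) he L hd, mul_assoc, ← mul_pow]
      refine (hC' x hd).trans ?_
      have := (le_abs_self _).trans (abs_depth_le_axisDist hw haxis x)
      gcongr
      exact le_abs_self C'
  calc |listD L (steinExt w η ψ φ) x|
      = |listD L φ x + listD L (fun x => steinExt w η ψ φ x - φ x) x| := by rw [h1]; ring_nf
    _ ≤ C * axisDist x ^ N + |C'| * (M + 1) ^ N * axisDist x ^ N :=
        (abs_add_le _ _).trans (add_le_add (hC x) h2)
    _ = _ := by ring

/-! ### Cut-off functions near the axis -/

theorem axisDist_sq (x : R3) : axisDist x ^ 2 = x 1 ^ 2 + x 2 ^ 2 := by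
  have h0 : 0 ≤ x 1 ^ 2 + x 2 ^ 2 := by positivity
  have key : axisDist x = √(x 1 ^ 2 + x 2 ^ 2) := by
    refine le_antisymm ?_ ((Metric.le_infDist ⟨0, zero_mem_axis⟩).2 fun y hy => ?_)
    · have hmem : EuclideanSpace.single (0 : Fin 3) (x 0) ∈ axis := by simp [axis]
      refine (Metric.infDist_le_dist_of_mem hmem).trans_eq ?_
      rw [EuclideanSpace.dist_eq]
      simp [Fin.sum_univ_three]
    · rw [EuclideanSpace.dist_eq]
      apply Real.sqrt_le_sqrt
      simp only [Fin.sum_univ_three, Real.dist_eq, sq_abs, hy.1, hy.2, sub_zero]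
      nlinarith [sq_nonneg (x 0 - y 0)]
  rw [key, Real.sq_sqrt h0]

/-- A smooth function that vanishes where `r ≤ 1` and equals one where `r² ≥ 2`. -/
noncomputable def axisCut (x : R3) : ℝ := Real.smoothTransition (x 1 ^ 2 + x 2 ^ 2 - 1)

theorem contDiff_axisCut : ContDiff ℝ ∞ axisCut := by
  refine Real.smoothTransition.contDiff.comp ?_
  fun_prop

theorem listD_axisCut_add (L : List (Fin 3)) (x : R3) (s : ℝ) :
    listD L axisCut (x + EuclideanSpace.single 0 s) = listD L axisCut x := by
  have key : ∀ L : List (Fin 3),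
      (fun x => listD L axisCut (x + EuclideanSpace.single 0 s)) = listD L axisCut := by
    intro L
    induction L with
    | nil => ext x; simp [axisCut]
    | cons i L ih =>
      ext x
      simp only [listD_cons]
      conv_rhs => rw [← ih]
      simp only [partialD]
      rw [fderiv_comp_add_right]
  exact congrFun (key L) x

theorem listD_axisCut_eq_zero {L : List (Fin 3)} (hL : L ≠ []) {x : R3} (hx : 2 < axisDist x ^ 2) :
    listD L axisCut x = 0 := by
  have hU : IsOpen {x : R3 | 2 < axisDist x ^ 2} :=
    isOpen_lt continuous_const (continuous_axisDist.pow 2)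
  have he : EqOn axisCut (fun _ => 1) {x : R3 | 2 < axisDist x ^ 2} := fun y hy => by
    have : 2 < axisDist y ^ 2 := hy
    rw [axisDist_sq] at this
    exact Real.smoothTransition.one_of_one_le (by linarith)
  rw [listD_congr hU he L hx, listD_const hL]

/-- Derivatives of positive order vanish where r² > 2, and translation along the axis moves any
other point into a fixed compact ball. -/
theorem exists_abs_listD_axisCut_le (L : List (Fin 3)) :
    ∃ B, 0 ≤ B ∧ ∀ x, |listD L axisCut x| ≤ B := by
  rcases eq_or_ne L [] with rfl | hL
  · refine ⟨1, zero_le_one, fun x => ?_⟩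
    rw [listD_nil, axisCut, abs_of_nonneg (Real.smoothTransition.nonneg _)]
    exact Real.smoothTransition.le_one _
  · obtain ⟨B, hB⟩ := (isCompact_closedBall (0 : R3) 2).exists_bound_of_continuousOn
      (contDiff_axisCut.listD L).continuous.continuousOn
    refine ⟨|B|, abs_nonneg B, fun x => ?_⟩
    by_cases hx : 2 < axisDist x ^ 2
    · rw [listD_axisCut_eq_zero hL hx, abs_zero]; positivity
    · rw [← listD_axisCut_add L x (-x 0)]
      refine (hB _ ?_).trans (le_abs_self B)
      rw [mem_closedBall_zero_iff, EuclideanSpace.norm_eq, Real.sqrt_le_left (by norm_num)]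
      rw [axisDist_sq] at hx
      simp [Fin.sum_univ_three]
      linarith

theorem listD_comp_smul {f : R3 → ℝ} (hf : ContDiff ℝ ∞ f) (c : ℝ) (L : List (Fin 3)) (x : R3) :
    listD L (fun y => f (c • y)) x = c ^ L.length * listD L f (c • x) := by
  induction L generalizing x with
  | nil => simp
  | cons i L ih =>
    rw [listD_cons, funext ih]
    have hd : DifferentiableAt ℝ (listD L f) (c • x) :=
      (hf.listD L).differentiable (by simp) _
    have h1 : HasFDerivAt (fun y : R3 => listD L f (c • y))
        (fderiv ℝ (listD L f) (c • x) ∘L (c • ContinuousLinearMap.id ℝ R3)) x :=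
      hd.hasFDerivAt.comp x ((hasFDerivAt_id x).fun_const_smul c)
    rw [partialD_const_mul h1.differentiableAt, partialD, h1.fderiv]
    simp [partialD, pow_succ]
    ring

theorem axisDist_smul {c : ℝ} (hc : 0 ≤ c) (x : R3) : axisDist (c • x) = c * axisDist x := by
  rw [← pow_left_inj₀ (axisDist_nonneg _) (mul_nonneg hc (axisDist_nonneg _)) two_ne_zero, mul_pow,
    axisDist_sq, axisDist_sq]
  simp; ring

/-- Rescaled cut-off functions satisfy derivative bounds that are uniform in the scale. -/
theorem exists_abs_listD_one_sub_axisCut_le (L : List (Fin 3)) :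
    ∃ B, 0 ≤ B ∧ ∀ c : ℝ, 0 < c → ∀ x ∈ axisᶜ,
      |listD L (fun y => 1 - axisCut (c • y)) x| ≤ B * axisDist x ^ (0 - (L.length : ℤ)) := by
  obtain ⟨B, hB0, hB⟩ := exists_abs_listD_axisCut_le L
  refine ⟨1 + B * 2 ^ L.length, by positivity, fun c hc x hx => ?_⟩
  have hr := axisDist_pos_iff.2 hx
  have hcs : ContDiff ℝ ∞ fun y : R3 => axisCut (c • y) :=
    contDiff_axisCut.comp (contDiff_const_smul c)
  rw [listD_sub isOpen_univ contDiffOn_const hcs.contDiffOn L (mem_univ x)]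
  beta_reduce
  rw [listD_comp_smul contDiff_axisCut, zero_sub, zpow_neg, zpow_natCast]
  rcases eq_or_ne L [] with rfl | hL
  · have h1 := Real.smoothTransition.nonneg ((c • x) 1 ^ 2 + (c • x) 2 ^ 2 - 1)
    have h2 := Real.smoothTransition.le_one ((c • x) 1 ^ 2 + (c • x) 2 ^ 2 - 1)
    simp only [listD_nil, List.length_nil, pow_zero, one_mul, inv_one, mul_one, axisCut]
    rw [abs_of_nonneg (by linarith)]
    linarith
  · have hcL : 0 ≤ c ^ L.length := by positivity
    rw [listD_const hL, zero_sub, abs_neg, abs_mul, abs_of_nonneg hcL]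
    by_cases hx2 : 2 < axisDist (c • x) ^ 2
    · rw [listD_axisCut_eq_zero hL hx2, abs_zero, mul_zero]; positivity
    · rw [axisDist_smul hc.le] at hx2
      -- The derivatives live where cr ≤ √2, so each factor c from rescaling is worth at most 2/r.
      have h3 : c * axisDist x ≤ 2 := by nlinarith [mul_pos hc hr]
      rw [← div_eq_mul_inv, le_div_iff₀ (by positivity)]
      calc c ^ L.length * |listD L axisCut (c • x)| * axisDist x ^ L.length
          = |listD L axisCut (c • x)| * (c * axisDist x) ^ L.length := by rw [mul_pow]; ring
        _ ≤ B * 2 ^ L.length := by gcongr; exact hB _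
        _ ≤ _ := by linarith

/-- The truncations of `f` away from the axis. -/
noncomputable def axisTrunc (f : R3 → ℝ) (n : ℕ) (x : R3) : ℝ := axisCut ((n + 1 : ℝ) • x) * f x

theorem IsAxisFlat.isTestFunction_axisTrunc {f : R3 → ℝ} (hf : IsAxisFlat f) (n : ℕ) :
    IsTestFunction axisᶜ (axisTrunc f n) := by
  refine ⟨(contDiff_axisCut.comp (contDiff_const_smul _)).mul hf.smooth, hf.compact.mul_left, ?_⟩
  have hn : (0 : ℝ) < n + 1 := by positivity
  have hcl : IsClosed {x : R3 | 1 ≤ (n + 1) * axisDist x} :=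
    isClosed_le continuous_const (continuous_const.mul continuous_axisDist)
  refine (closure_minimal (fun x hx => ?_) hcl).trans fun x hx => ?_
  · by_contra hcon
    simp only [mem_ofPred_eq, not_le] at hcon
    refine hx ?_
    have h1 : axisDist ((n + 1 : ℝ) • x) ^ 2 ≤ 1 := by
      rw [axisDist_smul hn.le]
      have := axisDist_nonneg x
      have : 0 ≤ (n + 1) * axisDist x := by positivity
      nlinarith
    rw [axisDist_sq] at h1
    rw [axisTrunc, axisCut, Real.smoothTransition.zero_of_nonpos (by linarith), zero_mul]
  · rw [mem_compl_iff, ← axisDist_pos_iff]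
    exact pos_of_mul_pos_right (lt_of_lt_of_le one_pos hx) hn.le

/-- The Leibniz estimate with weight r is applied to a cut-off of order 0, uniformly in its scale,
and f of order N. The choice N = |α| + j + 1 leaves the power j + 1 and keeps the exponents required
of f at least 1. -/
theorem IsAxisFlat.exists_abs_multiD_sub_axisTrunc_le {f : R3 → ℝ} (hf : IsAxisFlat f)
    (α : Fin 3 → ℕ) (j : ℕ) :
    ∃ C, 0 ≤ C ∧ ∀ n, ∀ x ∈ axisᶜ,
      |multiD α (fun x => f x - axisTrunc f n x) x| ≤ C * axisDist x ^ (j + 1) := by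
  set k := (multiList α).length with hk
  set N : ℕ := k + (j + 1) with hN
  have hUo : IsOpen (axisᶜ) := isClosed_axis.isOpen_compl
  have hρ : ∀ x ∈ axisᶜ, 0 < axisDist x := fun x hx => axisDist_pos_iff.2 hx
  have he : ∀ n, (fun x => f x - axisTrunc f n x) =
      fun x => (1 - axisCut ((n + 1 : ℝ) • x)) * f x := fun n => by
    ext x; rw [axisTrunc]; ring
  have hcs : ∀ n : ℕ, ContDiff ℝ ∞ fun y : R3 => 1 - axisCut ((n + 1 : ℝ) • y) := fun n =>
    contDiff_const.sub (contDiff_axisCut.comp (contDiff_const_smul _))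
  obtain ⟨A, hA⟩ : ∃ A, ∀ n : ℕ, ∀ L : List (Fin 3), L.length ≤ k → ∀ x ∈ axisᶜ,
      |listD L (fun y => 1 - axisCut ((n + 1 : ℝ) • y)) x| ≤
        A * axisDist x ^ (0 - (L.length : ℤ)) := by
    choose B hB0 hB using exists_abs_listD_one_sub_axisCut_le
    obtain ⟨C, hC⟩ := ((List.finite_length_le (Fin 3) k).image B).bddAbove
    refine ⟨C, fun n L hL x hx => (hB L (n + 1) (by positivity) x hx).trans ?_⟩
    exact mul_le_mul_of_nonneg_right (hC (mem_image_of_mem B hL)) (zpow_nonneg (hρ x hx).le _)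
  obtain ⟨B, hB⟩ : ∃ B, ∀ L : List (Fin 3), L.length ≤ k → ∀ x ∈ axisᶜ,
      |listD L f x| ≤ B * axisDist x ^ ((N : ℤ) - L.length) := by
    have h1 : ∀ L : List (Fin 3), ∃ B, L.length ≤ k → ∀ x ∈ axisᶜ,
        |listD L f x| ≤ B * axisDist x ^ ((N : ℤ) - L.length) := by
      intro L
      by_cases hL : L.length ≤ k
      · obtain ⟨B, -, hB⟩ := hf.bdd L (N - L.length) (by omega)
        refine ⟨B, fun _ x _ => (hB x).trans_eq ?_⟩
        rw [← zpow_natCast, Nat.cast_sub (by omega)]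
      · exact ⟨0, fun h => absurd h hL⟩
    choose B hB using h1
    obtain ⟨C, hC⟩ := ((List.finite_length_le (Fin 3) k).image B).bddAbove
    refine ⟨C, fun L hL x hx => (hB L hL x hx).trans ?_⟩
    exact mul_le_mul_of_nonneg_right (hC (mem_image_of_mem B hL)) (zpow_nonneg (hρ x hx).le _)
  refine ⟨|2 ^ k * (A * B)|, abs_nonneg _, fun n x hx => ?_⟩
  rw [multiD_eq_listD, he]
  have := abs_listD_mul_le hUo hρ k _ f (hcs n).contDiffOn hf.smooth.contDiffOn 0 N A B (hA n) hB
    (multiList α) le_rfl x hx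
  have e : 0 + (N : ℤ) - ((multiList α).length : ℤ) = ((j + 1 : ℕ) : ℤ) := by
    rw [hN, ← hk]; push_cast; ring
  rw [e, zpow_natCast] at this
  exact this.trans (mul_le_mul_of_nonneg_right (le_abs_self _) (pow_nonneg (hρ x hx).le _))

/-- Dominated convergence: off the axis the error vanishes for all large n. Flatness of order ⌈|a|⌉
+ 1 makes the product with r^a bounded, and the supports lie in one ball. -/
theorem IsAxisFlat.tendsto_wInt (hax : volume axis = 0) {f : R3 → ℝ} (hf : IsAxisFlat f)
    (α : Fin 3 → ℕ) (a : ℝ) {p : ℝ} (hp : 1 ≤ p) :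
    Filter.Tendsto (fun n => wInt univ a p (multiD α fun x => f x - axisTrunc f n x))
      Filter.atTop (nhds 0) := by
  have hp0 : 0 < p := by linarith
  have hρ : ∀ x ∈ axisᶜ, 0 < axisDist x := fun x hx => axisDist_pos_iff.2 hx
  have he : ∀ n, (fun x => f x - axisTrunc f n x) =
      fun x => (1 - axisCut ((n + 1 : ℝ) • x)) * f x := fun n => by
    ext x; rw [axisTrunc]; ring
  obtain ⟨C, hC0, hbound⟩ := hf.exists_abs_multiD_sub_axisTrunc_le α ⌈|a|⌉₊
  obtain ⟨R, hR⟩ := hf.compact.isCompact.isBounded.subset_closedBall 0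
  have hsupp : ∀ n x, x ∉ Metric.closedBall (0 : R3) R →
      multiD α (fun x => f x - axisTrunc f n x) x = 0 := by
    intro n x hx
    rw [multiD_eq_listD, he]
    refine image_eq_zero_of_notMem_tsupport fun h => hx (hR ?_)
    exact tsupport_mul_subset_right (tsupport_listD_subset _ _ h)
  have hae : ∀ᵐ x : R3, x ∈ axisᶜ := by
    rw [ae_iff]; simpa using hax
  set c := C * |R| ^ (a + (⌈|a|⌉₊ + 1)) with hc
  have ha0 : 0 ≤ a + (⌈|a|⌉₊ + 1 : ℝ) := by
    have h1 := Nat.le_ceil |a|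
    have h2 := neg_abs_le a
    linarith
  have hdom : ∀ n, ∀ᵐ x : R3, (ENNReal.ofReal (axisDist x ^ a) *
      ‖multiD α (fun x => f x - axisTrunc f n x) x‖ₑ) ^ p ≤
      (Metric.closedBall (0 : R3) R).indicator (fun _ => ENNReal.ofReal |c| ^ p) x := by
    intro n
    filter_upwards [hae] with x hx
    by_cases hxR : x ∈ Metric.closedBall (0 : R3) R
    · rw [indicator_of_mem hxR]
      have hr := hρ x hx
      gcongr
      rw [Real.enorm_eq_ofReal_abs, ← ENNReal.ofReal_mul (by positivity)]
      refine ENNReal.ofReal_le_ofReal ?_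
      have h1 := hbound n x hx
      have hrR : axisDist x ≤ |R| := by
        have h2 : axisDist x ≤ dist x 0 := Metric.infDist_le_dist_of_mem zero_mem_axis
        exact h2.trans ((Metric.mem_closedBall.1 hxR).trans (le_abs_self R))
      calc _ ≤ axisDist x ^ a * (C * axisDist x ^ (⌈|a|⌉₊ + 1)) := by gcongr
        _ = C * axisDist x ^ (a + (⌈|a|⌉₊ + 1)) := by
            rw [Real.rpow_add hr, ← Nat.cast_succ, Real.rpow_natCast, Nat.succ_eq_add_one]; ring
        _ ≤ c := by rw [hc]; gcongr
        _ ≤ |c| := le_abs_self c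
    · rw [hsupp n x hxR, enorm_zero, mul_zero, ENNReal.zero_rpow_of_pos hp0]
      exact zero_le
  have hlim : ∀ᵐ x : R3, Filter.Tendsto (fun n => (ENNReal.ofReal (axisDist x ^ a) *
      ‖multiD α (fun x => f x - axisTrunc f n x) x‖ₑ) ^ p) Filter.atTop (nhds 0) := by
    filter_upwards [hae] with x hx
    have hr := hρ x hx
    obtain ⟨n₀, hn₀⟩ := exists_nat_gt (2 / axisDist x)
    refine tendsto_const_nhds.congr' ?_
    filter_upwards [Filter.eventually_ge_atTop n₀] with n hn
    have hn0 : (0 : ℝ) < n + 1 := by positivity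
    have hn' : 2 < (n + 1) * axisDist x := by
      rw [div_lt_iff₀ hr] at hn₀
      have : (n₀ : ℝ) ≤ n + 1 := by
        have : (n₀ : ℝ) ≤ n := by exact_mod_cast hn
        linarith
      exact hn₀.trans_le (mul_le_mul_of_nonneg_right this hr.le)
    have hU : IsOpen {y : R3 | 2 < (n + 1) * axisDist y} :=
      isOpen_lt continuous_const (continuous_const.mul continuous_axisDist)
    have hz : EqOn (fun x => f x - axisTrunc f n x) (fun _ => 0)
        {y : R3 | 2 < (n + 1) * axisDist y} := by
      intro y hy
      have hy' : 2 < (n + 1) * axisDist y := hy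
      have h3 : 2 ≤ axisDist ((n + 1 : ℝ) • y) ^ 2 := by
        rw [axisDist_smul hn0.le]; nlinarith
      rw [axisDist_sq] at h3
      simp only [axisTrunc, axisCut]
      rw [Real.smoothTransition.one_of_one_le (by linarith), one_mul, sub_self]
    rw [multiD_eq_listD, listD_congr hU hz _ hn', listD_zero, enorm_zero, mul_zero,
      ENNReal.zero_rpow_of_pos hp0]
  have hmeas : ∀ n, AEMeasurable (fun x : R3 => (ENNReal.ofReal (axisDist x ^ a) *
      ‖multiD α (fun x => f x - axisTrunc f n x) x‖ₑ) ^ p) volume := by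
    intro n
    refine Measurable.aemeasurable ?_
    have hs : ContDiff ℝ ∞ fun x => f x - axisTrunc f n x :=
      hf.smooth.sub (hf.isTestFunction_axisTrunc n).smooth
    exact (((continuous_axisDist.measurable.pow_const a).ennreal_ofReal).mul
      (hs.multiD α).continuous.measurable.enorm).pow_const p
  have := tendsto_lintegral_of_dominated_convergence' _ hmeas hdom ?_ hlim
  · simpa [wInt] using this
  · rw [lintegral_indicator measurableSet_closedBall, setLIntegral_const]
    exact (ENNReal.mul_lt_top (ENNReal.rpow_lt_top_of_nonneg hp0.le ENNReal.ofReal_ne_top)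
      measure_closedBall_lt_top).ne

end

/-! ### Weak derivatives -/

theorem IsTestFunction.multiD {U : Set R3} {φ : R3 → ℝ} (h : IsTestFunction U φ)
    (α : Fin 3 → ℕ) : IsTestFunction U (multiD α φ) := by
  rw [multiD_eq_listD]
  have hs := tsupport_listD_subset φ (multiList α)
  exact ⟨h.smooth.listD _, h.compact.of_isClosed_subset (isClosed_tsupport _) hs,
    hs.trans h.support⟩

theorem IsTestFunction.setIntegral_mul {U : Set R3} {φ : R3 → ℝ} (h : IsTestFunction U φ)
    (f : R3 → ℝ) : ∫ x in U, f x * φ x = ∫ x, f x * φ x := by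
  refine setIntegral_eq_integral_of_forall_compl_eq_zero fun x hx => ?_
  rw [image_eq_zero_of_notMem_tsupport fun hx' => hx (h.support hx'), mul_zero]

theorem IsTestFunction.integrable_mul {U : Set R3} {φ : R3 → ℝ} (h : IsTestFunction U φ)
    {f : R3 → ℝ} (hf : LocallyIntegrableOn f U) : Integrable fun x => f x * φ x := by
  have h1 : IntegrableOn (fun x => f x * φ x) (tsupport φ) :=
    (hf.integrableOn_compact_subset h.support h.compact.isCompact).mul_continuousOn
      h.smooth.continuous.continuousOn h.compact.isCompact
  refine (integrableOn_iff_integrable_of_support_subset fun x hx => ?_).1 h1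
  exact subset_tsupport φ fun h0 => hx (by simp [h0])

section
variable {U : Set R3} {α : Fin 3 → ℕ}

theorem HasWeakDeriv.unique (hU : IsOpen U) {u v v' : R3 → ℝ} (h : HasWeakDeriv U α u v)
    (h' : HasWeakDeriv U α u v') : v =ᵐ[volume.restrict U] v' := by
  rw [Filter.EventuallyEq, ae_restrict_iff' hU.measurableSet]
  have h0 : LocallyIntegrableOn (fun x => v x - v' x) U := h.right.sub h'.right
  have := hU.ae_eq_zero_of_integral_contDiff_smul_eq_zero h0 fun g hg hgc hgs => ?_
  · filter_upwards [this] with x hx hxU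
    linarith [hx hxU]
  · have ht : IsTestFunction U g := ⟨hg, hgc, hgs⟩
    have e1 := h.parts g ht
    have e2 := h'.parts g ht
    rw [e1, ht.setIntegral_mul, ht.setIntegral_mul] at e2
    have e3 := mul_left_cancel₀ (pow_ne_zero _ (by norm_num : (-1 : ℝ) ≠ 0)) e2
    have e : ∀ x, g x • (v x - v' x) = v x * g x - v' x * g x := fun x => by
      rw [smul_eq_mul]; ring
    simp only [e]
    rw [integral_sub (ht.integrable_mul h.right) (ht.integrable_mul h'.right), e3, sub_self]

theorem HasWeakDeriv.add {u v u' v' : R3 → ℝ} (h : HasWeakDeriv U α u v)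
    (h' : HasWeakDeriv U α u' v') : HasWeakDeriv U α (u + u') (v + v') := by
  refine ⟨h.left.add h'.left, h.right.add h'.right, fun φ hφ => ?_⟩
  have hφ' := hφ.multiD α
  have e1 := h.parts φ hφ
  have e2 := h'.parts φ hφ
  rw [hφ'.setIntegral_mul, hφ.setIntegral_mul] at e1 e2 ⊢
  simp only [Pi.add_apply, add_mul]
  rw [integral_add (hφ'.integrable_mul h.left) (hφ'.integrable_mul h'.left),
    integral_add (hφ.integrable_mul h.right) (hφ.integrable_mul h'.right), e1, e2, mul_add]

theorem HasWeakDeriv.smul {u v : R3 → ℝ} (h : HasWeakDeriv U α u v) (c : ℝ) :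
    HasWeakDeriv U α (c • u) (c • v) := by
  refine ⟨h.left.smul c, h.right.smul c, fun φ hφ => ?_⟩
  have e1 := h.parts φ hφ
  simp only [Pi.smul_apply, smul_eq_mul, mul_assoc, integral_const_mul]
  rw [e1]; ring

theorem HasWeakDeriv.sub {u v u' v' : R3 → ℝ} (h : HasWeakDeriv U α u v)
    (h' : HasWeakDeriv U α u' v') : HasWeakDeriv U α (u - u') (v - v') := by
  have := h.add (h'.smul (-1))
  simpa [sub_eq_add_neg] using this

theorem multiD_order_zero (f : R3 → ℝ) : multiD 0 f = f := rfl

theorem hasWeakDeriv_zero {u : R3 → ℝ} (h : LocallyIntegrableOn u U) :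
    HasWeakDeriv U 0 u u :=
  ⟨h, h, fun φ _ => by simp [multiD_order_zero, order]⟩

/-- Each integration by parts removes the outermost derivative from φ and places it innermost on f,
whence the reversed list. -/
theorem integral_mul_listD (L : List (Fin 3)) : ∀ {f φ : R3 → ℝ}, ContDiff ℝ ∞ f →
    IsTestFunction univ φ →
    ∫ x, f x * listD L φ x = (-1) ^ L.length * ∫ x, listD L.reverse f x * φ x := by
  induction L with
  | nil => intro f φ _ _; simp
  | cons i L ih =>
    intro f φ hf hφ
    have hg : IsTestFunction univ (listD L φ) :=
      ⟨hφ.smooth.listD L, hφ.compact.of_isClosed_subset (isClosed_tsupport _)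
        (tsupport_listD_subset φ L), subset_univ _⟩
    have hg' : IsTestFunction univ (partialD i (listD L φ)) :=
      ⟨hg.smooth.partialD i, hg.compact.of_isClosed_subset (isClosed_tsupport _)
        (tsupport_partialD_subset _ i), subset_univ _⟩
    have hli : ∀ {k : R3 → ℝ}, ContDiff ℝ ∞ k → LocallyIntegrableOn k univ := fun hk =>
      hk.continuous.locallyIntegrable.locallyIntegrableOn _
    have := integral_mul_fderiv_eq_neg_fderiv_mul_of_integrable (μ := volume) (f := f)
      (g := listD L φ) (v := EuclideanSpace.single i (1 : ℝ))
      (hg.integrable_mul (hli (hf.partialD i))) (hg'.integrable_mul (hli hf))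
      (hg.integrable_mul (hli hf)) (fun x _ => hf.differentiable (by simp) x)
      (fun x _ => hg.smooth.differentiable (by simp) x)
    have e := ih (hf.partialD i) hφ
    rw [listD_cons, List.reverse_cons, listD_append, listD_cons, listD_nil, List.length_cons,
      pow_succ, mul_assoc, neg_one_mul, mul_neg, ← e]
    exact this

theorem hasWeakDeriv_of_contDiff {f : R3 → ℝ} (hf : ContDiff ℝ ∞ f) (α : Fin 3 → ℕ) :
    HasWeakDeriv U α f (multiD α f) := by
  refine ⟨hf.continuous.locallyIntegrable.locallyIntegrableOn _,
    (hf.multiD α).continuous.locallyIntegrable.locallyIntegrableOn _, fun φ hφ => ?_⟩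
  rw [(hφ.multiD α).setIntegral_mul, hφ.setIntegral_mul, multiD_eq_listD, multiD_eq_listD,
    integral_mul_listD _ hf ⟨hφ.smooth, hφ.compact, subset_univ _⟩, length_multiList]
  congr 2
  ext x
  rw [listD_perm isOpen_univ hf.contDiffOn (List.reverse_perm _) (mem_univ x)]

theorem HasWeakDeriv.weakD_ae_eq (hU : IsOpen U) {u v : R3 → ℝ} (h : HasWeakDeriv U α u v) :
    weakD U α u =ᵐ[volume.restrict U] v := by
  have hex : ∃ v, HasWeakDeriv U α u v := ⟨v, h⟩
  rw [weakD, dif_pos hex]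
  exact hex.choose_spec.unique hU h

theorem hasWeakDeriv_weakD {u : R3 → ℝ} (h : ∃ v, HasWeakDeriv U α u v) :
    HasWeakDeriv U α u (weakD U α u) := by
  rw [weakD, dif_pos h]
  exact h.choose_spec

theorem aestronglyMeasurable_weakD (u : R3 → ℝ) :
    AEStronglyMeasurable (weakD U α u) (volume.restrict U) := by
  by_cases h : ∃ v, HasWeakDeriv U α u v
  · exact (hasWeakDeriv_weakD h).right.aestronglyMeasurable
  · rw [weakD, dif_neg h]
    exact aestronglyMeasurable_zero

end

/-! ### Weighted integrals -/

section
variable {G : Set R3} {a p : ℝ}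

theorem wInt_congr_ae {f g : R3 → ℝ} (h : f =ᵐ[volume.restrict G] g) : wInt G a p f = wInt G a p g :=
  lintegral_congr_ae (h.mono fun x hx => by simp only [hx])

theorem aemeasurable_wInt_integrand {f : R3 → ℝ} (hf : AEStronglyMeasurable f (volume.restrict G)) :
    AEMeasurable (fun x => (ENNReal.ofReal (axisDist x ^ a) * ‖f x‖ₑ) ^ p) (volume.restrict G) :=
  (((continuous_axisDist.measurable.pow_const a).ennreal_ofReal.aemeasurable).mul
    hf.enorm).pow_const p

theorem wInt_add_le (hp : 1 ≤ p) {f g : R3 → ℝ}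
    (hf : AEStronglyMeasurable f (volume.restrict G)) :
    wInt G a p (f + g) ≤ 2 ^ (p - 1) * (wInt G a p f + wInt G a p g) := by
  have hp0 : 0 ≤ p := by linarith
  have h2 : (2 : ℝ≥0∞) ^ (p - 1) ≠ ⊤ :=
    ENNReal.rpow_ne_top_of_nonneg (by linarith) ENNReal.ofNat_ne_top
  rw [wInt, wInt, wInt, ← lintegral_add_left' (aemeasurable_wInt_integrand hf),
    ← lintegral_const_mul' _ _ h2]
  refine lintegral_mono fun x => ?_
  calc (ENNReal.ofReal (axisDist x ^ a) * ‖(f + g) x‖ₑ) ^ p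
      ≤ (ENNReal.ofReal (axisDist x ^ a) * ‖f x‖ₑ + ENNReal.ofReal (axisDist x ^ a) * ‖g x‖ₑ) ^ p := by
        rw [← mul_add]
        gcongr
        exact enorm_add_le _ _
    _ ≤ _ := ENNReal.rpow_add_le_mul_rpow_add_rpow _ _ hp

theorem wInt_neg (f : R3 → ℝ) : wInt G a p (-f) = wInt G a p f := by
  simp [wInt]

theorem wInt_sub_comm (f g : R3 → ℝ) : wInt G a p (f - g) = wInt G a p (g - f) := by
  rw [← wInt_neg, neg_sub]

theorem wInt_sub_le (hp : 1 ≤ p) {f g : R3 → ℝ}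
    (hf : AEStronglyMeasurable f (volume.restrict G)) :
    wInt G a p (f - g) ≤ 2 ^ (p - 1) * (wInt G a p f + wInt G a p g) := by
  rw [sub_eq_add_neg, ← wInt_neg g]
  exact wInt_add_le hp hf

/-- Raising to the power p splits the norm into one weighted integral per multi-index. The
interchange needs measurability on G, which holds because the removed axis is null. -/
theorem vNorm_rpow (hax : volume axis = 0) {l : ℕ} {δ : ℝ} (hp : 1 ≤ p)
    (u : R3 → ℝ) : vNorm G l δ p u ^ p =
      ∑ α ∈ multiIdx l, wInt G (δ - l + order α) p (weakD (G \ axis) α u) := by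
  have hp0 : 0 < p := by linarith
  have hr : volume.restrict (G \ axis) = volume.restrict G :=
    Measure.restrict_congr_set (sdiff_null_ae_eq_self hax)
  have e : ∀ (x : R3) (α : Fin 3 → ℕ), ENNReal.ofReal (axisDist x ^ (p * (δ - l + order α)) *
      |weakD (G \ axis) α u x| ^ p) =
      (ENNReal.ofReal (axisDist x ^ (δ - l + order α)) * ‖weakD (G \ axis) α u x‖ₑ) ^ p := by
    intro x α
    rw [Real.enorm_eq_ofReal_abs, ← ENNReal.ofReal_mul (Real.rpow_nonneg (axisDist_nonneg x) _),
      ENNReal.ofReal_rpow_of_nonneg (mul_nonneg (Real.rpow_nonneg (axisDist_nonneg x) _)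
        (abs_nonneg _)) hp0.le,
      Real.mul_rpow (Real.rpow_nonneg (axisDist_nonneg x) _) (abs_nonneg _),
      ← Real.rpow_mul (axisDist_nonneg x), mul_comm p]
  simp only [vNorm, e]
  rw [← ENNReal.rpow_mul, one_div_mul_cancel hp0.ne', ENNReal.rpow_one, lintegral_finsetSum']
  · rfl
  · intro α _
    refine aemeasurable_wInt_integrand ?_
    rw [← hr]
    exact aestronglyMeasurable_weakD u

theorem measurable_rpow_axisDist (a : ℝ) : Measurable fun x : R3 => axisDist x ^ a :=
  continuous_axisDist.measurable.pow_const a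

theorem wInt_univ_eq_eLpNorm (hp : 1 ≤ p) (f : R3 → ℝ) :
    wInt univ a p f = eLpNorm (fun x => axisDist x ^ a * f x) (ENNReal.ofReal p) volume ^ p := by
  have hp0 : 0 < p := by linarith
  rw [eLpNorm_eq_lintegral_rpow_enorm_toReal (by simpa using hp0) ENNReal.ofReal_ne_top,
    ENNReal.toReal_ofReal hp0.le, ← ENNReal.rpow_mul, one_div_mul_cancel hp0.ne', ENNReal.rpow_one,
    wInt, Measure.restrict_univ]
  refine lintegral_congr fun x => ?_
  rw [enorm_mul, Real.enorm_of_nonneg (Real.rpow_nonneg (axisDist_nonneg x) a)]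

/-- Completeness of the weighted spaces. -/
theorem exists_tendsto_wInt_sub (hax : volume axis = 0) (hp : 1 ≤ p) {g : ℕ → R3 → ℝ}
    (hg : ∀ n, Measurable (g n)) (hfin : ∀ n, wInt univ a p (g n) ≠ ⊤) {C : ℝ≥0}
    (hC : ∀ N n m : ℕ, N ≤ n → N ≤ m → wInt univ a p (g n - g m) ≤ C * ((2⁻¹ : ℝ≥0∞) ^ N) ^ p) :
    ∃ f, Measurable f ∧
      Filter.Tendsto (fun n => wInt univ a p (f - g n)) Filter.atTop (nhds 0) := by
  have hp0 : 0 < p := by linarith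
  have hp1 : (1 : ℝ≥0∞) ≤ ENNReal.ofReal p := by simpa using hp
  have hm := measurable_rpow_axisDist a
  set h : ℕ → R3 → ℝ := fun n x => axisDist x ^ a * g n x with hh
  have hroot : ∀ f : R3 → ℝ, eLpNorm (fun x => axisDist x ^ a * f x) (ENNReal.ofReal p) volume =
      wInt univ a p f ^ p⁻¹ := fun f => by
    rw [wInt_univ_eq_eLpNorm hp, ← ENNReal.rpow_mul, mul_inv_cancel₀ hp0.ne', ENNReal.rpow_one]
  have hmem : ∀ n, MemLp (h n) (ENNReal.ofReal p) volume := fun n => by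
    refine ⟨(hm.mul (hg n)).aestronglyMeasurable, ?_⟩
    rw [hroot]
    exact ENNReal.rpow_lt_top_of_nonneg (inv_nonneg.2 hp0.le) (hfin n)
  -- The summand 1 makes the Cauchy estimate strict, as the completeness criterion in L^p demands,
  -- even if C = 0.
  have hsum : ∑' i : ℕ, ((C : ℝ≥0∞) ^ p⁻¹ + 1) * (2⁻¹ : ℝ≥0∞) ^ i ≠ ⊤ := by
    rw [ENNReal.tsum_mul_left, ENNReal.tsum_geometric]
    refine ENNReal.mul_ne_top (ENNReal.add_ne_top.2
      ⟨ENNReal.rpow_ne_top_of_nonneg (inv_nonneg.2 hp0.le) ENNReal.coe_ne_top, ENNReal.one_ne_top⟩)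
      ?_
    simp
  obtain ⟨F, hF, hlim⟩ := Lp.cauchy_complete_eLpNorm hp1 hmem hsum fun N n m hn hm' => by
    have e : h n - h m = fun x => axisDist x ^ a * (g n - g m) x := by
      ext x; simp [hh]; ring
    rw [e, hroot]
    have h1 : wInt univ a p (g n - g m) ^ p⁻¹ ≤ (C : ℝ≥0∞) ^ p⁻¹ * (2⁻¹ : ℝ≥0∞) ^ N := by
      refine (ENNReal.rpow_le_rpow (hC N n m hn hm') (inv_nonneg.2 hp0.le)).trans_eq ?_
      rw [ENNReal.mul_rpow_of_nonneg _ _ (inv_nonneg.2 hp0.le), ← ENNReal.rpow_mul,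
        mul_inv_cancel₀ hp0.ne', ENNReal.rpow_one]
    refine h1.trans_lt ?_
    refine ENNReal.mul_lt_mul_left (by simp) (ENNReal.pow_ne_top (by simp)) ?_
    exact ENNReal.lt_add_right
      (ENNReal.rpow_ne_top_of_nonneg (inv_nonneg.2 hp0.le) ENNReal.coe_ne_top) one_ne_zero
  set F' := hF.1.mk F with hF'
  have hF'm : Measurable F' := hF.1.stronglyMeasurable_mk.measurable
  -- Dividing the L^p limit by the weight is legitimate off the axis, which is null.
  refine ⟨fun x => axisDist x ^ (-a) * F' x, (measurable_rpow_axisDist (-a)).mul hF'm, ?_⟩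
  have e : ∀ n, wInt univ a p ((fun x => axisDist x ^ (-a) * F' x) - g n) =
      eLpNorm (h n - F) (ENNReal.ofReal p) volume ^ p := by
    intro n
    rw [wInt_univ_eq_eLpNorm hp, eLpNorm_sub_comm]
    congr 1
    refine eLpNorm_congr_ae ?_
    have hae : ∀ᵐ x : R3, x ∈ axisᶜ := by
      rw [ae_iff]; simpa using hax
    filter_upwards [hF.1.ae_eq_mk, hae] with x hx hxa
    have hr := axisDist_pos_iff.2 hxa
    have : axisDist x ^ a * axisDist x ^ (-a) = 1 := by
      rw [← Real.rpow_add hr, add_neg_cancel, Real.rpow_zero]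
    simp only [Pi.sub_apply, hh]
    rw [hx, mul_sub, ← mul_assoc, this, one_mul]
  simp only [e]
  have := (ENNReal.continuous_rpow_const (y := p)).tendsto 0 |>.comp hlim
  simpa [Function.comp_def, ENNReal.zero_rpow_of_pos hp0] using this

/-- On compact sets off the axis the weighted norms control the integral. -/
theorem exists_lintegral_compact_le (hp : 1 ≤ p) {K : Set R3} (hK : IsCompact K) (hKa : K ⊆ axisᶜ)
    (a : ℝ) : ∃ C : ℝ≥0∞, C ≠ ⊤ ∧ ∀ g : R3 → ℝ, AEStronglyMeasurable g volume →
      ∫⁻ x in K, ‖g x‖ₑ ≤ C * wInt univ a p g ^ p⁻¹ := by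
  have hp0 : 0 < p := by linarith
  obtain ⟨c, hc0, hc⟩ : ∃ c, 0 < c ∧ ∀ x ∈ K, c ≤ axisDist x ^ a := by
    rcases K.eq_empty_or_nonempty with rfl | hne
    · exact ⟨1, one_pos, by simp⟩
    · have hcont : ContinuousOn (fun x : R3 => axisDist x ^ a) K :=
        continuous_axisDist.continuousOn.rpow_const fun x hx =>
          Or.inl (axisDist_pos_iff.2 (hKa hx)).ne'
      obtain ⟨x, hx, hmin⟩ := hK.exists_isMinOn hne hcont
      exact ⟨axisDist x ^ a, Real.rpow_pos_of_pos (axisDist_pos_iff.2 (hKa hx)) a, hmin⟩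
  refine ⟨ENNReal.ofReal c⁻¹ * volume K ^ (1 - 1 / p), ENNReal.mul_ne_top ENNReal.ofReal_ne_top
    (ENNReal.rpow_ne_top_of_nonneg ?_ hK.measure_lt_top.ne), fun g hg => ?_⟩
  · rw [sub_nonneg, div_le_one hp0]; exact hp
  set h : R3 → ℝ := fun x => axisDist x ^ a * g x with hh
  have hhm : AEStronglyMeasurable h volume :=
    (measurable_rpow_axisDist a).aestronglyMeasurable.mul hg
  have h1 : ∫⁻ x in K, ‖g x‖ₑ ≤ ENNReal.ofReal c⁻¹ * ∫⁻ x in K, ‖h x‖ₑ := by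
    rw [← lintegral_const_mul' _ _ ENNReal.ofReal_ne_top]
    refine setLIntegral_mono' hK.measurableSet fun x hx => ?_
    rw [hh, enorm_mul, Real.enorm_of_nonneg (Real.rpow_nonneg (axisDist_nonneg x) a), ← mul_assoc,
      ← ENNReal.ofReal_mul (by positivity)]
    refine le_mul_of_one_le_left zero_le ?_
    rw [ENNReal.one_le_ofReal, ← div_eq_inv_mul, one_le_div hc0]
    exact hc x hx
  have h2 := eLpNorm_le_eLpNorm_mul_rpow_measure_univ (p := 1) (q := ENNReal.ofReal p)
    (by simpa using hp) (hhm.mono_measure (Measure.restrict_le_self (s := K)))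
  rw [eLpNorm_one_eq_lintegral_enorm, Measure.restrict_apply_univ, ENNReal.toReal_one,
    ENNReal.toReal_ofReal hp0.le, div_one] at h2
  have h3 : eLpNorm h (ENNReal.ofReal p) (volume.restrict K) ≤ wInt univ a p g ^ p⁻¹ := by
    rw [wInt_univ_eq_eLpNorm hp, ← ENNReal.rpow_mul, mul_inv_cancel₀ hp0.ne', ENNReal.rpow_one]
    exact eLpNorm_mono_measure h Measure.restrict_le_self
  calc _ ≤ ENNReal.ofReal c⁻¹ * (eLpNorm h (ENNReal.ofReal p) (volume.restrict K) *
        volume K ^ (1 - 1 / p)) := h1.trans (by gcongr)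
    _ ≤ ENNReal.ofReal c⁻¹ * (wInt univ a p g ^ p⁻¹ * volume K ^ (1 - 1 / p)) := by gcongr
    _ = _ := by ring

theorem locallyIntegrableOn_of_wInt (hp : 1 ≤ p) {f : R3 → ℝ} (hf : AEStronglyMeasurable f volume)
    (hfin : wInt univ a p f ≠ ⊤) : LocallyIntegrableOn f (univ \ axis) := by
  rw [← compl_eq_univ_sdiff, locallyIntegrableOn_iff isClosed_axis.isOpen_compl.isLocallyClosed]
  intro K hKa hK
  obtain ⟨C, hC, h⟩ := exists_lintegral_compact_le hp hK hKa a
  refine ⟨hf.restrict, (h f hf).trans_lt ?_⟩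
  exact ENNReal.mul_lt_top hC.lt_top
    (ENNReal.rpow_lt_top_of_nonneg (inv_nonneg.2 (by linarith)) hfin)

/-- On the support of the test function the weight is bounded below, so weighted convergence implies
convergence in L¹ there. -/
theorem tendsto_integral_mul_of_wInt (hp : 1 ≤ p) {f : R3 → ℝ} {g : ℕ → R3 → ℝ}
    (hf : AEStronglyMeasurable f volume) (hfl : LocallyIntegrableOn f (univ \ axis))
    (hg : ∀ n, Continuous (g n))
    (hlim : Filter.Tendsto (fun n => wInt univ a p (f - g n)) Filter.atTop (nhds 0))
    {φ : R3 → ℝ} (hφ : IsTestFunction (univ \ axis) φ) :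
    Filter.Tendsto (fun n => ∫ x, g n x * φ x) Filter.atTop (nhds (∫ x, f x * φ x)) := by
  have hp0 : 0 < p := by linarith
  obtain ⟨B, hB⟩ := hφ.compact.exists_bound_of_continuous hφ.smooth.continuous
  have hsub : tsupport φ ⊆ axisᶜ := by
    rw [compl_eq_univ_sdiff]; exact hφ.support
  obtain ⟨C, hC, h⟩ := exists_lintegral_compact_le hp hφ.compact.isCompact hsub a
  have hgl : ∀ n, LocallyIntegrableOn (g n) (univ \ axis) := fun n =>
    (hg n).locallyIntegrable.locallyIntegrableOn _
  rw [tendsto_iff_edist_tendsto_0]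
  have hbound : ∀ n, edist (∫ x, g n x * φ x) (∫ x, f x * φ x) ≤
      ENNReal.ofReal B * (C * wInt univ a p (f - g n) ^ p⁻¹) := by
    intro n
    rw [edist_comm, edist_eq_enorm_sub,
      ← integral_sub (hφ.integrable_mul hfl) (hφ.integrable_mul (hgl n))]
    refine (enorm_integral_le_lintegral_enorm _).trans ?_
    have e : ∫⁻ x, ‖f x * φ x - g n x * φ x‖ₑ =
        ∫⁻ x in tsupport φ, ‖f x * φ x - g n x * φ x‖ₑ := by
      rw [← lintegral_indicator (isClosed_tsupport φ).measurableSet]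
      refine lintegral_congr fun x => ?_
      by_cases hx : x ∈ tsupport φ
      · rw [indicator_of_mem hx]
      · rw [indicator_of_notMem hx, image_eq_zero_of_notMem_tsupport hx]; simp
    rw [e]
    calc _ ≤ ∫⁻ x in tsupport φ, ENNReal.ofReal B * ‖(f - g n) x‖ₑ := by
          refine lintegral_mono fun x => ?_
          rw [← sub_mul, enorm_mul, mul_comm, Pi.sub_apply]
          gcongr
          rw [← ofReal_norm]
          exact ENNReal.ofReal_le_ofReal (hB x)
      _ = ENNReal.ofReal B * ∫⁻ x in tsupport φ, ‖(f - g n) x‖ₑ :=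
          lintegral_const_mul' _ _ ENNReal.ofReal_ne_top
      _ ≤ _ := by
          gcongr
          exact h _ (hf.sub (hg n).aestronglyMeasurable)
  refine tendsto_of_tendsto_of_tendsto_of_le_of_le tendsto_const_nhds ?_ (fun _ => zero_le) hbound
  have h1 : Filter.Tendsto (fun n => wInt univ a p (f - g n) ^ p⁻¹) Filter.atTop (nhds 0) := by
    have := (ENNReal.continuous_rpow_const (y := p⁻¹)).tendsto 0 |>.comp hlim
    simpa [Function.comp_def, ENNReal.zero_rpow_of_pos (inv_pos.2 hp0)] using this
  have h2 := ENNReal.Tendsto.const_mul (a := ENNReal.ofReal B)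
    (ENNReal.Tendsto.const_mul (a := C) h1 (Or.inr hC)) (Or.inr ENNReal.ofReal_ne_top)
  simpa using h2

/-- Weak derivatives are stable under convergence in the weighted norms. -/
theorem hasWeakDeriv_of_tendsto (hp : 1 ≤ p) {b : ℝ} {α : Fin 3 → ℕ} {u v : R3 → ℝ}
    {f : ℕ → R3 → ℝ} (hu : AEStronglyMeasurable u volume) (hv : AEStronglyMeasurable v volume)
    (hul : LocallyIntegrableOn u (univ \ axis)) (hvl : LocallyIntegrableOn v (univ \ axis))
    (hf : ∀ n, ContDiff ℝ ∞ (f n))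
    (h0 : Filter.Tendsto (fun n => wInt univ a p (u - f n)) Filter.atTop (nhds 0))
    (h1 : Filter.Tendsto (fun n => wInt univ b p (v - multiD α (f n))) Filter.atTop (nhds 0)) :
    HasWeakDeriv (univ \ axis) α u v := by
  refine ⟨hul, hvl, fun φ hφ => ?_⟩
  have hφ' := hφ.multiD α
  rw [hφ'.setIntegral_mul, hφ.setIntegral_mul]
  refine tendsto_nhds_unique
    (tendsto_integral_mul_of_wInt hp hu hul (fun n => (hf n).continuous) h0 hφ') ?_
  have h2 := (tendsto_integral_mul_of_wInt hp hv hvl (fun n => ((hf n).multiD α).continuous) h1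
    hφ).const_mul ((-1 : ℝ) ^ order α)
  refine h2.congr fun n => ?_
  have := (hasWeakDeriv_of_contDiff (U := univ \ axis) (hf n) α).parts φ hφ
  rw [hφ'.setIntegral_mul, hφ.setIntegral_mul] at this
  exact this.symm

end

/-! ### The extension operator on measurable functions -/

section
variable {M : ℝ≥0} {w : EuclideanSpace ℝ (Fin 2) → ℝ} {η : R3 → ℝ} {ψ : ℝ → ℝ} {a p : ℝ}

theorem ae_mem_union (hw : LipschitzWith M w) :
    ∀ᵐ x : R3, x ∈ {x | 0 < depth w x} ∪ aboveGraph w := by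
  rw [ae_iff, ← volume_graph hw]
  congr 1
  ext x
  simp only [mem_union, mem_ofPred_eq, mem_aboveGraph_iff, not_or, not_lt]
  exact le_antisymm_iff.symm

theorem ae_of_ae_restrict (hw : LipschitzWith M w) {P : R3 → Prop}
    (h1 : ∀ᵐ x ∂volume.restrict {x | 0 < depth w x}, P x)
    (h2 : ∀ᵐ x ∂volume.restrict (aboveGraph w), P x) : ∀ᵐ x, P x := by
  rw [ae_restrict_iff' (isOpen_depth_pos hw).measurableSet] at h1
  rw [ae_restrict_iff' (isOpen_aboveGraph hw).measurableSet] at h2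
  filter_upwards [ae_mem_union hw, h1, h2] with x hx hx1 hx2
  exact hx.elim hx1 hx2

theorem wInt_univ_le (hw : LipschitzWith M w) (f : R3 → ℝ) :
    wInt univ a p f ≤ wInt {x | 0 < depth w x} a p f + wInt (aboveGraph w) a p f := by
  have h : volume.restrict univ = volume.restrict ({x | 0 < depth w x} ∪ aboveGraph w) :=
    Measure.restrict_congr_set (Filter.eventuallyEq_comm.1 (Filter.eventuallyEq_univ.2 (ae_mem_union hw)))
  rw [wInt, h]
  exact lintegral_union_le _ _ _

/-- Null sets above the graph are not seen by the averages. -/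
theorem IsStep.ae_ae_line (hw : LipschitzWith M w) (h : IsStep w η) {P : R3 → Prop}
    (hP : ∀ᵐ y ∂volume.restrict (aboveGraph w), P y) :
    ∀ᵐ x ∂volume.restrict {x | 0 < depth w x}, ∀ᵐ t ∂volume.restrict (Ioi (1 : ℝ)),
      P (x + vert (t * η x)) := by
  obtain ⟨s, hPs, hsm, hs⟩ := exists_measurable_superset_of_null (ae_iff.1 hP)
  obtain ⟨K, hK⟩ := h.exists_lintegral_avg_le hw
  -- The L¹ bound for averages is applied to the indicator of a measurable null superset of the
  -- exceptional set.
  set F : R3 → ℝ≥0∞ := s.indicator 1 with hF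
  have hFm : Measurable F := measurable_one.indicator hsm
  have hUm := (isOpen_depth_pos hw).measurableSet
  set ζ := {x | 0 < depth w x}.indicator η
  have hζm : Measurable ζ := h.measurable_indicator hw
  have h0 : ∫⁻ x in {x | 0 < depth w x}, ∫⁻ t in Ioi (1 : ℝ), F (x + vert (t * ζ x)) *
      ENNReal.ofReal ((t ^ 2)⁻¹) = 0 := by
    have h1 : ∫⁻ x in {x | 0 < depth w x}, ∫⁻ t in Ioi (1 : ℝ), F (x + vert (t * ζ x)) *
        ENNReal.ofReal ((t ^ 2)⁻¹) = ∫⁻ x in {x | 0 < depth w x}, ∫⁻ t in Ioi (1 : ℝ),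
          F (x + vert (t * η x)) * ENNReal.ofReal ((t ^ 2)⁻¹) :=
      setLIntegral_congr_fun hUm fun x hx => by simp only [ζ, indicator_of_mem hx η]
    have h2 : ∫⁻ y in aboveGraph w, F y = 0 := by
      rw [hF, lintegral_indicator_one hsm, hs]
    rw [h1, ← nonpos_iff_eq_zero]
    exact (hK F hFm).trans_eq (by rw [h2, mul_zero])
  rw [lintegral_eq_zero_iff (measurable_lintegral_line hζm hFm (measurable_ofReal_inv_pow 2))] at h0
  filter_upwards [h0, ae_restrict_mem hUm] with x hx hxU
  have hm : Measurable fun t : ℝ => F (x + vert (t * ζ x)) * ENNReal.ofReal ((t ^ 2)⁻¹) :=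
    (hFm.comp ((measurable_line hζm).comp measurable_prodMk_left)).mul (measurable_ofReal_inv_pow 2)
  rw [Pi.zero_apply, lintegral_eq_zero_iff hm] at hx
  filter_upwards [hx, ae_restrict_mem measurableSet_Ioi] with t ht ht1
  have ht0 : 0 < t := lt_trans one_pos ht1
  have hζ : ζ x = η x := indicator_of_mem (s := {x | 0 < depth w x}) hxU η
  have hk : ENNReal.ofReal ((t ^ 2)⁻¹) ≠ 0 := by
    rw [Ne, ENNReal.ofReal_eq_zero, not_le]; positivity
  have hz : F (x + vert (t * ζ x)) = 0 := (mul_eq_zero.1 ht).resolve_right hk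
  rw [hζ] at hz
  by_contra hcon
  rw [hF, indicator_of_mem (hPs hcon)] at hz
  exact one_ne_zero hz

theorem steinExt_ae_eq_restrict (hw : LipschitzWith M w) (u : R3 → ℝ) :
    steinExt w η ψ u =ᵐ[volume.restrict (aboveGraph w)] u := by
  filter_upwards [ae_restrict_mem (isOpen_aboveGraph hw).measurableSet] with x hx
  exact steinExt_of_depth_nonpos (mem_aboveGraph_iff.1 hx).le u

theorem IsStep.steinExt_congr_ae (hw : LipschitzWith M w) (h : IsStep w η) {u v : R3 → ℝ}
    (huv : u =ᵐ[volume.restrict (aboveGraph w)] v) : steinExt w η ψ u =ᵐ[volume] steinExt w η ψ v := by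
  refine ae_of_ae_restrict hw ?_ ?_
  · filter_upwards [h.ae_ae_line hw huv, ae_restrict_mem (isOpen_depth_pos hw).measurableSet] with
      x hx hxU
    rw [steinExt_of_depth_pos hxU, steinExt_of_depth_pos hxU]
    exact integral_congr_ae (hx.mono fun t ht => by simp only [ht])
  · exact ((steinExt_ae_eq_restrict hw u).trans huv).trans (steinExt_ae_eq_restrict hw v).symm

theorem IsSteinKernel.exists_enorm_le (hψ : IsSteinKernel ψ) (N : ℕ) :
    ∃ A : ℝ≥0, ∀ t, 1 < t → ‖ψ t‖ₑ ≤ A * ENNReal.ofReal ((t ^ N)⁻¹) := by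
  obtain ⟨A, hA0, hA⟩ := hψ.isRapid.exists_le_rpow N
  refine ⟨A.toNNReal, fun t ht => ?_⟩
  rw [Real.enorm_eq_ofReal_abs]
  refine (ENNReal.ofReal_le_ofReal (hA t ht.le)).trans_eq ?_
  rw [ENNReal.ofReal_mul hA0]; rfl

theorem lintegral_enorm_mul_le {A : ℝ≥0} {N : ℕ}
    (hA : ∀ t, 1 < t → ‖ψ t‖ₑ ≤ A * ENNReal.ofReal ((t ^ N)⁻¹)) (g : ℝ → ℝ) :
    ∫⁻ t in Ioi (1 : ℝ), ‖g t * ψ t‖ₑ ≤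
      A * ∫⁻ t in Ioi (1 : ℝ), ‖g t‖ₑ * ENNReal.ofReal ((t ^ N)⁻¹) := by
  rw [← lintegral_const_mul' _ _ ENNReal.coe_ne_top]
  refine setLIntegral_mono' measurableSet_Ioi fun t ht => ?_
  rw [enorm_mul, mul_left_comm]
  gcongr
  exact hA t ht

theorem IsStep.aestronglyMeasurable_steinExt (hw : LipschitzWith M w) (h : IsStep w η)
    (hψ : IsSteinKernel ψ) {u : R3 → ℝ}
    (hu : AEStronglyMeasurable u (volume.restrict (aboveGraph w))) :
    AEStronglyMeasurable (steinExt w η ψ u) volume := by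
  have hm : StronglyMeasurable (hu.mk u) := hu.stronglyMeasurable_mk
  refine AEStronglyMeasurable.congr ?_ (h.steinExt_congr_ae hw hu.ae_eq_mk).symm
  set f := hu.mk u
  have hUm := (isOpen_depth_pos hw).measurableSet
  have hψm : Measurable ((Ioi 1).indicator ψ) := by
    have hc : ContinuousOn ψ (Ioi 1) := hψ.smooth.continuousOn.mono Ioi_subset_Ici_self
    rw [← piecewise_eq_indicator]
    exact hc.measurable_piecewise continuousOn_const measurableSet_Ioi
  set ζ := {x | 0 < depth w x}.indicator η
  have hI : StronglyMeasurable fun x => ∫ t in Ioi (1 : ℝ), f (x + vert (t * ζ x)) *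
      (Ioi 1).indicator ψ t :=
    ((hm.measurable.comp (measurable_line (h.measurable_indicator hw))).mul
      (hψm.comp measurable_snd)).stronglyMeasurable.integral_prod_right'
  refine ((hI.indicator hUm).add (hm.indicator hUm.compl)).aestronglyMeasurable.congr
    (Filter.Eventually.of_forall fun x => ?_)
  by_cases hx : x ∈ {x | 0 < depth w x}
  · have hx' : x ∉ {x | 0 < depth w x}ᶜ := fun hc => hc hx
    rw [Pi.add_apply, indicator_of_mem hx, indicator_of_notMem hx', add_zero,
      steinExt_of_depth_pos hx]
    refine setIntegral_congr_fun measurableSet_Ioi fun t ht => ?_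
    simp only [indicator_of_mem ht, ζ, indicator_of_mem hx]
  · have hx' : x ∈ {x | 0 < depth w x}ᶜ := hx
    rw [Pi.add_apply, indicator_of_notMem hx, indicator_of_mem hx', zero_add,
      steinExt_of_depth_nonpos (not_lt.1 hx)]

/-- This order-zero bound holds for arbitrary measurable functions, without any approximation. It is
what later identifies the limit of extensions of test functions with the integral formula for u. -/
theorem IsStep.exists_wInt_steinExt_le (hw : LipschitzWith M w)
    (haxis : axis ⊆ frontier (aboveGraph w)) (h : IsStep w η) (hψ : IsSteinKernel ψ)
    (a : ℝ) {p : ℝ} (hp : 1 ≤ p) :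
    ∃ C : ℝ≥0, ∀ u, AEStronglyMeasurable u (volume.restrict (aboveGraph w)) →
      wInt univ a p (steinExt w η ψ u) ≤ C * wInt (aboveGraph w) a p u := by
  obtain ⟨A, hA⟩ := hψ.exists_enorm_le (⌈|a|⌉₊ + 2)
  obtain ⟨C, hC⟩ := h.exists_lintegral_rpow_avg_le hw haxis a hp
  have hp0 : 0 ≤ p := by linarith
  have hUm := (isOpen_depth_pos hw).measurableSet
  refine ⟨A ^ p * C + 1, fun u hu => ?_⟩
  have e1 : wInt univ a p (steinExt w η ψ u) = wInt univ a p (steinExt w η ψ (hu.mk u)) :=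
    wInt_congr_ae (by rw [Measure.restrict_univ]; exact h.steinExt_congr_ae hw hu.ae_eq_mk)
  have e2 : wInt (aboveGraph w) a p u = wInt (aboveGraph w) a p (hu.mk u) :=
    wInt_congr_ae hu.ae_eq_mk
  have hm : Measurable (hu.mk u) := hu.stronglyMeasurable_mk.measurable
  rw [e1, e2]
  set f := hu.mk u
  have e3 : ((A ^ p * C + 1 : ℝ≥0) : ℝ≥0∞) = (A : ℝ≥0∞) ^ p * C + 1 := by
    rw [ENNReal.coe_add, ENNReal.coe_mul, ENNReal.coe_rpow_of_nonneg _ hp0, ENNReal.coe_one]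
  rw [e3, add_mul, one_mul, ← wInt_congr_ae (steinExt_ae_eq_restrict (η := η) (ψ := ψ) hw f)]
  refine (wInt_univ_le hw _).trans ?_
  gcongr
  rw [wInt_congr_ae (steinExt_ae_eq_restrict hw f), mul_assoc]
  refine le_trans ?_ (mul_le_mul_right (hC f hm) _)
  rw [← lintegral_const_mul' _ _ (ENNReal.rpow_ne_top_of_nonneg hp0 ENNReal.coe_ne_top)]
  refine setLIntegral_mono' hUm fun x hx => ?_
  rw [← ENNReal.mul_rpow_of_nonneg _ _ hp0, mul_left_comm]
  gcongr
  rw [steinExt_of_depth_pos hx]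
  exact (enorm_integral_le_lintegral_enorm _).trans (lintegral_enorm_mul_le hA _)

/-- The averaged norm has finite weighted L^p norm, so it is finite almost everywhere, and the
weight is positive below the graph. Linearity depends on this, since an integral that does not
converge has the default value 0. -/
theorem IsStep.ae_integrableOn_line (hw : LipschitzWith M w)
    (haxis : axis ⊆ frontier (aboveGraph w)) (h : IsStep w η) (hψ : IsSteinKernel ψ)
    (hp : 1 ≤ p) {u : R3 → ℝ} (hu : AEStronglyMeasurable u (volume.restrict (aboveGraph w)))
    (hfin : wInt (aboveGraph w) a p u ≠ ⊤) :
    ∀ᵐ x ∂volume.restrict {x | 0 < depth w x},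
      IntegrableOn (fun t => u (x + vert (t * η x)) * ψ t) (Ioi 1) := by
  obtain ⟨A, hA⟩ := hψ.exists_enorm_le (⌈|a|⌉₊ + 2)
  obtain ⟨C, hC⟩ := h.exists_lintegral_rpow_avg_le hw haxis a hp
  have hp0 : 0 < p := by linarith
  have hUm := (isOpen_depth_pos hw).measurableSet
  have hm : Measurable (hu.mk u) := hu.stronglyMeasurable_mk.measurable
  rw [wInt_congr_ae hu.ae_eq_mk] at hfin
  have hline := h.ae_ae_line hw hu.ae_eq_mk
  set f := hu.mk u
  set ζ := {x | 0 < depth w x}.indicator η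
  have hζm : Measurable ζ := h.measurable_indicator hw
  have hJ : ∫⁻ x in {x | 0 < depth w x}, (ENNReal.ofReal (axisDist x ^ a) *
        ∫⁻ t in Ioi (1 : ℝ), ‖f (x + vert (t * ζ x))‖ₑ *
          ENNReal.ofReal ((t ^ (⌈|a|⌉₊ + 2))⁻¹)) ^ p ≠ ⊤ := by
    refine ne_top_of_le_ne_top (ENNReal.mul_ne_top ENNReal.coe_ne_top hfin)
      (le_trans (le_of_eq (setLIntegral_congr_fun hUm fun x hx => ?_)) (hC f hm))
    simp only [ζ, indicator_of_mem hx]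
  have hJm : Measurable fun x => (ENNReal.ofReal (axisDist x ^ a) *
        ∫⁻ t in Ioi (1 : ℝ), ‖f (x + vert (t * ζ x))‖ₑ *
          ENNReal.ofReal ((t ^ (⌈|a|⌉₊ + 2))⁻¹)) ^ p :=
    (((continuous_axisDist.measurable.pow_const a).ennreal_ofReal).mul
      (measurable_lintegral_line hζm hm.enorm (measurable_ofReal_inv_pow _))).pow_const p
  filter_upwards [ae_lt_top hJm hJ, hline, ae_restrict_mem hUm] with x hx hxl hxU
  have hr : 0 < axisDist x := by
    have := (le_abs_self _).trans (abs_depth_le_axisDist hw haxis x)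
    exact pos_of_mul_pos_right (lt_of_lt_of_le hxU this) (by positivity)
  have hζ : ζ x = η x := indicator_of_mem (s := {x | 0 < depth w x}) hxU η
  rw [hζ, ENNReal.rpow_lt_top_iff_of_pos hp0] at hx
  have hI : ∫⁻ t in Ioi (1 : ℝ), ‖f (x + vert (t * η x))‖ₑ *
      ENNReal.ofReal ((t ^ (⌈|a|⌉₊ + 2))⁻¹) ≠ ⊤ := by
    intro htop
    rw [htop, ENNReal.mul_top] at hx
    · exact lt_irrefl _ hx
    · rw [Ne, ENNReal.ofReal_eq_zero, not_le]; exact Real.rpow_pos_of_pos hr a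
  have hmt : Measurable fun t : ℝ => f (x + vert (t * η x)) := by
    rw [← hζ]
    exact hm.comp ((measurable_line hζm).comp measurable_prodMk_left)
  have hint : IntegrableOn (fun t => f (x + vert (t * η x)) * ψ t) (Ioi 1) := by
    refine ⟨hmt.aestronglyMeasurable.mul ((hψ.smooth.continuousOn.mono
      Ioi_subset_Ici_self).aestronglyMeasurable measurableSet_Ioi), ?_⟩
    exact (lintegral_enorm_mul_le hA _).trans_lt
      (ENNReal.mul_lt_top ENNReal.coe_lt_top hI.lt_top)
  exact hint.congr (hxl.mono fun t ht => by simp only [ht])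

theorem IsStep.steinExt_linear_ae (hw : LipschitzWith M w)
    (haxis : axis ⊆ frontier (aboveGraph w)) (h : IsStep w η) (hψ : IsSteinKernel ψ)
    (hp : 1 ≤ p) {u v : R3 → ℝ} (hu : AEStronglyMeasurable u (volume.restrict (aboveGraph w)))
    (hufin : wInt (aboveGraph w) a p u ≠ ⊤)
    (hv : AEStronglyMeasurable v (volume.restrict (aboveGraph w)))
    (hvfin : wInt (aboveGraph w) a p v ≠ ⊤) (b c : ℝ) :
    steinExt w η ψ (b • u + c • v) =ᵐ[volume] b • steinExt w η ψ u + c • steinExt w η ψ v := by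
  refine ae_of_ae_restrict hw ?_ ?_
  · filter_upwards [h.ae_integrableOn_line hw haxis hψ hp hu hufin,
      h.ae_integrableOn_line hw haxis hψ hp hv hvfin,
      ae_restrict_mem (isOpen_depth_pos hw).measurableSet] with x hxu hxv hxU
    simp only [Pi.add_apply, Pi.smul_apply, smul_eq_mul, steinExt_of_depth_pos hxU, kernelAvg]
    rw [← integral_const_mul, ← integral_const_mul,
      ← integral_add (hxu.const_mul b) (hxv.const_mul c)]
    exact integral_congr_ae (Filter.Eventually.of_forall fun t => by ring)
  · filter_upwards [ae_restrict_mem (isOpen_aboveGraph hw).measurableSet] with x hx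
    have hd := (mem_aboveGraph_iff.1 hx).le
    simp only [Pi.add_apply, Pi.smul_apply, steinExt_of_depth_nonpos hd]

/-- The graph is null, so the two sides are treated separately; above it nothing is changed, which
accounts for the additional 1 in the constant. -/
theorem IsStep.exists_wInt_multiD_steinExt_le (hw : LipschitzWith M w)
    (haxis : axis ⊆ frontier (aboveGraph w)) (h : IsStep w η) (hψ : IsSteinKernel ψ)
    (a : ℝ) {p : ℝ} (hp : 1 ≤ p) (α : Fin 3 → ℕ) :
    ∃ C : ℝ≥0, ∀ φ, IsBddSmooth φ → wInt univ a p (multiD α (steinExt w η ψ φ)) ≤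
      C * ∑ β ∈ multiIdxEq (order α), wInt (aboveGraph w) a p (multiD β φ) := by
  obtain ⟨C, hC⟩ := h.exists_wInt_multiD_le hw haxis hψ a hp α
  refine ⟨C + 1, fun φ hφ => (wInt_univ_le hw _).trans ?_⟩
  rw [ENNReal.coe_add, ENNReal.coe_one, add_mul, one_mul]
  refine add_le_add (le_trans (le_of_eq ?_) (hC φ hφ)) (le_trans (le_of_eq ?_)
    (Finset.single_le_sum (f := fun β => wInt (aboveGraph w) a p (multiD β φ))
      (fun _ _ => zero_le) (mem_multiIdxEq.2 rfl)))
  · refine wInt_congr_ae ?_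
    filter_upwards [ae_restrict_mem (isOpen_depth_pos hw).measurableSet] with x hx
    rw [multiD_eq_listD, multiD_eq_listD]
    exact listD_congr (isOpen_depth_pos hw) (fun y hy => steinExt_of_depth_pos hy φ) _ hx
  · refine wInt_congr_ae ?_
    filter_upwards [ae_restrict_mem (isOpen_aboveGraph hw).measurableSet] with x hx
    rw [multiD_eq_listD, multiD_eq_listD]
    exact listD_congr (isOpen_aboveGraph hw)
      (fun y hy => steinExt_of_depth_nonpos (mem_aboveGraph_iff.1 hy).le φ) _ hx

theorem IsSteinKernel.steinExt_sub (hψ : IsSteinKernel ψ) {φ χ : R3 → ℝ}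
    (hφ : IsBddSmooth φ) (hχ : IsBddSmooth χ) :
    steinExt w η ψ (φ - χ) = steinExt w η ψ φ - steinExt w η ψ χ := by
  ext x
  rcases le_or_gt (depth w x) 0 with hx | hx
  · simp only [Pi.sub_apply, steinExt_of_depth_nonpos hx]
  · simp only [Pi.sub_apply, steinExt_of_depth_pos hx, kernelAvg]
    rw [← integral_sub (hψ.isRapid.integrableOn_comp_mul hφ x (η x))
      (hψ.isRapid.integrableOn_comp_mul hχ x (η x))]
    exact integral_congr_ae (Filter.Eventually.of_forall fun t => by ring)

end

/-! ### Approximation in the weighted spaces -/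

theorem multiD_sub {f g : R3 → ℝ} (hf : ContDiff ℝ ∞ f) (hg : ContDiff ℝ ∞ g) (α : Fin 3 → ℕ) :
    multiD α (f - g) = multiD α f - multiD α g := by
  ext x
  simp only [multiD_eq_listD, Pi.sub_apply]
  exact listD_sub isOpen_univ hf.contDiffOn hg.contDiffOn _ (mem_univ x)

theorem IsTestFunction.sub {U : Set R3} {φ χ : R3 → ℝ} (hφ : IsTestFunction U φ)
    (hχ : IsTestFunction U χ) : IsTestFunction U (φ - χ) := by
  refine ⟨hφ.smooth.sub hχ.smooth, hφ.compact.sub hχ.compact, ?_⟩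
  exact (tsupport_sub φ χ).trans (union_subset hφ.support hχ.support)

theorem restrict_diff_axis (hax : volume axis = 0) (G : Set R3) :
    volume.restrict (G \ axis) = volume.restrict G :=
  Measure.restrict_congr_set (sdiff_null_ae_eq_self hax)

theorem zero_mem_multiIdx (l : ℕ) : (0 : Fin 3 → ℕ) ∈ multiIdx l := by
  simp [mem_multiIdx, order]

section
variable {G : Set R3} {l : ℕ} {δ p a : ℝ} {u : R3 → ℝ}

theorem MemV.aestronglyMeasurable (hax : volume axis = 0) (hu : MemV G l δ p u) :
    AEStronglyMeasurable u (volume.restrict G) := by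
  obtain ⟨v, hv⟩ := hu.weak 0 (zero_mem_multiIdx l)
  rw [← restrict_diff_axis hax]
  exact hv.left.aestronglyMeasurable

theorem MemV.weakD_zero_ae_eq (hax : volume axis = 0) (hG : IsOpen G) (hu : MemV G l δ p u) :
    weakD (G \ axis) 0 u =ᵐ[volume.restrict G] u := by
  obtain ⟨v, hv⟩ := hu.weak 0 (zero_mem_multiIdx l)
  have := (hasWeakDeriv_zero hv.left).weakD_ae_eq (hG.sdiff isClosed_axis)
  rwa [restrict_diff_axis hax] at this

theorem MemV.wInt_weakD_ne_top (hax : volume axis = 0) (hp : 1 ≤ p) (hu : MemV G l δ p u)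
    {α : Fin 3 → ℕ} (hα : α ∈ multiIdx l) :
    wInt G (δ - l + order α) p (weakD (G \ axis) α u) ≠ ⊤ := by
  have h := ENNReal.rpow_ne_top_of_nonneg (by linarith : 0 ≤ p) hu.finite.ne
  rw [vNorm_rpow hax hp] at h
  exact ne_top_of_le_ne_top h (Finset.single_le_sum
    (f := fun α => wInt G (δ - l + order α) p (weakD (G \ axis) α u)) (fun _ _ => zero_le) hα)

theorem MemV.wInt_ne_top (hax : volume axis = 0) (hG : IsOpen G) (hp : 1 ≤ p)
    (hu : MemV G l δ p u) : wInt G (δ - l) p u ≠ ⊤ := by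
  have h := hu.wInt_weakD_ne_top hax hp (zero_mem_multiIdx l)
  rw [wInt_congr_ae (hu.weakD_zero_ae_eq hax hG)] at h
  simpa [order] using h

theorem MemV.weakD_sub_ae_eq (hax : volume axis = 0) (hG : IsOpen G) (hu : MemV G l δ p u)
    {φ : R3 → ℝ} (hφ : ContDiff ℝ ∞ φ) {α : Fin 3 → ℕ} (hα : α ∈ multiIdx l) :
    weakD (G \ axis) α (u - φ) =ᵐ[volume.restrict G] weakD (G \ axis) α u - multiD α φ := by
  have := ((hasWeakDeriv_weakD (hu.weak α hα)).sub
    (hasWeakDeriv_of_contDiff hφ α)).weakD_ae_eq (hG.sdiff isClosed_axis)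
  rwa [restrict_diff_axis hax] at this

theorem MemV.exists_seq (hax : volume axis = 0) (hG : IsOpen G) (hp : 1 ≤ p)
    (hu : MemV G l δ p u) : ∃ φ : ℕ → R3 → ℝ, (∀ n, IsTestFunction axisᶜ (φ n)) ∧
      ∀ n, ∀ α ∈ multiIdx l, wInt G (δ - l + order α) p (weakD (G \ axis) α u - multiD α (φ n)) ≤
        ((2⁻¹ : ℝ≥0∞) ^ n) ^ p := by
  have hp0 : 0 ≤ p := by linarith
  choose φ hφ hφu using fun n : ℕ =>
    hu.approx ((2⁻¹ : ℝ≥0∞) ^ n) (ENNReal.pow_pos (by simp) n)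
  refine ⟨φ, hφ, fun n α hα => ?_⟩
  have h := ENNReal.rpow_le_rpow (hφu n).le hp0
  rw [vNorm_rpow hax hp] at h
  rw [← wInt_congr_ae (hu.weakD_sub_ae_eq hax hG (hφ n).smooth hα)]
  exact (Finset.single_le_sum (f := fun α => wInt G (δ - l + order α) p
    (weakD (G \ axis) α (u - φ n))) (fun _ _ => zero_le) hα).trans h

theorem tendsto_two_inv_pow_rpow (hp : 1 ≤ p) :
    Filter.Tendsto (fun n : ℕ => ((2⁻¹ : ℝ≥0∞) ^ n) ^ p) Filter.atTop (nhds 0) := by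
  have hp0 : 0 < p := by linarith
  have h := ENNReal.tendsto_pow_atTop_nhds_zero_of_lt_one (r := (2⁻¹ : ℝ≥0∞)) (by simp)
  have := (ENNReal.continuous_rpow_const (y := p)).tendsto 0 |>.comp h
  simpa [Function.comp_def, ENNReal.zero_rpow_of_pos hp0] using this

theorem two_rpow_ne_top (hp : 1 ≤ p) : (2 : ℝ≥0∞) ^ (p - 1) ≠ ⊤ :=
  ENNReal.rpow_ne_top_of_nonneg (by linarith) ENNReal.ofNat_ne_top

theorem wInt_le_of_sub (hp : 1 ≤ p) {f g : R3 → ℝ}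
    (hf : AEStronglyMeasurable f (volume.restrict G)) :
    wInt G a p g ≤ 2 ^ (p - 1) * (wInt G a p f + wInt G a p (f - g)) := by
  have h := wInt_sub_le (a := a) (g := f - g) hp hf
  rwa [sub_sub_cancel] at h

theorem wInt_ne_top_of_sub (hp : 1 ≤ p) {f g : R3 → ℝ}
    (hf : AEStronglyMeasurable f (volume.restrict G)) (hfin : wInt G a p f ≠ ⊤)
    (hsub : wInt G a p (f - g) ≠ ⊤) : wInt G a p g ≠ ⊤ :=
  ne_top_of_le_ne_top (ENNReal.mul_ne_top (two_rpow_ne_top hp) (ENNReal.add_ne_top.2 ⟨hfin, hsub⟩))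
    (wInt_le_of_sub hp hf)

end

/-! ### The extension operator on the weighted spaces -/

section
variable {M : ℝ≥0} {w : EuclideanSpace ℝ (Fin 2) → ℝ} {η : R3 → ℝ} {ψ : ℝ → ℝ}
  {l : ℕ} {δ p : ℝ}

theorem multiIdxEq_subset {α : Fin 3 → ℕ} (hα : α ∈ multiIdx l) :
    multiIdxEq (order α) ⊆ multiIdx l := fun β hβ => by
  rw [mem_multiIdx, mem_multiIdxEq.1 hβ]; exact (mem_multiIdx l α).1 hα

/-- On test functions the operator is linear and ∂^α of the extension is bounded by derivatives of
order |α|. These converge to the weak derivatives of u in the same weight, so the extended sequence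
is Cauchy. -/
theorem IsStep.exists_tendsto_wInt_multiD_sub (hw : LipschitzWith M w)
    (haxis : axis ⊆ frontier (aboveGraph w)) (h : IsStep w η) (hψ : IsSteinKernel ψ)
    (hp : 1 ≤ p) {u : R3 → ℝ} (hu : MemV (aboveGraph w) l δ p u) {φ : ℕ → R3 → ℝ}
    (hφ : ∀ n, IsTestFunction axisᶜ (φ n))
    (hφu : ∀ n, ∀ α ∈ multiIdx l, wInt (aboveGraph w) (δ - l + order α) p
      (weakD (aboveGraph w \ axis) α u - multiD α (φ n)) ≤ ((2⁻¹ : ℝ≥0∞) ^ n) ^ p)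
    {α : Fin 3 → ℕ} (hα : α ∈ multiIdx l) :
    ∃ v, Measurable v ∧ wInt univ (δ - l + order α) p v ≠ ⊤ ∧
      Filter.Tendsto (fun n => wInt univ (δ - l + order α) p
        (v - multiD α (steinExt w η ψ (φ n)))) Filter.atTop (nhds 0) := by
  have hax := volume_axis hw haxis
  have hp0 : 0 ≤ p := by linarith
  set D := aboveGraph w
  obtain ⟨C, hC⟩ := h.exists_wInt_multiD_steinExt_le hw haxis hψ (δ - l + order α) hp α
  have hsm : ∀ n, ContDiff ℝ ∞ (steinExt w η ψ (φ n)) := fun n =>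
    contDiff_steinExt hw h hψ (hφ n).isBddSmooth
  have hsub := multiIdxEq_subset hα
  have hwm : ∀ β, AEStronglyMeasurable (weakD (D \ axis) β u) (volume.restrict D) := fun β => by
    rw [← restrict_diff_axis hax]; exact aestronglyMeasurable_weakD u
  have hφu' : ∀ n, ∀ β ∈ multiIdxEq (order α), wInt D (δ - l + order α) p
      (weakD (D \ axis) β u - multiD β (φ n)) ≤ ((2⁻¹ : ℝ≥0∞) ^ n) ^ p := fun n β hβ => by
    have := hφu n β (hsub hβ)
    rwa [mem_multiIdxEq.1 hβ] at this
  have hfin : ∀ n, wInt univ (δ - l + order α) p (multiD α (steinExt w η ψ (φ n))) ≠ ⊤ := by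
    intro n
    refine ne_top_of_le_ne_top (ENNReal.mul_ne_top ENNReal.coe_ne_top
      (ENNReal.sum_ne_top.2 fun β hβ => ?_)) (hC _ (hφ n).isBddSmooth)
    refine wInt_ne_top_of_sub hp (hwm β) ?_ (ne_top_of_le_ne_top ?_ (hφu' n β hβ))
    · have := hu.wInt_weakD_ne_top hax hp (hsub hβ)
      rwa [mem_multiIdxEq.1 hβ] at this
    · exact ENNReal.rpow_ne_top_of_nonneg hp0 (ENNReal.pow_ne_top (by simp))
  obtain ⟨v, hv, hlim⟩ := exists_tendsto_wInt_sub (a := δ - l + order α) hax hp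
    (g := fun n => multiD α (steinExt w η ψ (φ n)))
    (fun n => ((hsm n).multiD α).continuous.measurable) hfin
    -- The cardinality counts the derivatives of order |α|; the factor 2^{p−1} · 2 comes from
    -- inserting ∂^β u between two members of the sequence.
    (C := C * ((multiIdxEq (order α)).card * (2 ^ (p - 1) * 2))) (by
      intro N n m hn hm
      have e : multiD α (steinExt w η ψ (φ n)) - multiD α (steinExt w η ψ (φ m)) =
          multiD α (steinExt w η ψ (φ n - φ m)) := by
        rw [hψ.steinExt_sub (hφ n).isBddSmooth (hφ m).isBddSmooth, multiD_sub (hsm n) (hsm m)]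
      rw [e]
      refine (hC _ ((hφ n).sub (hφ m)).isBddSmooth).trans ?_
      have hmono : ∀ k, N ≤ k → ((2⁻¹ : ℝ≥0∞) ^ k) ^ p ≤ ((2⁻¹ : ℝ≥0∞) ^ N) ^ p := fun k hk =>
        ENNReal.rpow_le_rpow (pow_le_pow_of_le_one zero_le (by simp) hk) hp0
      have hβ : ∀ β ∈ multiIdxEq (order α), wInt D (δ - l + order α) p (multiD β (φ n - φ m)) ≤
          2 ^ (p - 1) * 2 * ((2⁻¹ : ℝ≥0∞) ^ N) ^ p := by
        intro β hβ
        have e2 : multiD β (φ n - φ m) = (weakD (D \ axis) β u - multiD β (φ m)) -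
            (weakD (D \ axis) β u - multiD β (φ n)) := by
          rw [multiD_sub (hφ n).smooth (hφ m).smooth]; abel
        rw [e2, mul_assoc, two_mul]
        refine (wInt_sub_le hp ((hwm β).sub
          ((hφ m).smooth.multiD β).continuous.aestronglyMeasurable)).trans ?_
        gcongr
        · exact (hφu' m β hβ).trans (hmono m hm)
        · exact (hφu' n β hβ).trans (hmono n hn)
      refine (mul_le_mul_right (Finset.sum_le_card_nsmul _ _ _ hβ) _).trans_eq ?_
      rw [ENNReal.coe_mul, ENNReal.coe_mul, ENNReal.coe_mul,
        ENNReal.coe_rpow_of_nonneg _ (by linarith : 0 ≤ p - 1), ENNReal.coe_natCast, nsmul_eq_mul,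
        ENNReal.coe_ofNat]
      ring)
  refine ⟨v, hv, ?_, hlim⟩
  obtain ⟨n, hn⟩ := (hlim.eventually (gt_mem_nhds one_pos)).exists
  refine wInt_ne_top_of_sub hp ((hsm n).multiD α).continuous.aestronglyMeasurable (hfin n) ?_
  rw [wInt_sub_comm]
  exact (hn.trans ENNReal.one_lt_top).ne

theorem IsStep.tendsto_wInt_steinExt_sub (hw : LipschitzWith M w)
    (haxis : axis ⊆ frontier (aboveGraph w)) (h : IsStep w η) (hψ : IsSteinKernel ψ)
    (hp : 1 ≤ p) {u : R3 → ℝ} (hu : MemV (aboveGraph w) l δ p u) {φ : ℕ → R3 → ℝ}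
    (hφ : ∀ n, IsTestFunction axisᶜ (φ n))
    (hφu : ∀ n, wInt (aboveGraph w) (δ - l) p (u - φ n) ≤ ((2⁻¹ : ℝ≥0∞) ^ n) ^ p) :
    Filter.Tendsto (fun n => wInt univ (δ - l) p (steinExt w η ψ u - steinExt w η ψ (φ n)))
      Filter.atTop (nhds 0) := by
  have hax := volume_axis hw haxis
  have hD := isOpen_aboveGraph hw
  have hum := hu.aestronglyMeasurable hax
  have hufin := hu.wInt_ne_top hax hD hp
  obtain ⟨C, hC⟩ := h.exists_wInt_steinExt_le hw haxis hψ (δ - l) hp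
  have hlim := ENNReal.Tendsto.const_mul (a := C) (tendsto_two_inv_pow_rpow hp)
    (Or.inr ENNReal.coe_ne_top)
  rw [mul_zero] at hlim
  refine tendsto_of_tendsto_of_tendsto_of_le_of_le tendsto_const_nhds hlim (fun _ => zero_le)
    fun n => ?_
  have hφm : AEStronglyMeasurable (φ n) (volume.restrict (aboveGraph w)) :=
    (hφ n).smooth.continuous.aestronglyMeasurable
  have hφfin : wInt (aboveGraph w) (δ - l) p (φ n) ≠ ⊤ :=
    wInt_ne_top_of_sub hp hum hufin (ne_top_of_le_ne_top
      (ENNReal.rpow_ne_top_of_nonneg (by linarith) (ENNReal.pow_ne_top (by simp))) (hφu n))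
  have e := h.steinExt_linear_ae hw haxis hψ hp hum hufin hφm hφfin 1 (-1)
  simp only [one_smul, neg_one_smul, ← sub_eq_add_neg] at e
  have e' : wInt univ (δ - l) p (steinExt w η ψ u - steinExt w η ψ (φ n)) =
      wInt univ (δ - l) p (steinExt w η ψ (u - φ n)) :=
    wInt_congr_ae (by rw [Measure.restrict_univ]; exact e.symm)
  beta_reduce
  rw [e']
  exact (hC _ (hum.sub hφm)).trans (mul_le_mul_right (hφu n) _)

/-- The extension of `u` has weak derivatives, and they are the limits of the derivatives of the
extensions of approximating test functions. -/
theorem IsStep.exists_approx_steinExt (hw : LipschitzWith M w)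
    (haxis : axis ⊆ frontier (aboveGraph w)) (h : IsStep w η) (hψ : IsSteinKernel ψ)
    (hp : 1 ≤ p) {u : R3 → ℝ} (hu : MemV (aboveGraph w) l δ p u) :
    ∃ φ : ℕ → R3 → ℝ, (∀ n, IsTestFunction axisᶜ (φ n)) ∧
      (∀ n, ∀ α ∈ multiIdx l, wInt (aboveGraph w) (δ - l + order α) p
        (weakD (aboveGraph w \ axis) α u - multiD α (φ n)) ≤ ((2⁻¹ : ℝ≥0∞) ^ n) ^ p) ∧
      ∀ α ∈ multiIdx l, (∃ v, HasWeakDeriv (univ \ axis) α (steinExt w η ψ u) v) ∧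
        Filter.Tendsto (fun n => wInt univ (δ - l + order α) p
          (weakD (univ \ axis) α (steinExt w η ψ u) - multiD α (steinExt w η ψ (φ n))))
          Filter.atTop (nhds 0) := by
  have hax := volume_axis hw haxis
  have hD := isOpen_aboveGraph hw
  have hum := hu.aestronglyMeasurable hax
  obtain ⟨φ, hφ, hφu⟩ := hu.exists_seq hax hD hp
  refine ⟨φ, hφ, hφu, fun α hα => ?_⟩
  have hφ0 : ∀ n, wInt (aboveGraph w) (δ - l) p (u - φ n) ≤ ((2⁻¹ : ℝ≥0∞) ^ n) ^ p := fun n => by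
    have h0 := hφu n 0 (zero_mem_multiIdx l)
    rw [multiD_order_zero, wInt_congr_ae ((hu.weakD_zero_ae_eq hax hD).sub
      (Filter.EventuallyEq.refl _ (φ n)))] at h0
    simpa [order] using h0
  have hlim0 := h.tendsto_wInt_steinExt_sub hw haxis hψ hp hu hφ hφ0
  obtain ⟨v, hv, hvfin, hvlim⟩ := h.exists_tendsto_wInt_multiD_sub hw haxis hψ hp hu hφ hφu hα
  have hEm := h.aestronglyMeasurable_steinExt hw hψ hum
  obtain ⟨C, hC⟩ := h.exists_wInt_steinExt_le hw haxis hψ (δ - l) hp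
  have hEfin : wInt univ (δ - l) p (steinExt w η ψ u) ≠ ⊤ :=
    ne_top_of_le_ne_top (ENNReal.mul_ne_top ENNReal.coe_ne_top (hu.wInt_ne_top hax hD hp))
      (hC u hum)
  have hwd : HasWeakDeriv (univ \ axis) α (steinExt w η ψ u) v :=
    hasWeakDeriv_of_tendsto hp hEm hv.aestronglyMeasurable
      (locallyIntegrableOn_of_wInt hp hEm hEfin)
      (locallyIntegrableOn_of_wInt hp hv.aestronglyMeasurable hvfin)
      (fun n => contDiff_steinExt hw h hψ (hφ n).isBddSmooth) hlim0 hvlim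
  refine ⟨⟨v, hwd⟩, hvlim.congr fun n => wInt_congr_ae ?_⟩
  have := hwd.weakD_ae_eq (isOpen_univ.sdiff isClosed_axis)
  rw [restrict_diff_axis hax] at this
  exact this.symm.sub (Filter.EventuallyEq.refl _ _)

/-- The bound for test functions passes to the limit. Only β with |β| = |α| ≤ l occur, and they
carry exactly the weights of the norm of u. -/
theorem IsStep.exists_wInt_weakD_steinExt_le (hw : LipschitzWith M w)
    (haxis : axis ⊆ frontier (aboveGraph w)) (h : IsStep w η) (hψ : IsSteinKernel ψ)
    (hp : 1 ≤ p) {α : Fin 3 → ℕ} (hα : α ∈ multiIdx l) :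
    ∃ C : ℝ≥0, ∀ u, MemV (aboveGraph w) l δ p u →
      wInt univ (δ - l + order α) p (weakD (univ \ axis) α (steinExt w η ψ u)) ≤
        C * vNorm (aboveGraph w) l δ p u ^ p := by
  have hax := volume_axis hw haxis
  obtain ⟨C, hC⟩ := h.exists_wInt_multiD_steinExt_le hw haxis hψ (δ - l + order α) hp α
  have h2 := two_rpow_ne_top hp
  refine ⟨2 ^ (p - 1) * (C * 2 ^ (p - 1)), fun u hu => ?_⟩
  obtain ⟨φ, hφ, hφu, hE⟩ := h.exists_approx_steinExt hw haxis hψ hp hu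
  set D := aboveGraph w
  have hsub := multiIdxEq_subset hα
  have hwm : ∀ β, AEStronglyMeasurable (weakD (D \ axis) β u) (volume.restrict D) := fun β => by
    rw [← restrict_diff_axis hax]; exact aestronglyMeasurable_weakD u
  set S := ∑ β ∈ multiIdxEq (order α), wInt D (δ - l + order α) p (weakD (D \ axis) β u) with hS
  have hSle : S ≤ vNorm D l δ p u ^ p := by
    rw [vNorm_rpow hax hp, hS]
    refine (Finset.sum_congr rfl fun β hβ => ?_).trans_le
      (Finset.sum_le_sum_of_subset hsub)
    rw [mem_multiIdxEq.1 hβ]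
  have hbound : ∀ n, wInt univ (δ - l + order α) p (weakD (univ \ axis) α (steinExt w η ψ u)) ≤
      2 ^ (p - 1) * (C * (2 ^ (p - 1) * (S + (multiIdxEq (order α)).card *
        ((2⁻¹ : ℝ≥0∞) ^ n) ^ p)) + wInt univ (δ - l + order α) p
          (weakD (univ \ axis) α (steinExt w η ψ u) - multiD α (steinExt w η ψ (φ n)))) := by
    intro n
    have hsm := (contDiff_steinExt hw h hψ (hφ n).isBddSmooth).multiD α
    refine (wInt_le_of_sub (f := multiD α (steinExt w η ψ (φ n))) hp
      hsm.continuous.aestronglyMeasurable).trans ?_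
    rw [wInt_sub_comm]
    gcongr
    refine (hC _ (hφ n).isBddSmooth).trans ?_
    gcongr
    rw [hS, ← nsmul_eq_mul, ← Finset.sum_const, ← Finset.sum_add_distrib, Finset.mul_sum]
    refine Finset.sum_le_sum fun β hβ => (wInt_le_of_sub hp (hwm β)).trans ?_
    gcongr
    have := hφu n β (hsub hβ)
    rwa [mem_multiIdxEq.1 hβ] at this
  have hlim : Filter.Tendsto (fun n : ℕ => 2 ^ (p - 1) * (C * (2 ^ (p - 1) *
      (S + (multiIdxEq (order α)).card * ((2⁻¹ : ℝ≥0∞) ^ n) ^ p)) +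
        wInt univ (δ - l + order α) p (weakD (univ \ axis) α (steinExt w η ψ u) -
          multiD α (steinExt w η ψ (φ n))))) Filter.atTop
      (nhds (2 ^ (p - 1) * (C * (2 ^ (p - 1) * (S + (multiIdxEq (order α)).card * 0)) + 0))) := by
    refine ENNReal.Tendsto.const_mul (Filter.Tendsto.add ?_ (hE α hα).2) (Or.inr h2)
    refine ENNReal.Tendsto.const_mul (ENNReal.Tendsto.const_mul (tendsto_const_nhds.add
      (ENNReal.Tendsto.const_mul (tendsto_two_inv_pow_rpow hp)
        (Or.inr (ENNReal.natCast_ne_top _)))) (Or.inr h2)) (Or.inr ENNReal.coe_ne_top)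
  refine (ge_of_tendsto' hlim hbound).trans ?_
  rw [mul_zero, add_zero, add_zero, ENNReal.coe_mul, ENNReal.coe_mul,
    ENNReal.coe_rpow_of_nonneg _ (by linarith : 0 ≤ p - 1), ENNReal.coe_ofNat, mul_assoc, mul_assoc]
  gcongr

theorem IsStep.exists_vNorm_steinExt_le (hw : LipschitzWith M w)
    (haxis : axis ⊆ frontier (aboveGraph w)) (h : IsStep w η) (hψ : IsSteinKernel ψ)
    (hp : 1 ≤ p) :
    ∃ C : ℝ≥0, ∀ u, MemV (aboveGraph w) l δ p u →
      vNorm univ l δ p (steinExt w η ψ u) ≤ C * vNorm (aboveGraph w) l δ p u := by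
  have hax := volume_axis hw haxis
  have hp0 : 0 < p := by linarith
  choose! C hC using fun α (hα : α ∈ multiIdx l) =>
    h.exists_wInt_weakD_steinExt_le (δ := δ) hw haxis hψ hp hα
  refine ⟨(∑ α ∈ multiIdx l, C α) ^ p⁻¹, fun u hu => ?_⟩
  rw [← ENNReal.rpow_le_rpow_iff hp0, ENNReal.mul_rpow_of_nonneg _ _ hp0.le, vNorm_rpow hax hp,
    ENNReal.coe_rpow_of_nonneg _ (inv_nonneg.2 hp0.le), ENNReal.rpow_inv_rpow hp0.ne',
    ENNReal.ofNNReal_finsetSum, Finset.sum_mul]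
  exact Finset.sum_le_sum fun α hα => hC α hα u hu

/-- Extensions of test functions approximate the extension of u, but they may reach the axis. A
second approximation, by truncation near the axis, produces genuine test functions. -/
theorem IsStep.memV_steinExt (hw : LipschitzWith M w)
    (haxis : axis ⊆ frontier (aboveGraph w)) (h : IsStep w η) (hψ : IsSteinKernel ψ)
    (hp : 1 ≤ p) {u : R3 → ℝ} (hu : MemV (aboveGraph w) l δ p u) :
    MemV univ l δ p (steinExt w η ψ u) := by
  have hax := volume_axis hw haxis
  have hp0 : 0 < p := by linarith
  have h2 := two_rpow_ne_top hp
  obtain ⟨φ, hφ, -, hE⟩ := h.exists_approx_steinExt hw haxis hψ hp hu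
  obtain ⟨C, hC⟩ := h.exists_vNorm_steinExt_le (l := l) (δ := δ) hw haxis hψ hp
  have hflat := fun n => isAxisFlat_steinExt hw haxis h hψ (hφ n)
  refine ⟨fun α hα => (hE α hα).1,
    (hC u hu).trans_lt (ENNReal.mul_lt_top ENNReal.coe_lt_top hu.finite), fun ε hε => ?_⟩
  -- The error is measured in p-th powers, half of ε^p for each of the two approximations; the
  -- factor 2^{p−1} of the quasi-triangle inequality is already in the sums.
  have hε' : 0 < ε ^ p / 2 := ENNReal.half_pos (ENNReal.rpow_pos_of_nonneg hε hp0.le).ne'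
  have hlim1 : Filter.Tendsto (fun n => ∑ α ∈ multiIdx l, 2 ^ (p - 1) *
      wInt univ (δ - l + order α) p (weakD (univ \ axis) α (steinExt w η ψ u) -
        multiD α (steinExt w η ψ (φ n)))) Filter.atTop (nhds 0) := by
    have := tendsto_finsetSum (multiIdx l) fun α hα =>
      ENNReal.Tendsto.const_mul (hE α hα).2 (Or.inr h2)
    simpa using this
  obtain ⟨n, hn⟩ := (hlim1.eventually (gt_mem_nhds hε')).exists
  have hlim2 : Filter.Tendsto (fun k => ∑ α ∈ multiIdx l, 2 ^ (p - 1) *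
      wInt univ (δ - l + order α) p (multiD α (steinExt w η ψ (φ n) -
        axisTrunc (steinExt w η ψ (φ n)) k))) Filter.atTop (nhds 0) := by
    have := tendsto_finsetSum (multiIdx l) fun α _ =>
      ENNReal.Tendsto.const_mul ((hflat n).tendsto_wInt hax α (δ - l + order α) hp)
        (Or.inr h2)
    simp only [mul_zero, Finset.sum_const_zero] at this
    exact this
  obtain ⟨k, hk⟩ := (hlim2.eventually (gt_mem_nhds hε')).exists
  have hχ := (hflat n).isTestFunction_axisTrunc k
  refine ⟨_, hχ, ?_⟩
  rw [← ENNReal.rpow_lt_rpow_iff hp0, vNorm_rpow hax hp, ← ENNReal.add_halves (ε ^ p)]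
  refine lt_of_le_of_lt ?_ (ENNReal.add_lt_add hn hk)
  rw [← Finset.sum_add_distrib]
  refine Finset.sum_le_sum fun α hα => ?_
  have hd := ((hasWeakDeriv_weakD (hE α hα).1).sub
    (hasWeakDeriv_of_contDiff hχ.smooth α)).weakD_ae_eq (isOpen_univ.sdiff isClosed_axis)
  rw [restrict_diff_axis hax] at hd
  rw [wInt_congr_ae hd, ← mul_add, multiD_sub (hflat n).smooth hχ.smooth]
  have hm : AEStronglyMeasurable (weakD (univ \ axis) α (steinExt w η ψ u))
      (volume.restrict univ) := by
    rw [← restrict_diff_axis hax]; exact aestronglyMeasurable_weakD _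
  have := wInt_add_le (a := δ - l + order α) hp
    (g := multiD α (steinExt w η ψ (φ n)) - multiD α (axisTrunc (steinExt w η ψ (φ n)) k))
    (hm.sub ((hflat n).smooth.multiD α).continuous.aestronglyMeasurable)
  rwa [sub_add_sub_cancel] at this

theorem IsStep.isBoundedExtension (hw : LipschitzWith M w)
    (haxis : axis ⊆ frontier (aboveGraph w)) (h : IsStep w η) (hψ : IsSteinKernel ψ)
    (hp : 1 ≤ p) : IsBoundedExtension (aboveGraph w) l δ p (steinExt w η ψ) where
  congr_ae _ _ _ _ huv := h.steinExt_congr_ae hw huv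
  linear u v hu hv b c := by
    have hax := volume_axis hw haxis
    have hD := isOpen_aboveGraph hw
    exact h.steinExt_linear_ae hw haxis hψ hp (hu.aestronglyMeasurable hax)
      (hu.wInt_ne_top hax hD hp) (hv.aestronglyMeasurable hax) (hv.wInt_ne_top hax hD hp) b c
  extends_fun u _ := steinExt_ae_eq_restrict hw u
  maps _ hu := h.memV_steinExt hw haxis hψ hp hu
  bounded := h.exists_vNorm_steinExt_le hw haxis hψ hp

end

theorem theorem3p4 (M : ℝ≥0) (w : EuclideanSpace ℝ (Fin 2) → ℝ) (hw : LipschitzWith M w)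
    (haxis : axis ⊆ frontier (aboveGraph w)) :
    (∃ ψ : ℝ → ℝ, IsSteinKernel ψ) ∧
    (∃ δs : R3 → ℝ, IsSteinDist w δs) ∧
    ∀ (ψ : ℝ → ℝ) (δs : R3 → ℝ), IsSteinKernel ψ → IsSteinDist w δs →
      ∀ (l : ℕ) (δ p : ℝ), 1 ≤ p →
        IsBoundedExtension (aboveGraph w) l δ p (steinExt w δs ψ) :=
  ⟨exists_isSteinKernel, exists_isSteinDist hw, fun _ _ hψ hδ _ _ _ hp =>
    (isSteinDist_isStep hw hδ).isBoundedExtension hw haxis hψ hp⟩
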